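/- Let $q\in\mathbb C$ with $|q|>1$, and let $K=\mathbb C(\{z\})$ be the field of fractions of the ring of convergent power series (germs at $0$ of meromorphic functions), with the automorphism $\sigma_q f(z)=f(qz)$. For a commutative ring $R$ with an automorphism $\sigma$, a difference module over $(R,\sigma)$ is a pair $(E,\Phi)$ of a finitely generated projective $R$-module $E$ and an additive automorphism $\Phi$ of $E$ with $\Phi(\lambda x)=\sigma(\lambda)\Phi(x)$; equivalently, it is a left module over $R\langle\sigma,\sigma^{-1}\rangle$, $\sigma$ acting by $\Phi$. A difference module $M$ over $(K,\sigma_q)$ is pure isoclinic of slope $\mu\in\mathbb Q$ if $M\simeq \mathcal D/\mathcal D L$, where $\mathcal D=K\langle\sigma_q,\sigma_q^{-1}\rangle$ and $L=\sum_{i=0}^n a_i\sigma_q^i$ with $n\ge 1$, $a_0a_n\ne0$, has a Newton polygon with $\mu$ as only slope, i.e. $v_0(a_i)\ge v_0(a_0)+\mu i$ for all $0\le i\le n$, with equality for $i=n$, where $v_0$ is the $z$-adic valuation. Given difference modules $Q_1,\dots,Q_k$ over $(R,\sigma)$, let $\mathcal F(Q_1,\dots,Q_k)$ be the set of equivalence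 classes of pairs $(\underline M,\underline u)$, where $\underline M=(0=M_0\subset M_1\subset\cdots\subset M_k=M)$ is a difference module over $(R,\sigma)$ filtered by difference submodules and $\underline u=(u_i:M_i/M_{i-1}\simeq Q_i)_{1\le i\le k}$ is a family of isomorphisms of difference modules; $(\underline M,\underline u)$ and $(\underline M',\underline u')$ are equivalent if there is a morphism of filtered difference modules $f:M\to M'$ with $u'\circ\operatorname{gr} f=u$. **Theorem.** Let $P_1,\dots,P_k$ be pure isoclinic difference modules over $(K,\sigma_q)$, of ranks $r_1,\dots,r_k$ and slopes $\mu_1<\cdots<\mu_k$ in $\mathbb Q$. Consider the functor $F$ from commutative $\mathbb C$-algebras to sets $$F(C)=\mathcal F(C\otimes_{\mathbb C}P_1,\dots,C\otimes_{\mathbb C}P_k),$$ where $C\otimes_{\mathbb C}P_i$ is the difference module over $(C\otimes_{\mathbb C}K,\,1\otimes\sigma_q)$ obtained from $P_i$ by extension of scalars, and a morphism $C\to C'$ acts by extension of scalars $C'\otimes_C-$ on pairs $(\underline M,\underline u)$. Then $F$ is representable by an affine space over $\mathbb C$ of dimension $$d=\sum_{1\le i<j\le k} r_ir_j(\mu_j-\mu_i),$$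 that is, $d$ is a natural number and $F$ is isomorphic to the functor $C\mapsto \operatorname{Hom}_{\mathbb C\text{-alg}}(\mathbb C[T_1,\dots,T_d],C)$. -/

import Mathlib

open CategoryTheory
open scoped TensorProduct

universe u v w

namespace QDiff

theorem summable_shift (p : PowerSeries ℂ) (m : ℤ) (f : LaurentSeries ℂ)
    (hf : f = HahnSeries.single m 1 * (p : LaurentSeries ℂ)) {r : ℝ} (hr : 0 < r) :
    (Summable fun n : ℤ => ‖f.coeff n‖ * r ^ n) ↔
      Summable fun n : ℕ => ‖PowerSeries.coeff n p‖ * r ^ n := by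
  have hc : ∀ n : ℕ, f.coeff (n + m) = PowerSeries.coeff n p := by
    intro n
    rw [hf, HahnSeries.coeff_single_mul_add, one_mul]
    simp
  have hz : ∀ n : ℤ, n < m → f.coeff n = 0 := by
    intro n hn
    have : n = (n - m) + m := by ring
    rw [hf, this, HahnSeries.coeff_single_mul_add, one_mul, PowerSeries.coeff_coe]
    simp [sub_neg.mpr hn]
  have hi : Function.Injective (fun n : ℕ => (n : ℤ) + m) := by
    intro a b h; simpa using h
  rw [← hi.summable_iff]
  · have : ((fun n : ℤ => ‖f.coeff n‖ * r ^ n) ∘ fun n : ℕ => (n : ℤ) + m) =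
        fun n : ℕ => r ^ m * (‖PowerSeries.coeff n p‖ * r ^ n) := by
      funext n
      simp only [Function.comp, hc, zpow_add₀ hr.ne', zpow_natCast]
      ring
    rw [this, summable_mul_left_iff (zpow_pos hr m).ne']
  · intro n hn
    have : n < m := by
      by_contra h
      exact hn ⟨(n - m).toNat, by simp; omega⟩
    simp [hz n this]

/-- The power series `p` has positive radius of convergence. -/
def PConv (p : PowerSeries ℂ) : Prop :=
  ∃ r : ℝ, 0 < r ∧ Summable fun n : ℕ => ‖PowerSeries.coeff n p‖ * r ^ n

/-- The Laurent series `f` (with finitely many negative terms) converges absolutely on some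
punctured disc `0 < |z| ≤ r`, i.e. it is the expansion of a meromorphic germ at `0`. -/
def LConv (f : LaurentSeries ℂ) : Prop :=
  ∃ r : ℝ, 0 < r ∧ Summable fun n : ℤ => ‖f.coeff n‖ * r ^ n

theorem summable_of_le {p : PowerSeries ℂ} {r s : ℝ} (hr : 0 < r) (hrs : r ≤ s)
    (h : Summable fun n : ℕ => ‖PowerSeries.coeff n p‖ * s ^ n) :
    Summable fun n : ℕ => ‖PowerSeries.coeff n p‖ * r ^ n :=
  h.of_nonneg_of_le (fun n => by positivity) (fun n => by gcongr)

theorem PConv.mul {p p' : PowerSeries ℂ} (h : PConv p) (h' : PConv p') : PConv (p * p') := by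
  obtain ⟨r, hr, hs⟩ := h
  obtain ⟨r', hr', hs'⟩ := h'
  have hm : 0 < min r r' := lt_min hr hr'
  refine ⟨min r r', hm, ?_⟩
  set ρ := min r r'
  have h1 := summable_of_le hm (min_le_left r r') hs
  have h2 := summable_of_le hm (min_le_right r r') hs'
  have h1' : Summable fun n : ℕ => ‖PowerSeries.coeff n p * (ρ : ℂ) ^ n‖ := by
    simpa [abs_of_pos hm] using h1
  have h2' : Summable fun n : ℕ => ‖PowerSeries.coeff n p' * (ρ : ℂ) ^ n‖ := by
    simpa [abs_of_pos hm] using h2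
  have := summable_norm_sum_mul_antidiagonal_of_summable_norm h1' h2'
  refine this.congr fun n => ?_
  rw [PowerSeries.coeff_mul]
  have : ∑ kl ∈ Finset.HasAntidiagonal.antidiagonal n, PowerSeries.coeff kl.1 p * (ρ : ℂ) ^ kl.1 *
      (PowerSeries.coeff kl.2 p' * (ρ : ℂ) ^ kl.2) =
      (∑ kl ∈ Finset.HasAntidiagonal.antidiagonal n, PowerSeries.coeff kl.1 p * PowerSeries.coeff kl.2 p')
        * (ρ : ℂ) ^ n := by
    rw [Finset.sum_mul]
    refine Finset.sum_congr rfl fun x hx => ?_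
    rw [← Finset.HasAntidiagonal.mem_antidiagonal.mp hx, pow_add]; ring
  rw [this]
  simp [abs_of_pos hm]

theorem PConv.inv {p : PowerSeries ℂ} (h : PConv p) (h0 : PowerSeries.constantCoeff p ≠ 0) :
    PConv p⁻¹ := by
  obtain ⟨r, hr, hs⟩ := h
  -- every coefficient is bounded by a geometric sequence
  obtain ⟨M, hM⟩ : ∃ M : ℝ, ∀ n : ℕ, ‖PowerSeries.coeff n p‖ * r ^ n ≤ M :=
    ⟨_, fun n => hs.le_tsum n (fun j _ => by positivity)⟩
  set c := ‖(PowerSeries.constantCoeff p)⁻¹‖ with hc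
  have hcpos : 0 < c := norm_pos_iff.mpr (inv_ne_zero h0)
  have hM0 : 0 ≤ M := le_trans (by positivity) (hM 0)
  set B : ℝ := 1 + c * M with hB
  have hB1 : 1 ≤ B := by rw [hB]; nlinarith [mul_nonneg hcpos.le hM0]
  have key : ∀ n : ℕ, ‖PowerSeries.coeff n p⁻¹‖ * r ^ n ≤ c * B ^ n := by
    intro n
    induction n using Nat.strong_induction_on with
    | _ n ih =>
      rcases Nat.eq_zero_or_pos n with rfl | hn
      · simp [hc]
      · rw [PowerSeries.coeff_inv, if_neg hn.ne', norm_mul, norm_neg, ← hc]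
        have hsum : ‖∑ x ∈ Finset.HasAntidiagonal.antidiagonal n, if x.2 < n then
            PowerSeries.coeff x.1 p * PowerSeries.coeff x.2 p⁻¹ else 0‖ * r ^ n ≤
            ∑ j ∈ Finset.range n, M * (c * B ^ j) := by
          calc _ ≤ (∑ x ∈ Finset.HasAntidiagonal.antidiagonal n, ‖if x.2 < n then
              PowerSeries.coeff x.1 p * PowerSeries.coeff x.2 p⁻¹ else 0‖) * r ^ n := by
                gcongr; exact norm_sum_le _ _
            _ = ∑ x ∈ Finset.HasAntidiagonal.antidiagonal n, (if x.2 < n then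
              (‖PowerSeries.coeff x.1 p‖ * r ^ x.1) * (‖PowerSeries.coeff x.2 p⁻¹‖ * r ^ x.2)
                else 0) := by
                rw [Finset.sum_mul]
                refine Finset.sum_congr rfl fun x hx => ?_
                rw [← Finset.HasAntidiagonal.mem_antidiagonal.mp hx]
                split_ifs
                · rw [norm_mul, pow_add]; ring
                · simp
            _ ≤ ∑ x ∈ Finset.HasAntidiagonal.antidiagonal n, (if x.2 < n then M * (c * B ^ x.2) else 0) := by
                refine Finset.sum_le_sum fun x hx => ?_
                split_ifs with hlt
                · exact mul_le_mul (hM _) (ih _ hlt) (by positivity) hM0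
                · exact le_rfl
            _ = ∑ j ∈ Finset.range (n + 1), (if j < n then M * (c * B ^ j) else 0) := by
                rw [Finset.Nat.sum_antidiagonal_eq_sum_range_succ_mk, ← Finset.sum_range_reflect]
                refine Finset.sum_congr rfl fun j hj => ?_
                have := Finset.mem_range.mp hj
                have e : n - (n + 1 - 1 - j) = j := by omega
                simp only [e]
            _ = _ := by
                rw [Finset.sum_range_succ]
                simp only [lt_irrefl, if_false, add_zero]
                exact Finset.sum_congr rfl fun j hj => if_pos (Finset.mem_range.mp hj)
        have hgeo : ∀ n : ℕ, ∑ j ∈ Finset.range n, c * M * B ^ j = B ^ n - 1 := by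
          intro n
          have := geom_sum_mul B n
          rw [← Finset.mul_sum, ← this, hB]; ring
        calc _ = c * (‖∑ x ∈ Finset.HasAntidiagonal.antidiagonal n, if x.2 < n then
            PowerSeries.coeff x.1 p * PowerSeries.coeff x.2 p⁻¹ else 0‖ * r ^ n) := by ring
          _ ≤ c * ∑ j ∈ Finset.range n, M * (c * B ^ j) := by gcongr
          _ = c * (B ^ n - 1) := by
              rw [← hgeo]; congr 1; exact Finset.sum_congr rfl fun j _ => by ring
          _ ≤ c * B ^ n := by gcongr; linarith
  refine ⟨r / (2 * B), by positivity, ?_⟩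
  refine Summable.of_nonneg_of_le (fun n => by positivity) (fun n => ?_)
    ((summable_geometric_two).mul_left c)
  have hBn : 0 < B := by linarith
  calc ‖PowerSeries.coeff n p⁻¹‖ * (r / (2 * B)) ^ n
      = (‖PowerSeries.coeff n p⁻¹‖ * r ^ n) * (1 / (2 * B)) ^ n := by
        rw [div_eq_mul_one_div, mul_pow]; ring
    _ ≤ (c * B ^ n) * (1 / (2 * B)) ^ n := by exact mul_le_mul_of_nonneg_right (key n) (by positivity)
    _ = c * (1 / 2) ^ n := by
        rw [mul_assoc, ← mul_pow]; congr 2; field_simp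

theorem LConv_iff (p : PowerSeries ℂ) (m : ℤ) :
    LConv (HahnSeries.single m 1 * (p : LaurentSeries ℂ)) ↔ PConv p :=
  exists_congr fun _ => and_congr_right fun hr => summable_shift p m _ rfl hr

theorem LConv.exists_eq {f : LaurentSeries ℂ} (h : LConv f) : ∃ (p : PowerSeries ℂ), PConv p ∧ f = HahnSeries.single f.order 1 * (p : LaurentSeries ℂ) := by
  have e := f.single_order_mul_powerSeriesPart
  exact ⟨f.powerSeriesPart, by rwa [← LConv_iff _ f.order, e], e.symm⟩

theorem LConv.mul {f g : LaurentSeries ℂ} (hf : LConv f) (hg : LConv g) : LConv (f * g) := by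
  obtain ⟨p, hp, ef⟩ := hf.exists_eq
  obtain ⟨p', hp', eg⟩ := hg.exists_eq
  have : f * g = HahnSeries.single (f.order + g.order) 1 * ((p * p' : PowerSeries ℂ) : LaurentSeries ℂ) := by
    conv_lhs => rw [ef, eg]
    rw [PowerSeries.coe_mul, mul_mul_mul_comm, HahnSeries.single_mul_single, one_mul]
  rw [this, LConv_iff]
  exact hp.mul hp'

theorem LConv.mono {f : LaurentSeries ℂ} {r s : ℝ} (hr : 0 < r) (hrs : r ≤ s)
    (h : Summable fun n : ℤ => ‖f.coeff n‖ * s ^ n) : Summable fun n : ℤ => ‖f.coeff n‖ * r ^ n := by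
  have e := f.single_order_mul_powerSeriesPart.symm
  rw [summable_shift _ _ _ e hr]
  rw [summable_shift _ _ _ e (hr.trans_le hrs)] at h
  exact summable_of_le hr hrs h

theorem LConv.add {f g : LaurentSeries ℂ} (hf : LConv f) (hg : LConv g) : LConv (f + g) := by
  obtain ⟨r, hr, hs⟩ := hf
  obtain ⟨r', hr', hs'⟩ := hg
  have hm : 0 < min r r' := lt_min hr hr'
  refine ⟨min r r', hm, Summable.of_nonneg_of_le (fun n => by positivity) (fun n => ?_)
    ((LConv.mono hm (min_le_left _ _) hs).add (LConv.mono hm (min_le_right _ _) hs'))⟩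
  rw [← add_mul, HahnSeries.coeff_add]
  gcongr
  exact norm_add_le _ _

theorem LConv.inv {f : LaurentSeries ℂ} (hf : LConv f) : LConv f⁻¹ := by
  rcases eq_or_ne f 0 with rfl | h0
  · simpa using hf
  have e := f.single_order_mul_powerSeriesPart
  have hp : PConv f.powerSeriesPart := by rwa [← LConv_iff _ f.order, e]
  have hc : PowerSeries.constantCoeff f.powerSeriesPart ≠ 0 := by
    rw [← PowerSeries.coeff_zero_eq_constantCoeff_apply, LaurentSeries.powerSeriesPart_coeff]
    simpa using HahnSeries.coeff_order_eq_zero.not.mpr h0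
  have : f⁻¹ = HahnSeries.single (-f.order) 1 * ((f.powerSeriesPart⁻¹ : PowerSeries ℂ) : LaurentSeries ℂ) := by
    refine inv_eq_of_mul_eq_one_right ?_
    nth_rewrite 1 [← e]
    rw [mul_mul_mul_comm, HahnSeries.single_mul_single, ← PowerSeries.coe_mul,
      PowerSeries.mul_inv_cancel _ hc]
    simp
  rw [this, LConv_iff]
  exact hp.inv hc

theorem LConv.const (c : ℂ) : LConv (HahnSeries.C c) := by
  refine ⟨1, one_pos, summable_of_hasFiniteSupport (Set.Finite.subset (Set.finite_singleton 0) ?_)⟩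
  intro n hn
  by_contra h
  apply hn
  have h' : n ≠ 0 := h
  simp [HahnSeries.C_apply, HahnSeries.coeff_single_of_ne h']

/-- The field `ℂ({z})` of germs at `0` of meromorphic functions (convergent Laurent series), that is
the field of fractions of the ring of convergent power series. -/
def Ka : Subfield (LaurentSeries ℂ) where
  carrier := {f | LConv f}
  mul_mem' := LConv.mul
  add_mem' := LConv.add
  one_mem' := by simpa using LConv.const 1
  zero_mem' := by simpa using LConv.const 0
  neg_mem' {f} h := by
    have := (LConv.const (-1)).mul h
    rw [show HahnSeries.C (-1 : ℂ) * f = -f by rw [map_neg, map_one, neg_mul, one_mul]] at this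
    exact this
  inv_mem' _ h := LConv.inv h

/-- Complex numbers are viewed as constant series. -/
noncomputable instance : Algebra ℂ Ka :=
  ((HahnSeries.C : ℂ →+* LaurentSeries ℂ).codRestrict Ka LConv.const).toAlgebra

/-- The dilatation `f(z) ↦ f(q z)`, i.e. `∑ f_n z^n ↦ ∑ q^n f_n z^n`. -/
noncomputable def dil (q : ℂ) (f : LaurentSeries ℂ) : LaurentSeries ℂ where
  coeff n := q ^ n * f.coeff n
  isPWO_support' := f.isPWO_support.mono fun n hn => by
    simp only [Function.mem_support] at hn ⊢
    exact right_ne_zero_of_mul hn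

theorem dil_mul {q : ℂ} (hq : q ≠ 0) (f g : LaurentSeries ℂ) : dil q (f * g) = dil q f * dil q g := by
  have hs : ∀ f : LaurentSeries ℂ, (dil q f).support = f.support := by
    intro f; ext n; simp [dil, hq, zpow_ne_zero]
  ext n
  change q ^ n * (f * g).coeff n = (dil q f * dil q g).coeff n
  rw [HahnSeries.coeff_mul, HahnSeries.coeff_mul, Finset.mul_sum]
  refine Finset.sum_congr ?_ fun x hx => ?_
  · ext x; simp [hs]
  · rw [← (Finset.mem_antidiagonal.mp hx).2.2, zpow_add₀ hq]
    change _ = (q ^ x.1 * f.coeff x.1) * (q ^ x.2 * g.coeff x.2)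
    ring

theorem dil_mem {q : ℂ} (hq : q ≠ 0) {f : LaurentSeries ℂ} (hf : f ∈ Ka) : dil q f ∈ Ka := by
  obtain ⟨r, hr, hs⟩ := hf
  have hq' : 0 < ‖q‖ := norm_pos_iff.mpr hq
  refine ⟨r / ‖q‖, by positivity, hs.congr fun n => ?_⟩
  simp only [dil, norm_mul, norm_zpow, div_zpow]
  field_simp

theorem q_ne_zero {q : ℂ} (hq : 1 < ‖q‖) : q ≠ 0 := norm_pos_iff.mp (one_pos.trans hq)

/-- The automorphism `σ_q : f(z) ↦ f(q z)` of `ℂ({z})`. -/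
noncomputable def sigmaQ (q : ℂ) (hq : 1 < ‖q‖) : Ka ≃ₐ[ℂ] Ka where
  toFun f := ⟨dil q f, dil_mem (q_ne_zero hq) f.2⟩
  invFun f := ⟨dil q⁻¹ f, dil_mem (inv_ne_zero (q_ne_zero hq)) f.2⟩
  left_inv f := by
    ext n; simp [dil, q_ne_zero hq, zpow_ne_zero]
  right_inv f := by
    ext n; simp [dil, q_ne_zero hq, zpow_ne_zero]
  map_mul' f g := Subtype.ext (dil_mul (q_ne_zero hq) _ _)
  map_add' f g := by ext n; simp [dil, mul_add]
  commutes' c := by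
    ext n
    change q ^ n * (HahnSeries.C c).coeff n = (HahnSeries.C c).coeff n
    by_cases h : n = 0
    · subst h; simp
    · simp [HahnSeries.C_apply, HahnSeries.coeff_single_of_ne h]

/-- A difference module over the difference ring `(K, σ)`: a finitely generated projective
`K`-module `E` with a `σ`-linear automorphism `Φ`, i.e. a left module over the ring of difference
operators `K⟨σ, σ⁻¹⟩` (where `σ` acts by `Φ`) that is finitely generated projective over `K`. -/
structure DiffMod (K : Type u) [CommRing K] (σ : K ≃+* K) : Type (max u (w + 1)) where
  carrier : Type w
  [addCommGroup : AddCommGroup carrier]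
  [module : Module K carrier]
  [finite : Module.Finite K carrier]
  [projective : Module.Projective K carrier]
  Φ : carrier ≃+ carrier
  Φ_smul : ∀ (a : K) (x : carrier), Φ (a • x) = σ a • Φ x

namespace DiffMod
instance {K : Type u} [CommRing K] {σ : K ≃+* K} :
    CoeSort (DiffMod.{u, w} K σ) (Type w) := ⟨DiffMod.carrier⟩

attribute [instance] addCommGroup module finite projective
end DiffMod

/-- A pair `(M, u)` where `0 = M_0 ⊆ M_1 ⊆ ⋯ ⊆ M_k = M` is a difference module filtered by
difference submodules and `u = (u_i : M_i / M_{i-1} ≃ P_i)` is an isomorphism of difference modules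
from the associated graded module to `P_1 ⊕ ⋯ ⊕ P_k`. -/
structure FilteredPair {K : Type u} [CommRing K] {σ : K ≃+* K} {k : ℕ}
    (P : Fin k → DiffMod.{u, w} K σ) : Type (max u (w + 1)) where
  M : DiffMod.{u, w} K σ
  fil : Fin (k + 1) → Submodule K M
  fil_zero : fil 0 = ⊥
  fil_last : fil (Fin.last k) = ⊤
  fil_le : ∀ i : Fin k, fil i.castSucc ≤ fil i.succ
  Φ_mem_iff : ∀ (i : Fin (k + 1)) (x : M), M.Φ x ∈ fil i ↔ x ∈ fil i
  iso : ∀ i : Fin k, (fil i.succ ⧸ (fil i.castSucc).submoduleOf (fil i.succ)) ≃ₗ[K] P i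
  iso_Φ : ∀ (i : Fin k) (x : fil i.succ),
    iso i (Submodule.Quotient.mk ⟨M.Φ x, (Φ_mem_iff i.succ x).2 x.2⟩) =
      (P i).Φ (iso i (Submodule.Quotient.mk x))

namespace FilteredPair

section basic
variable {K : Type u} [CommRing K] {σ : K ≃+* K} {k : ℕ} {P : Fin k → DiffMod.{u, w} K σ}

/-- The composite `M_i → M_i / M_{i-1} ≃ P_i`. -/
def gr (X : FilteredPair P) (i : Fin k) : X.fil i.succ →ₗ[K] P i :=
  (X.iso i).toLinearMap ∘ₗ ((X.fil i.castSucc).submoduleOf (X.fil i.succ)).mkQ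

theorem gr_surjective (X : FilteredPair P) (i : Fin k) : Function.Surjective (X.gr i) :=
  (X.iso i).surjective.comp (Submodule.mkQ_surjective _)

theorem gr_eq_zero_iff (X : FilteredPair P) (i : Fin k) (x : X.fil i.succ) :
    X.gr i x = 0 ↔ (x : X.M) ∈ X.fil i.castSucc := by
  rw [gr, LinearMap.comp_apply, LinearEquiv.coe_coe, LinearEquiv.map_eq_zero_iff,
    Submodule.mkQ_apply, Submodule.Quotient.mk_eq_zero]
  rfl

theorem gr_Φ (X : FilteredPair P) (i : Fin k) (x : X.fil i.succ) :
    X.gr i ⟨X.M.Φ x, (X.Φ_mem_iff i.succ x).2 x.2⟩ = (P i).Φ (X.gr i x) :=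
  X.iso_Φ i x

/-- Constructor from surjections `M_i → P_i` with kernel `M_{i-1}`. -/
noncomputable def ofGr (M : DiffMod.{u, w} K σ) (fil : Fin (k + 1) → Submodule K M)
    (fil_zero : fil 0 = ⊥) (fil_last : fil (Fin.last k) = ⊤)
    (fil_le : ∀ i : Fin k, fil i.castSucc ≤ fil i.succ)
    (Φ_mem_iff : ∀ (i : Fin (k + 1)) (x : M), M.Φ x ∈ fil i ↔ x ∈ fil i)
    (g : ∀ i : Fin k, fil i.succ →ₗ[K] P i) (hs : ∀ i, Function.Surjective (g i))
    (hk : ∀ i x, g i x = 0 ↔ (x : M) ∈ fil i.castSucc)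
    (hΦ : ∀ (i : Fin k) (x : fil i.succ),
      g i ⟨M.Φ x, (Φ_mem_iff i.succ x).2 x.2⟩ = (P i).Φ (g i x)) : FilteredPair P where
  M := M
  fil := fil
  fil_zero := fil_zero
  fil_last := fil_last
  fil_le := fil_le
  Φ_mem_iff := Φ_mem_iff
  iso i := (Submodule.quotEquivOfEq _ (LinearMap.ker (g i)) (by
      ext x; simp [Submodule.submoduleOf, hk])).trans
    ((g i).quotKerEquivOfSurjective (hs i))
  iso_Φ i x := hΦ i x

/-- `(M, u) ∼ (M', u')`: there is a morphism `f : M → M'` of filtered difference modules such that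
`u' ∘ gr f = u`. (Such an `f` is automatically an isomorphism.) -/
def Equivalent (X Y : FilteredPair P) : Prop :=
  ∃ (f : X.M →ₗ[K] Y.M) (_ : ∀ x, f (X.M.Φ x) = Y.M.Φ (f x))
    (hf : ∀ i, ∀ x ∈ X.fil i, f x ∈ Y.fil i),
    ∀ (i : Fin k) (x : X.fil i.succ),
      Y.iso i (Submodule.Quotient.mk ⟨f x, hf i.succ x x.2⟩) =
        X.iso i (Submodule.Quotient.mk x)

theorem Equivalent.refl (X : FilteredPair P) : Equivalent X X :=
  ⟨LinearMap.id, fun _ => rfl, fun _ _ h => h, fun _ _ => rfl⟩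

theorem Equivalent.trans {X Y Z : FilteredPair P} (h : Equivalent X Y) (h' : Equivalent Y Z) :
    Equivalent X Z := by
  obtain ⟨f, hf, hfil, hgr⟩ := h
  obtain ⟨g, hg, hfil', hgr'⟩ := h'
  refine ⟨g ∘ₗ f, fun x => by simp [hf, hg], fun i x hx => hfil' i _ (hfil i x hx), fun i x => ?_⟩
  rw [← hgr i x]
  exact hgr' i ⟨f x, hfil i.succ x x.2⟩

theorem Equivalent.symm {X Y : FilteredPair P} (h : Equivalent X Y) : Equivalent Y X := by
  obtain ⟨f, hf, hfil, hgr⟩ := h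
  replace hgr : ∀ (i : Fin k) (x : X.fil i.succ),
      Y.gr i ⟨f x, hfil i.succ x x.2⟩ = X.gr i x := hgr
  have inj : ∀ (i : Fin (k + 1)), ∀ x ∈ X.fil i, f x = 0 → x = 0 := by
    intro i
    induction i using Fin.induction with
    | zero => intro x hx _; simpa [X.fil_zero] using hx
    | succ i ih =>
      intro x hx h0
      refine ih x ?_ h0
      rw [← X.gr_eq_zero_iff i ⟨x, hx⟩, ← hgr, Y.gr_eq_zero_iff]
      simp [h0]
  have surj : ∀ (i : Fin (k + 1)), ∀ y ∈ Y.fil i, ∃ x ∈ X.fil i, f x = y := by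
    intro i
    induction i using Fin.induction with
    | zero => intro y hy; exact ⟨0, zero_mem _, by simpa [Y.fil_zero, eq_comm] using hy⟩
    | succ i ih =>
      intro y hy
      obtain ⟨x, hx⟩ := X.gr_surjective i (Y.gr i ⟨y, hy⟩)
      have : Y.gr i (⟨y, hy⟩ - ⟨f x, hfil _ _ x.2⟩) = 0 := by rw [map_sub, hgr, hx, sub_self]
      rw [Y.gr_eq_zero_iff] at this
      obtain ⟨x', hx', e⟩ := ih _ this
      refine ⟨x' + x, add_mem (X.fil_le i hx') x.2, ?_⟩
      rw [map_add, e]; simp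
  have hinj : Function.Injective f := by
    rw [injective_iff_map_eq_zero]
    exact fun x hx => inj (Fin.last k) x (by simp [X.fil_last]) hx
  have hsurj : Function.Surjective f := fun y => by
    obtain ⟨x, -, e⟩ := surj (Fin.last k) y (by simp [Y.fil_last])
    exact ⟨x, e⟩
  let e := LinearEquiv.ofBijective f ⟨hinj, hsurj⟩
  have he : ∀ y, f (e.symm y) = y := fun y => e.apply_symm_apply y
  have hmem : ∀ i, ∀ y ∈ Y.fil i, e.symm y ∈ X.fil i := by
    intro i y hy
    obtain ⟨x, hx, rfl⟩ := surj i y hy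
    rwa [show e.symm (f x) = x from e.symm_apply_apply x]
  refine ⟨e.symm.toLinearMap, fun y => hinj ?_, hmem, fun i y => ?_⟩
  · simp [hf, he]
  · change X.gr i ⟨e.symm y, hmem _ _ y.2⟩ = Y.gr i y
    rw [← hgr]
    congr 1
    exact Subtype.ext (he y)

instance setoid (P : Fin k → DiffMod.{u, w} K σ) : Setoid (FilteredPair P) where
  r := Equivalent
  iseqv := ⟨Equivalent.refl, Equivalent.symm, Equivalent.trans⟩

end basic
end FilteredPair

section lift
variable {K : Type u} [CommRing K] {L : Type v} [CommRing L] [Algebra K L]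

/-- The `L`-linear map `L ⊗ M → N`, `a ⊗ x ↦ a • g x`. -/
noncomputable def liftSemi {M : Type*} [AddCommGroup M] [Module K M] {N : Type*} [AddCommGroup N]
    [Module L N] (g : M →ₛₗ[algebraMap K L] N) : L ⊗[K] M →ₗ[L] N :=
  letI : Module K N := Module.compHom N (algebraMap K L)
  haveI : IsScalarTower K L N := ⟨fun a b x => by
    rw [Algebra.smul_def, mul_smul]; rfl⟩
  LinearMap.liftBaseChange L
    { toFun := g, map_add' := map_add g, map_smul' := fun a x => g.map_smulₛₗ a x }

@[simp] theorem liftSemi_tmul {M : Type*} [AddCommGroup M] [Module K M] {N : Type*}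
    [AddCommGroup N] [Module L N] (g : M →ₛₗ[algebraMap K L] N) (a : L) (x : M) :
    liftSemi g (a ⊗ₜ[K] x) = a • g x := by
  simp [liftSemi]

end lift

namespace DiffMod
variable {K : Type u} [CommRing K] {L : Type v} [CommRing L] [Algebra K L]
  {σ : K ≃+* K} {τ : L ≃+* L}

/-- The additive map `τ ⊗ φ : s ⊗ x ↦ τ s ⊗ φ x`, for a `σ`-linear `φ`. -/
noncomputable def tensorMap (h : ∀ a, algebraMap K L (σ a) = τ (algebraMap K L a))
    {E : Type w} [AddCommGroup E] [Module K E] (φ : E ≃+ E)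
    (hφ : ∀ (a : K) (x : E), φ (a • x) = σ a • φ x) : L ⊗[K] E →+ L ⊗[K] E :=
  TensorProduct.liftAddHom
    { toFun := fun s =>
        { toFun := fun x => τ s ⊗ₜ[K] φ x
          map_zero' := by simp
          map_add' := by simp [TensorProduct.tmul_add] }
      map_zero' := by ext; simp
      map_add' := fun s t => by ext; simp [TensorProduct.add_tmul] }
    (fun a s x => by
      simp [hφ, Algebra.smul_def, ← h, TensorProduct.tmul_smul, TensorProduct.smul_tmul'])

@[simp] theorem tensorMap_tmul (h : ∀ a, algebraMap K L (σ a) = τ (algebraMap K L a))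
    {E : Type w} [AddCommGroup E] [Module K E] (φ : E ≃+ E)
    (hφ : ∀ (a : K) (x : E), φ (a • x) = σ a • φ x) (s : L) (x : E) :
    tensorMap h φ hφ (s ⊗ₜ x) = τ s ⊗ₜ φ x := rfl

theorem tensorMap_smul (h : ∀ a, algebraMap K L (σ a) = τ (algebraMap K L a))
    {E : Type w} [AddCommGroup E] [Module K E] (φ : E ≃+ E)
    (hφ : ∀ (a : K) (x : E), φ (a • x) = σ a • φ x) (a : L) (t : L ⊗[K] E) :
    tensorMap h φ hφ (a • t) = τ a • tensorMap h φ hφ t := by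
  induction t with
  | zero => simp
  | tmul s x =>
    rw [TensorProduct.smul_tmul', tensorMap_tmul, tensorMap_tmul, TensorProduct.smul_tmul']
    simp
  | add x y hx hy => rw [smul_add, map_add, map_add, hx, hy, smul_add]

theorem compat_symm (h : ∀ a, algebraMap K L (σ a) = τ (algebraMap K L a)) (a : K) :
    algebraMap K L (σ.symm a) = τ.symm (algebraMap K L a) := by
  apply τ.injective; rw [← h]; simp

theorem Φ_symm_smul (M : DiffMod.{u, w} K σ) (a : K) (x : M) :
    M.Φ.symm (a • x) = σ.symm a • M.Φ.symm x := by
  apply M.Φ.injective; rw [M.Φ_smul]; simp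

/-- Extension of scalars `(L ⊗_K E, τ ⊗ Φ)` along a morphism `(K, σ) → (L, τ)` of difference
rings. -/
noncomputable def tensor (h : ∀ a, algebraMap K L (σ a) = τ (algebraMap K L a))
    (M : DiffMod.{u, w} K σ) : DiffMod.{v, max v w} L τ where
  carrier := L ⊗[K] M
  Φ :=
    { tensorMap h M.Φ M.Φ_smul with
      invFun := tensorMap (compat_symm h) M.Φ.symm M.Φ_symm_smul
      left_inv := fun t => by
        simp only [ZeroHom.toFun_eq_coe, AddMonoidHom.toZeroHom_coe]
        induction t with
        | zero => exact (congrArg _ (map_zero _)).trans (map_zero _)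
        | tmul s x =>
          exact congrArg₂ (· ⊗ₜ[K] ·) (τ.symm_apply_apply s) (M.Φ.symm_apply_apply x)
        | add a b ha hb => rw [map_add, map_add, ha, hb]
      right_inv := fun t => by
        simp only [ZeroHom.toFun_eq_coe, AddMonoidHom.toZeroHom_coe]
        induction t with
        | zero => exact (congrArg _ (map_zero _)).trans (map_zero _)
        | tmul s x =>
          exact congrArg₂ (· ⊗ₜ[K] ·) (τ.apply_symm_apply s) (M.Φ.apply_symm_apply x)
        | add a b ha hb => rw [map_add, map_add, ha, hb] }
  Φ_smul := tensorMap_smul h M.Φ M.Φ_smul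

theorem tensor_Φ_tmul (h : ∀ a, algebraMap K L (σ a) = τ (algebraMap K L a))
    (M : DiffMod.{u, w} K σ) (s : L) (x : M) :
    (M.tensor h).Φ (s ⊗ₜ[K] x : L ⊗[K] M) = (τ s ⊗ₜ[K] M.Φ x : L ⊗[K] M) := rfl

end DiffMod

namespace FilteredPair
variable {K : Type u} [CommRing K] {L : Type v} [CommRing L] [Algebra K L]
  {σ : K ≃+* K} {τ : L ≃+* L} {k : ℕ} {P : Fin k → DiffMod.{u, w} K σ}

theorem exists_retraction (X : FilteredPair P) (i : Fin (k + 1)) :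
    ∃ r : X.M →ₗ[K] X.fil i, ∀ x : X.fil i, r x = x := by
  induction i using Fin.reverseInduction with
  | last =>
    exact ⟨LinearMap.codRestrict _ LinearMap.id (by simp [X.fil_last]), fun x => rfl⟩
  | cast i ih =>
    obtain ⟨r, hr⟩ := ih
    obtain ⟨s, hs⟩ := Module.projective_lifting_property (X.gr i) LinearMap.id (X.gr_surjective i)
    have hs' : ∀ y, X.gr i (s y) = y := fun y => LinearMap.congr_fun hs y
    let t : X.M →ₗ[K] X.fil i.succ := r - s ∘ₗ X.gr i ∘ₗ r
    have ht : ∀ x, (t x : X.M) ∈ X.fil i.castSucc := fun x => by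
      rw [← X.gr_eq_zero_iff]; simp [t, hs']
    refine ⟨LinearMap.codRestrict _ ((X.fil i.succ).subtype ∘ₗ t) ht, fun x => Subtype.ext ?_⟩
    have hx := X.fil_le i x.2
    have h1 : r x = ⟨x, hx⟩ := hr ⟨x, hx⟩
    have h2 : X.gr i ⟨x, hx⟩ = 0 := (X.gr_eq_zero_iff i _).2 x.2
    change ((r x - s (X.gr i (r x)) : X.fil i.succ) : X.M) = x
    rw [h1, h2, map_zero, sub_zero]

variable (L) in
theorem baseChange_subtype_injective (X : FilteredPair P) (i : Fin (k + 1)) :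
    Function.Injective ((X.fil i).subtype.baseChange L) := by
  obtain ⟨r, hr⟩ := X.exists_retraction i
  have : r ∘ₗ (X.fil i).subtype = LinearMap.id := LinearMap.ext hr
  refine Function.LeftInverse.injective (g := r.baseChange L) fun t => ?_
  rw [← LinearMap.comp_apply, ← LinearMap.baseChange_comp, this, LinearMap.baseChange_id]; rfl

variable (L) in
/-- `L ⊗ M_i` is the `i`-th step of the filtration of `L ⊗ M`. -/
noncomputable def filEquiv (X : FilteredPair P) (i : Fin (k + 1)) :
    (L ⊗[K] X.fil i) ≃ₗ[L] (X.fil i).baseChange L :=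
  LinearEquiv.ofInjective _ (X.baseChange_subtype_injective L i)

theorem filEquiv_coe (X : FilteredPair P) (i : Fin (k + 1)) (t : L ⊗[K] X.fil i) :
    (X.filEquiv L i t : L ⊗[K] X.M) = (X.fil i).subtype.baseChange L t := rfl

theorem mem_of_mapsTo (X : FilteredPair P) (i : Fin (k + 1)) {φ : X.M ≃+ X.M} {ρ : K ≃+* K}
    {ρ' : L ≃+* L} (h : ∀ a, algebraMap K L (ρ a) = ρ' (algebraMap K L a))
    (hφ : ∀ (a : K) (x : X.M), φ (a • x) = ρ a • φ x) (hm : ∀ x ∈ X.fil i, φ x ∈ X.fil i)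
    (t : L ⊗[K] X.M) (ht : t ∈ (X.fil i).baseChange L) :
    DiffMod.tensorMap h φ hφ t ∈ (X.fil i).baseChange L := by
  obtain ⟨t, rfl⟩ : ∃ t', (X.filEquiv L i t' : L ⊗[K] X.M) = t :=
    ⟨(X.filEquiv L i).symm ⟨t, ht⟩, by simp⟩
  rw [filEquiv_coe]
  induction t with
  | zero => simp
  | tmul s x => simpa using Submodule.tmul_mem_baseChange_of_mem _ (hm x x.2)
  | add a b ha hb =>
    rw [map_add, map_add]
    exact add_mem (ha (Subtype.coe_prop _)) (hb (Subtype.coe_prop _))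

/-- The map `L ⊗ M_i → L ⊗ P_i = Q_i`. -/
noncomputable def tensorGr (X : FilteredPair P) {Q : Fin k → DiffMod.{v, max v w} L τ}
    (p : ∀ i, P i →ₛₗ[algebraMap K L] Q i) (i : Fin k) :
    (X.fil i.succ).baseChange L →ₗ[L] Q i :=
  liftSemi ((p i).comp (X.gr i)) ∘ₗ (X.filEquiv L i.succ).symm.toLinearMap

theorem tensorGr_filEquiv (X : FilteredPair P) {Q : Fin k → DiffMod.{v, max v w} L τ}
    (p : ∀ i, P i →ₛₗ[algebraMap K L] Q i) (i : Fin k) (t : L ⊗[K] X.fil i.succ) :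
    X.tensorGr p i (X.filEquiv L i.succ t) = liftSemi (p i) ((X.gr i).baseChange L t) := by
  simp only [tensorGr, LinearMap.comp_apply, LinearEquiv.coe_coe, LinearEquiv.symm_apply_apply]
  induction t with
  | zero => simp
  | tmul s x => simp
  | add a b ha hb => rw [map_add, map_add, map_add, ha, hb]

theorem tensorGr_eq_zero_iff (X : FilteredPair P) {Q : Fin k → DiffMod.{v, max v w} L τ}
    (p : ∀ i, P i →ₛₗ[algebraMap K L] Q i)
    (hp : ∀ i, Function.Bijective (liftSemi (p i))) (i : Fin k)
    (y : (X.fil i.succ).baseChange L) :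
    X.tensorGr p i y = 0 ↔ (y : L ⊗[K] X.M) ∈ (X.fil i.castSucc).baseChange L := by
  obtain ⟨t, rfl⟩ := (X.filEquiv L i.succ).surjective y
  rw [tensorGr_filEquiv, map_eq_zero_iff _ (hp i).1]
  have hex : Function.Exact (Submodule.inclusion (X.fil_le i)) (X.gr i) := fun x => by
    rw [X.gr_eq_zero_iff]
    exact ⟨fun hx => ⟨⟨x, hx⟩, rfl⟩, by rintro ⟨z, rfl⟩; exact z.2⟩
  have key : ∀ z, (X.fil i.succ).subtype.baseChange L
      ((Submodule.inclusion (X.fil_le i)).baseChange L z) =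
      (X.fil i.castSucc).subtype.baseChange L z := fun z => by
    rw [← LinearMap.comp_apply, ← LinearMap.baseChange_comp]; rfl
  refine (lTensor_exact L hex (X.gr_surjective i) t).trans ⟨?_, ?_⟩
  · rintro ⟨z, rfl⟩
    exact ⟨z, (key z).symm⟩
  · rintro ⟨z, hz⟩
    exact ⟨z, X.baseChange_subtype_injective L i.succ ((key z).trans hz)⟩

theorem tensorGr_Φ (h : ∀ a, algebraMap K L (σ a) = τ (algebraMap K L a))
    (X : FilteredPair P) {Q : Fin k → DiffMod.{v, max v w} L τ}
    (p : ∀ i, P i →ₛₗ[algebraMap K L] Q i)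
    (hpΦ : ∀ i x, p i ((P i).Φ x) = (Q i).Φ (p i x)) (i : Fin k)
    (y : (X.fil i.succ).baseChange L) :
    X.tensorGr p i ⟨DiffMod.tensorMap h X.M.Φ X.M.Φ_smul y,
      X.mem_of_mapsTo i.succ h X.M.Φ_smul (fun x hx => (X.Φ_mem_iff i.succ x).2 hx) y y.2⟩ =
      (Q i).Φ (X.tensorGr p i y) := by
  obtain ⟨t, rfl⟩ := (X.filEquiv L i.succ).surjective y
  have : ∀ t : L ⊗[K] X.fil i.succ, ∃ t' : L ⊗[K] X.fil i.succ,
      DiffMod.tensorMap h X.M.Φ X.M.Φ_smul (X.filEquiv L i.succ t) =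
        X.filEquiv L i.succ t' ∧
      liftSemi (p i) ((X.gr i).baseChange L t') =
        (Q i).Φ (liftSemi (p i) ((X.gr i).baseChange L t)) := by
    intro t
    induction t with
    | zero => exact ⟨0, by simp, by simp⟩
    | tmul s x =>
      refine ⟨τ s ⊗ₜ ⟨X.M.Φ x, (X.Φ_mem_iff i.succ x).2 x.2⟩, rfl, ?_⟩
      simp [X.gr_Φ, hpΦ, (Q i).Φ_smul]
    | add a b ha hb =>
      obtain ⟨a', ha, ha'⟩ := ha
      obtain ⟨b', hb, hb'⟩ := hb
      refine ⟨a' + b', ?_, ?_⟩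
      · rw [map_add, map_add, Submodule.coe_add, Submodule.coe_add, map_add, ha, hb]
      · rw [map_add, map_add, ha', hb', map_add, map_add, map_add]
  obtain ⟨t', h1, h2⟩ := this t
  rw [tensorGr_filEquiv, ← h2, ← tensorGr_filEquiv]
  congr 1
  exact Subtype.ext h1

/-- Extension of scalars of a filtered difference module with prescribed graded module `P`,
where `p` exhibits each `Q i` as the extension of scalars of `P i`. -/
noncomputable def tensor (h : ∀ a, algebraMap K L (σ a) = τ (algebraMap K L a))
    (X : FilteredPair P) {Q : Fin k → DiffMod.{v, max v w} L τ}
    (p : ∀ i, P i →ₛₗ[algebraMap K L] Q i)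
    (hp : ∀ i, Function.Bijective (liftSemi (p i)))
    (hpΦ : ∀ i x, p i ((P i).Φ x) = (Q i).Φ (p i x)) : FilteredPair Q :=
  ofGr (X.M.tensor h) (fun i => (X.fil i).baseChange L)
    (by rw [X.fil_zero]; exact Submodule.baseChange_bot _)
    (by rw [X.fil_last]; exact Submodule.baseChange_top _)
    (fun i => Submodule.baseChange_mono L (X.fil_le i))
    (fun i t => by
      constructor
      · intro ht
        have := X.mem_of_mapsTo i (φ := X.M.Φ.symm) (DiffMod.compat_symm h)
          X.M.Φ_symm_smul (fun x hx => by
            rw [← X.Φ_mem_iff]; simpa using hx) _ ht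
        exact ((X.M.tensor h).Φ.symm_apply_apply t) ▸ this
      · exact X.mem_of_mapsTo i h X.M.Φ_smul (fun x hx => (X.Φ_mem_iff i x).2 hx) t)
    (X.tensorGr p)
    (fun i => by
      intro y
      obtain ⟨t, rfl⟩ := (hp i).2 y
      obtain ⟨t, rfl⟩ := LinearMap.lTensor_surjective L (X.gr_surjective i) t
      exact ⟨X.filEquiv L i.succ t, X.tensorGr_filEquiv p i t⟩)
    (X.tensorGr_eq_zero_iff p hp)
    (X.tensorGr_Φ h p hpΦ)

theorem liftSemi_tensorMap (h : ∀ a, algebraMap K L (σ a) = τ (algebraMap K L a))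
    (M : DiffMod.{u, w} K σ) {N : DiffMod.{v, max v w} L τ} (g : M →ₛₗ[algebraMap K L] N)
    (hg : ∀ x, g (M.Φ x) = N.Φ (g x)) (t : L ⊗[K] M) :
    liftSemi g (DiffMod.tensorMap h M.Φ M.Φ_smul t) = N.Φ (liftSemi g t) := by
  induction t with
  | zero => simp
  | tmul s x =>
    refine (liftSemi_tmul g (τ s) (M.Φ x)).trans ?_
    rw [hg, liftSemi_tmul, N.Φ_smul]
  | add a b ha hb => rw [map_add, map_add, map_add, map_add, ha, hb]

theorem tensor_equivalent (h : ∀ a, algebraMap K L (σ a) = τ (algebraMap K L a))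
    (X : FilteredPair P) {Q : Fin k → DiffMod.{v, max v w} L τ}
    (p : ∀ i, P i →ₛₗ[algebraMap K L] Q i)
    (hp : ∀ i, Function.Bijective (liftSemi (p i)))
    (hpΦ : ∀ i x, p i ((P i).Φ x) = (Q i).Φ (p i x))
    (Y : FilteredPair Q) (g : X.M →ₛₗ[algebraMap K L] Y.M)
    (hg : ∀ x, g (X.M.Φ x) = Y.M.Φ (g x)) (hfil : ∀ i, ∀ x ∈ X.fil i, g x ∈ Y.fil i)
    (hgr : ∀ i (x : X.fil i.succ), Y.gr i ⟨g x, hfil i.succ x x.2⟩ = p i (X.gr i x)) :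
    Equivalent (X.tensor h p hp hpΦ) Y := by
  have hmem : ∀ i, ∀ t : L ⊗[K] X.fil i, liftSemi g (X.filEquiv L i t) ∈ Y.fil i := by
    intro i t
    induction t with
    | zero => simp
    | tmul s x =>
      change liftSemi g (s ⊗ₜ (x : X.M)) ∈ _
      rw [liftSemi_tmul]
      exact Submodule.smul_mem _ _ (hfil i x x.2)
    | add a b ha hb => rw [map_add, Submodule.coe_add, map_add]; exact add_mem ha hb
  have hmem' : ∀ i, ∀ t ∈ (X.fil i).baseChange L, liftSemi g t ∈ Y.fil i := fun i t ht => by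
    obtain ⟨t', e⟩ := (X.filEquiv L i).surjective ⟨t, ht⟩
    have := hmem i t'
    rwa [e] at this
  refine ⟨liftSemi g, fun t => ?_, hmem', fun i t => ?_⟩
  · exact liftSemi_tensorMap h X.M g hg t
  · obtain ⟨t, rfl⟩ := (X.filEquiv L i.succ).surjective t
    change Y.gr i ⟨liftSemi g (X.filEquiv L i.succ t), hmem i.succ t⟩ =
      X.tensorGr p i (X.filEquiv L i.succ t)
    rw [tensorGr_filEquiv]
    induction t with
    | zero =>
      have : (⟨liftSemi g (X.filEquiv L i.succ 0), hmem i.succ 0⟩ : Y.fil i.succ) = 0 :=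
        Subtype.ext (by
          change liftSemi g (X.filEquiv L i.succ 0) = 0
          rw [map_zero, Submodule.coe_zero, map_zero])
      rw [this, map_zero, map_zero, map_zero]
    | tmul s x =>
      have : (⟨liftSemi g (X.filEquiv L i.succ (s ⊗ₜ x)), hmem i.succ (s ⊗ₜ x)⟩ : Y.fil i.succ) =
          s • ⟨g x, hfil i.succ x x.2⟩ := Subtype.ext (liftSemi_tmul g s (x : X.M))
      rw [this, map_smul, hgr]
      simp
    | add a b ha hb =>
      have : (⟨liftSemi g (X.filEquiv L i.succ (a + b)), hmem i.succ (a + b)⟩ : Y.fil i.succ) =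
          ⟨liftSemi g (X.filEquiv L i.succ a), hmem i.succ a⟩ +
          ⟨liftSemi g (X.filEquiv L i.succ b), hmem i.succ b⟩ :=
        Subtype.ext (by
          change liftSemi g (X.filEquiv L i.succ (a + b)) = liftSemi g _ + liftSemi g _
          rw [map_add, Submodule.coe_add, map_add])
      rw [this, map_add, ha, hb, map_add, map_add]

/-- The canonical map `M → L ⊗ M`, `x ↦ 1 ⊗ x`. -/
theorem tensor_exists_unit (h : ∀ a, algebraMap K L (σ a) = τ (algebraMap K L a))
    (X : FilteredPair P) {Q : Fin k → DiffMod.{v, max v w} L τ}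
    (p : ∀ i, P i →ₛₗ[algebraMap K L] Q i)
    (hp : ∀ i, Function.Bijective (liftSemi (p i)))
    (hpΦ : ∀ i x, p i ((P i).Φ x) = (Q i).Φ (p i x)) :
    ∃ g : X.M →ₛₗ[algebraMap K L] (X.tensor h p hp hpΦ).M,
      (∀ x, g (X.M.Φ x) = (X.tensor h p hp hpΦ).M.Φ (g x)) ∧
      ∃ hfil : ∀ i, ∀ x ∈ X.fil i, g x ∈ (X.tensor h p hp hpΦ).fil i,
      ∀ i (x : X.fil i.succ), (X.tensor h p hp hpΦ).gr i ⟨g x, hfil i.succ x x.2⟩ =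
        p i (X.gr i x) := by
  let g : X.M →ₛₗ[algebraMap K L] L ⊗[K] X.M :=
    { toFun := fun x => 1 ⊗ₜ x
      map_add' := fun x y => TensorProduct.tmul_add _ _ _
      map_smul' := fun a x => by
        rw [TensorProduct.tmul_smul, algebraMap_smul] }
  refine ⟨g, fun x => ?_, fun i x hx => Submodule.tmul_mem_baseChange_of_mem 1 hx, fun i x => ?_⟩
  · exact congrArg (· ⊗ₜ[K] X.M.Φ x) (map_one τ).symm
  · refine (X.tensorGr_filEquiv p i (1 ⊗ₜ x)).trans ?_
    simp

end FilteredPair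

section transition
variable {R : Type u} [CommRing R] {K : Type v} [CommRing K] {L : Type v} [CommRing L]
  [Algebra R K] [Algebra R L] [Algebra K L] [IsScalarTower R K L]

variable (K L) in
/-- The canonical map `K ⊗ M → L ⊗ M`, `a ⊗ x ↦ a ⊗ x`, attached to `R → K → L`. -/
noncomputable def transition (M : Type w) [AddCommGroup M] [Module R M] :
    K ⊗[R] M →ₛₗ[algebraMap K L] L ⊗[R] M where
  toFun := (IsScalarTower.toAlgHom R K L).toLinearMap.rTensor M
  map_add' := map_add _
  map_smul' a t := by
    induction t with
    | zero => simp
    | tmul s x => simp [TensorProduct.smul_tmul', Algebra.smul_def]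
    | add x y hx hy => rw [smul_add, map_add, map_add, hx, hy, smul_add]

@[simp] theorem transition_tmul (M : Type w) [AddCommGroup M] [Module R M] (a : K) (x : M) :
    transition K L M (a ⊗ₜ[R] x) = algebraMap K L a ⊗ₜ[R] x := by
  simp [transition]

theorem liftSemi_transition_bijective (M : Type w) [AddCommGroup M] [Module R M] :
    Function.Bijective (liftSemi (transition K L M : K ⊗[R] M →ₛₗ[algebraMap K L] L ⊗[R] M)) := by
  have : (liftSemi (transition K L M : K ⊗[R] M →ₛₗ[algebraMap K L] L ⊗[R] M)) =
      (TensorProduct.AlgebraTensorModule.cancelBaseChange R K L L M).toLinearMap := by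
    ext; simp
  rw [this]
  exact (TensorProduct.AlgebraTensorModule.cancelBaseChange R K L L M).bijective

theorem transition_Φ {ρ : R ≃+* R} {σ : K ≃+* K} {τ : L ≃+* L}
    (hK : ∀ a, algebraMap R K (ρ a) = σ (algebraMap R K a))
    (hL : ∀ a, algebraMap R L (ρ a) = τ (algebraMap R L a))
    (h : ∀ a, algebraMap K L (σ a) = τ (algebraMap K L a)) (M : DiffMod.{u, w} R ρ)
    (t : K ⊗[R] M) :
    transition K L M (DiffMod.tensorMap hK M.Φ M.Φ_smul t) =
      DiffMod.tensorMap hL M.Φ M.Φ_smul (transition K L M t) := by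
  induction t with
  | zero => simp
  | tmul s x =>
    rw [DiffMod.tensorMap_tmul, transition_tmul, transition_tmul, DiffMod.tensorMap_tmul, h]
  | add x y hx hy => rw [map_add, map_add, map_add, map_add, hx, hy]

end transition

section functor
attribute [local instance] Algebra.TensorProduct.rightAlgebra

variable {K : Type} [CommRing K] [Algebra ℂ K] (σ : K ≃ₐ[ℂ] K)

/-- The automorphism `1 ⊗ σ` of `A ⊗ K`. -/
noncomputable def extAut (A : Type u) [CommRing A] [Algebra ℂ A] : A ⊗[ℂ] K ≃+* A ⊗[ℂ] K :=
  (Algebra.TensorProduct.congr (AlgEquiv.refl : A ≃ₐ[ℂ] A) σ).toRingEquiv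

@[simp] theorem extAut_tmul (A : Type u) [CommRing A] [Algebra ℂ A] (a : A) (x : K) :
    extAut σ A (a ⊗ₜ x) = a ⊗ₜ σ x := by
  simp [extAut]

theorem extAut_algebraMap (A : Type u) [CommRing A] [Algebra ℂ A] (x : K) :
    algebraMap K (A ⊗[ℂ] K) (σ.toRingEquiv x) = extAut σ A (algebraMap K (A ⊗[ℂ] K) x) :=
  (extAut_tmul σ A 1 x).symm

/-- The ring homomorphism `φ ⊗ 1 : A ⊗ K → B ⊗ K`. -/
noncomputable def extMap (K : Type) [CommRing K] [Algebra ℂ K] {A B : Type u} [CommRing A]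
    [Algebra ℂ A] [CommRing B] [Algebra ℂ B] (φ : A →ₐ[ℂ] B) : A ⊗[ℂ] K →+* B ⊗[ℂ] K :=
  (Algebra.TensorProduct.map φ (AlgHom.id ℂ K)).toRingHom

@[simp] theorem extMap_tmul {A B : Type u} [CommRing A]
    [Algebra ℂ A] [CommRing B] [Algebra ℂ B] (φ : A →ₐ[ℂ] B) (a : A) (x : K) :
    extMap K φ (a ⊗ₜ x) = φ a ⊗ₜ x := by
  simp [extMap]

theorem extMap_extAut {A B : Type u} [CommRing A] [Algebra ℂ A] [CommRing B] [Algebra ℂ B]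
    (φ : A →ₐ[ℂ] B) (t : A ⊗[ℂ] K) :
    extMap K φ (extAut σ A t) = extAut σ B (extMap K φ t) := by
  induction t with
  | zero => simp
  | tmul a x => simp
  | add x y hx hy => rw [map_add, map_add, map_add, map_add, hx, hy]

/-- The difference module `A ⊗_ℂ M = (A ⊗_ℂ K) ⊗_K M` over `(A ⊗_ℂ K, 1 ⊗ σ)`. -/
noncomputable def DiffMod.ext (M : DiffMod.{0, v} K σ.toRingEquiv)
    (A : Type u) [CommRing A] [Algebra ℂ A] :
    DiffMod.{u, max u v} (A ⊗[ℂ] K) (extAut σ A) :=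
  M.tensor (extAut_algebraMap σ A)

variable {σ} {k : ℕ} (P : Fin k → DiffMod.{0, v} K σ.toRingEquiv)

section map
variable {A B : Type u} [CommRing A] [Algebra ℂ A] [CommRing B] [Algebra ℂ B] (φ : A →ₐ[ℂ] B)

theorem isScalarTower_ext : letI := (extMap K φ).toAlgebra
    IsScalarTower K (A ⊗[ℂ] K) (B ⊗[ℂ] K) := by
  let := (extMap K φ).toAlgebra
  refine IsScalarTower.of_algebraMap_eq fun x => ?_
  change (1 : B) ⊗ₜ[ℂ] x = extMap K φ (1 ⊗ₜ x)
  simp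

/-- The canonical map `φ ⊗ 1 : A ⊗ M → B ⊗ M`. -/
noncomputable def extTransition (M : DiffMod.{0, v} K σ.toRingEquiv) :
    M.ext σ A →ₛₗ[extMap K φ] M.ext σ B :=
  letI := (extMap K φ).toAlgebra
  haveI := isScalarTower_ext (K := K) φ
  transition (A ⊗[ℂ] K) (B ⊗[ℂ] K) M

/-- Extension of scalars along `φ : A → B` of a filtered difference module over `A ⊗ K` with
graded module identified with `A ⊗ P_1 ⊕ ⋯ ⊕ A ⊗ P_k`. -/
noncomputable def FilteredPair.extend (X : FilteredPair fun i => (P i).ext σ A) :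
    FilteredPair fun i => (P i).ext σ B :=
  letI := (extMap K φ).toAlgebra
  haveI := isScalarTower_ext (K := K) φ
  X.tensor (extMap_extAut σ φ) (fun i => extTransition φ (P i))
    (fun i => liftSemi_transition_bijective (P i))
    (fun i => transition_Φ (extAut_algebraMap σ A) (extAut_algebraMap σ B)
      (extMap_extAut σ φ) (P i))

theorem FilteredPair.extend_equivalent (X : FilteredPair fun i => (P i).ext σ A)
    (Y : FilteredPair fun i => (P i).ext σ B) (g : X.M →ₛₗ[extMap K φ] Y.M)
    (hg : ∀ x, g (X.M.Φ x) = Y.M.Φ (g x)) (hfil : ∀ i, ∀ x ∈ X.fil i, g x ∈ Y.fil i)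
    (hgr : ∀ i (x : X.fil i.succ),
      Y.gr i ⟨g x, hfil i.succ x x.2⟩ = extTransition φ (P i) (X.gr i x)) :
    Equivalent (X.extend P φ) Y :=
  let := (extMap K φ).toAlgebra
  have := isScalarTower_ext (K := K) φ
  X.tensor_equivalent (extMap_extAut σ φ) (fun i => extTransition φ (P i)) _ _ Y g hg hfil hgr

/-- The canonical map `X → B ⊗_A X`, `x ↦ 1 ⊗ x`. -/
theorem FilteredPair.exists_unit (X : FilteredPair fun i => (P i).ext σ A) :
    ∃ g : X.M →ₛₗ[extMap K φ] (X.extend P φ).M,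
      (∀ x, g (X.M.Φ x) = (X.extend P φ).M.Φ (g x)) ∧
      ∃ hfil : ∀ i, ∀ x ∈ X.fil i, g x ∈ (X.extend P φ).fil i,
      ∀ i (x : X.fil i.succ), (X.extend P φ).gr i ⟨g x, hfil i.succ x x.2⟩ =
        extTransition φ (P i) (X.gr i x) := by
  let := (extMap K φ).toAlgebra
  have := isScalarTower_ext (K := K) φ
  exact X.tensor_exists_unit (extMap_extAut σ φ) (fun i => extTransition φ (P i)) _ _

end map

/-- The set `F(A) = ℱ(A ⊗ P_1, …, A ⊗ P_k)`. -/
def IsoClasses (A : Type u) [CommRing A] [Algebra ℂ A] : Type (max (u + 1) (v + 1)) :=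
  Quotient (FilteredPair.setoid fun i => (P i).ext σ A)

/-- The map `F(A) → F(B)`, class of `X` ↦ class of `B ⊗_A X`. -/
noncomputable def IsoClasses.map {A B : Type u} [CommRing A] [Algebra ℂ A] [CommRing B]
    [Algebra ℂ B] (φ : A →ₐ[ℂ] B) : IsoClasses P A → IsoClasses P B :=
  Quotient.map (FilteredPair.extend P φ) (by
    rintro X Y ⟨f, hf, hfil, hgr⟩
    obtain ⟨g, hg, hfil', hgr'⟩ := Y.exists_unit P φ
    refine X.extend_equivalent P φ _ (g.comp f) (fun x => ?_)
      (fun i x hx => hfil' i _ (hfil i x hx)) (fun i x => ?_)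
    · simp [hf, hg]
    · exact (hgr' i ⟨f x, hfil i.succ x x.2⟩).trans (congrArg _ (hgr i x)))

theorem extMap_id_apply {A : Type u} [CommRing A] [Algebra ℂ A] (t : A ⊗[ℂ] K) :
    extMap K (AlgHom.id ℂ A) t = t := by
  simp [extMap]

theorem extMap_comp_apply {A B D : Type u} [CommRing A] [Algebra ℂ A] [CommRing B] [Algebra ℂ B]
    [CommRing D] [Algebra ℂ D] (φ : A →ₐ[ℂ] B) (ψ : B →ₐ[ℂ] D) (t : A ⊗[ℂ] K) :
    extMap K ψ (extMap K φ t) = extMap K (ψ.comp φ) t := by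
  induction t with
  | zero => simp
  | tmul a x => simp
  | add x y hx hy => rw [map_add, map_add, map_add, hx, hy]

theorem extTransition_tmul {A B : Type u} [CommRing A] [Algebra ℂ A] [CommRing B] [Algebra ℂ B]
    (φ : A →ₐ[ℂ] B) (M : DiffMod.{0, v} K σ.toRingEquiv) (a : A ⊗[ℂ] K) (x : M) :
    extTransition φ M (a ⊗ₜ[K] x : (A ⊗[ℂ] K) ⊗[K] M) =
      (extMap K φ a ⊗ₜ[K] x : (B ⊗[ℂ] K) ⊗[K] M) := by
  let := (extMap K φ).toAlgebra
  have := isScalarTower_ext (K := K) φ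
  exact transition_tmul (K := A ⊗[ℂ] K) (L := B ⊗[ℂ] K) M a x

theorem extTransition_id {A : Type u} [CommRing A] [Algebra ℂ A]
    (M : DiffMod.{0, v} K σ.toRingEquiv) (t : M.ext σ A) :
    extTransition (AlgHom.id ℂ A) M t = t := by
  change extTransition (AlgHom.id ℂ A) M (show (A ⊗[ℂ] K) ⊗[K] M from t) = t
  refine TensorProduct.induction_on (motive := fun t : (A ⊗[ℂ] K) ⊗[K] M =>
    extTransition (AlgHom.id ℂ A) M t = t) _ (map_zero _) (fun a x => ?_) (fun x y hx hy => ?_)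
  · rw [extTransition_tmul, extMap_id_apply]
  · exact (map_add (extTransition (AlgHom.id ℂ A) M) x y).trans (congrArg₂ _ hx hy)

theorem extTransition_comp {A B D : Type u} [CommRing A] [Algebra ℂ A] [CommRing B] [Algebra ℂ B]
    [CommRing D] [Algebra ℂ D] (φ : A →ₐ[ℂ] B) (ψ : B →ₐ[ℂ] D)
    (M : DiffMod.{0, v} K σ.toRingEquiv) (t : M.ext σ A) :
    extTransition ψ M (extTransition φ M t) = extTransition (ψ.comp φ) M t := by
  refine TensorProduct.induction_on (motive := fun t : (A ⊗[ℂ] K) ⊗[K] M =>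
    extTransition ψ M (extTransition φ M t) = extTransition (ψ.comp φ) M t) t ?_ (fun a x => ?_)
    (fun x y hx hy => ?_)
  · exact (congrArg _ (map_zero (extTransition φ M))).trans
      ((map_zero _).trans (map_zero (extTransition (ψ.comp φ) M)).symm)
  · rw [extTransition_tmul, extTransition_tmul, extTransition_tmul, extMap_comp_apply]
  · refine (congrArg _ (map_add (extTransition φ M) x y)).trans ((map_add _ _ _).trans
      ((congrArg₂ _ hx hy).trans (map_add (extTransition (ψ.comp φ) M) x y).symm))

theorem IsoClasses.map_id {A : Type u} [CommRing A] [Algebra ℂ A] (x : IsoClasses P A) :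
    IsoClasses.map P (AlgHom.id ℂ A) x = x := by
  induction x using Quotient.inductionOn with
  | h X =>
    refine Quotient.sound (X.extend_equivalent P _ X
      { toFun := fun x => x, map_add' := fun _ _ => rfl, map_smul' := fun a x => ?_ }
      (fun _ => rfl) (fun _ _ h => h) fun i x => ?_)
    · rw [extMap_id_apply]
    · exact (extTransition_id (P i) _).symm

theorem IsoClasses.map_comp {A B D : Type u} [CommRing A] [Algebra ℂ A] [CommRing B] [Algebra ℂ B]
    [CommRing D] [Algebra ℂ D] (φ : A →ₐ[ℂ] B) (ψ : B →ₐ[ℂ] D) (x : IsoClasses P A) :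
    IsoClasses.map P (ψ.comp φ) x = IsoClasses.map P ψ (IsoClasses.map P φ x) := by
  induction x using Quotient.inductionOn with
  | h X =>
    obtain ⟨g, hg, hfil, hgr⟩ := X.exists_unit P φ
    obtain ⟨g', hg', hfil', hgr'⟩ := (X.extend P φ).exists_unit P ψ
    refine Quotient.sound (X.extend_equivalent P _ _
      { toFun := fun x => g' (g x)
        map_add' := fun x y => by rw [map_add, map_add]
        map_smul' := fun a x => ?_ }
      (fun x => ?_) (fun i x h => hfil' i _ (hfil i x h)) fun i x => ?_)
    · rw [g.map_smulₛₗ, g'.map_smulₛₗ, extMap_comp_apply]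
    · exact (congrArg g' (hg x)).trans (hg' (g x))
    · exact (hgr' i ⟨g x, hfil i.succ x x.2⟩).trans
        ((congrArg _ (hgr i x)).trans (extTransition_comp φ ψ (P i) _))

/-- The functor `A ↦ F(A) = ℱ(A ⊗ P_1, …, A ⊗ P_k)` from commutative `ℂ`-algebras to sets. -/
noncomputable def isoClassesFunctor : CommAlgCat.{u} ℂ ⥤ Type (max (u + 1) (v + 1)) where
  obj A := IsoClasses P A
  map φ := TypeCat.ofHom (IsoClasses.map P φ.hom)
  map_id A := by
    ext x
    exact IsoClasses.map_id P x
  map_comp φ ψ := by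
    ext x
    exact IsoClasses.map_comp P φ.hom ψ.hom x

end functor

section slopes

/-- `M` is isomorphic to `D / D P`, where `D = K⟨σ, σ⁻¹⟩` and `P = a_0 + a_1 σ + ⋯ + a_n σ^n` with
`a_0 a_n ≠ 0`: there is `e` in `M` (the class of `1`), annihilated by `P`, such that
`e, Φ e, …, Φ^(n-1) e` is a basis of `M`. -/
def DiffMod.IsPresentedBy {K : Type u} [Field K] {σ : K ≃+* K} (M : DiffMod.{u, w} K σ)
    (n : ℕ) (a : ℕ → K) : Prop :=
  a 0 ≠ 0 ∧ a n ≠ 0 ∧ ∃ e : M,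
    LinearIndependent K (fun i : Fin n => (⇑M.Φ)^[i] e) ∧
    Submodule.span K (Set.range fun i : Fin n => (⇑M.Φ)^[i] e) = ⊤ ∧
    ∑ i ∈ Finset.range (n + 1), a i • (⇑M.Φ)^[i] e = 0

/-- The valuation `v_0` at `z = 0` (meaningful for `f ≠ 0`). -/
noncomputable def v0 (f : Ka) : ℤ := (f : LaurentSeries ℂ).order

/-- The Newton polygon of `P = a_0 + a_1 σ + ⋯ + a_n σ^n`, i.e. the convex hull of the set of points
`(i, j)` with `j ≥ v_0(a_i)`, has exactly one slope, equal to `μ`: the lower part of its boundary is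
the single segment from `(0, v_0(a_0))` to `(n, v_0(a_n))`, and this segment has slope `μ`. -/
def HasUniqueSlope (n : ℕ) (a : ℕ → Ka) (μ : ℚ) : Prop :=
  0 < n ∧ (v0 (a n) : ℚ) = v0 (a 0) + μ * n ∧
    ∀ i ≤ n, a i ≠ 0 → (v0 (a 0) : ℚ) + μ * i ≤ v0 (a i)

/-- The `q`-difference module `M` over `ℂ({z})` is pure isoclinic of slope `μ`: one has
`M ≃ D / D P` for some `P` whose Newton polygon has `μ` as its only slope. -/
def IsPureIsoclinic {σ : Ka ≃+* Ka} (M : DiffMod.{0, w} Ka σ) (μ : ℚ) : Prop :=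
  ∃ (n : ℕ) (a : ℕ → Ka), M.IsPresentedBy n a ∧ HasUniqueSlope n a μ

end slopes

end QDiff

/-! After splitting the graded projections, a filtered module with graded pieces `Q_1, …, Q_k`
becomes `∏ Q_i` with automorphism `(1 + u) ∘ diag(Φ_i)`, `u` strictly upper triangular
(`exists_stdPair_equivalent`). Two such modules are equivalent exactly when some strictly upper
triangular `g` satisfies `(1 + g)(1 + u) = (1 + v)(1 + Φ g Φ⁻¹)` (`stdPair_equivalent_iff`). At
position `(i, j)` this reads `v_ij + (Φ g_ij Φ⁻¹ - g_ij) = ` an expression in `u_ij` and entries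
nearer the diagonal. Hence, if a complement of the image of the injective operator `Φ - 1` on each
`Hom(Q_j, Q_i)`, `i < j`, is chosen, the system is solved uniquely one diagonal after another: each
class contains exactly one `v` with entries in the complements (`existsUnique_normalForm`).

Over `ℂ` the complements come from analysis. On `Hom(P_j, P_i)` the automorphism raises a suitable
rational valuation by `δ = μ_j - μ_i > 0`. Modulo the image of `Φ - 1`, a vector `g` may be replaced
by `Φ g`, so low valuations can be pushed up. The formal solution `-∑ Φ^k g` diverges in general.
Instead, in high valuation, put `f = Φ x`: the equation becomes `f - B(z) f(z/q) = g`, and `f ↦ B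
f(z/q)` contracts a weighted `ℓ¹` space, as it multiplies the coefficient of `zⁿ` by `q⁻ⁿ`. Only the
monomials in a window of valuations of length `δ` remain, and they form a basis of a complement
(`exists_complement`). Counting them by telescoping sums of ceilings gives `r_i r_j (μ_j - μ_i)`
(`sum_ceil_sub`).

For a `ℂ`-algebra `A`, `Hom(A ⊗ P_j, A ⊗ P_i)` is `A ⊗ Hom(P_j, P_i)`, so the same basis spans a
complement over `A` (`bijective_extHom`). Normal forms are thus tuples of elements of `A`,
compatibly with extension of scalars (`map_normalForm`), which is the functor of points of an affine
space. -/

namespace QDiff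

/-! ### Contracting kernels on `ℓ¹`. -/

section kernel
variable {ι : Type*} {t : ι → ι → ℂ}

theorem summable_kernel_mul (ht : ∀ j, Summable fun i => ‖t i j‖)
    (ht' : ∀ j, ∑' i, ‖t i j‖ ≤ 1 / 2) {f : ι → ℂ} (hf : Summable fun j => ‖f j‖) :
    Summable fun p : ι × ι => ‖t p.2 p.1 * f p.1‖ := by
  rw [summable_prod_of_nonneg (fun _ => norm_nonneg _)]
  simp only [norm_mul]
  refine ⟨fun j => (ht j).mul_right _, ?_⟩
  refine (hf.mul_left (1 / 2)).of_nonneg_of_le (fun j => tsum_nonneg fun i => by positivity)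
    fun j => ?_
  rw [tsum_mul_right]
  exact mul_le_mul_of_nonneg_right (ht' j) (norm_nonneg _)

/-- Exchanging the two summations bounds the result by `∑_j |f j| ∑_i |t i j|`: on `ℓ¹`, a uniform
bound on the columns is a bound on the operator norm. -/
theorem kernel_bound (ht : ∀ j, Summable fun i => ‖t i j‖)
    (ht' : ∀ j, ∑' i, ‖t i j‖ ≤ 1 / 2) {f : ι → ℂ} (hf : Summable fun j => ‖f j‖) :
    (∀ i, Summable fun j => t i j * f j) ∧ (Summable fun i => ‖∑' j, t i j * f j‖) ∧
      ∑' i, ‖∑' j, t i j * f j‖ ≤ 1 / 2 * ∑' j, ‖f j‖ := by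
  have h := summable_kernel_mul ht ht' hf
  have h' : Summable fun p : ι × ι => ‖t p.1 p.2 * f p.2‖ :=
    (Equiv.prodComm ι ι).summable_iff.mpr h
  have hrow := h'.prod_factor
  have hle : ∀ i, ‖∑' j, t i j * f j‖ ≤ ∑' j, ‖t i j * f j‖ := fun i =>
    norm_tsum_le_tsum_norm (hrow i)
  have hs : Summable fun i => ‖∑' j, t i j * f j‖ :=
    h'.prod.of_nonneg_of_le (fun _ => norm_nonneg _) hle
  refine ⟨fun i => (hrow i).of_norm, hs, (hs.tsum_le_tsum hle h'.prod).trans ?_⟩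
  rw [← h'.tsum_comm' (f := fun i j => ‖t i j * f j‖) hrow h.prod_factor, ← tsum_mul_left]
  refine h.prod.tsum_le_tsum (fun j => ?_) (hf.mul_left _)
  simp only [norm_mul]
  rw [tsum_mul_right]
  exact mul_le_mul_of_nonneg_right (ht' j) (norm_nonneg _)

theorem memlp_one_iff {f : ι → ℂ} : Memℓp f 1 ↔ Summable fun i => ‖f i‖ := by
  rw [memℓp_gen_iff (by simp)]
  simp

/-- A kernel whose columns have `ℓ¹`-norm at most `1/2` defines a contraction of `ℓ¹`. -/
theorem exists_eq_add_kernel (ht : ∀ j, Summable fun i => ‖t i j‖)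
    (ht' : ∀ j, ∑' i, ‖t i j‖ ≤ 1 / 2) {g : ι → ℂ} (hg : Summable fun j => ‖g j‖) :
    ∃ f : ι → ℂ, (Summable fun j => ‖f j‖) ∧ ∀ i, f i = g i + ∑' j, t i j * f j := by
  have hn : ∀ x : lp (fun _ : ι => ℂ) 1, ‖x‖ = ∑' i, ‖x i‖ := fun x => by
    rw [lp.norm_eq_tsum_rpow (by simp)]; simp
  have hx : ∀ x : lp (fun _ : ι => ℂ) 1, Summable fun i => ‖x i‖ := fun x =>
    memlp_one_iff.mp (lp.memℓp x)
  let T : lp (fun _ : ι => ℂ) 1 → lp (fun _ : ι => ℂ) 1 := fun x =>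
    ⟨fun i => g i + ∑' j, t i j * x j,
      (memlp_one_iff.mpr hg).add (memlp_one_iff.mpr (kernel_bound ht ht' (hx x)).2.1)⟩
  have hT : ContractingWith (1 / 2) T := by
    refine ⟨by simp [← NNReal.coe_lt_coe]; norm_num, LipschitzWith.of_dist_le_mul fun x y => ?_⟩
    rw [dist_eq_norm, dist_eq_norm, hn, hn]
    have e : ∀ i, (T x - T y) i = ∑' j, t i j * (x - y) j := fun i => by
      have h1 := (kernel_bound ht ht' (hx x)).1 i
      have h2 := (kernel_bound ht ht' (hx y)).1 i
      have : (T x - T y) i = (g i + ∑' j, t i j * x j) - (g i + ∑' j, t i j * y j) := rfl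
      rw [this, add_sub_add_left_eq_sub, ← h1.tsum_sub h2]
      simp [mul_sub]
    simp only [e]
    simpa using (kernel_bound ht ht' (hx (x - y))).2.2
  obtain ⟨x, hfix⟩ : ∃ x, T x = x := ⟨hT.fixedPoint T, hT.fixedPoint_isFixedPt⟩
  exact ⟨fun i => x i, hx x, fun i => congrFun (congrArg Subtype.val hfix.symm) i⟩

/-- The `ℓ¹`-norm of such a fixed vector is at most half of itself. -/
theorem eq_zero_of_eq_kernel (ht : ∀ j, Summable fun i => ‖t i j‖)
    (ht' : ∀ j, ∑' i, ‖t i j‖ ≤ 1 / 2) {f : ι → ℂ} (hf : Summable fun j => ‖f j‖)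
    (h : ∀ i, f i = ∑' j, t i j * f j) : f = 0 := by
  have h1 := (kernel_bound ht ht' hf).2.2
  simp only [← h] at h1
  have h0 : ∑' i, ‖f i‖ = 0 := le_antisymm (by linarith) (tsum_nonneg fun _ => norm_nonneg _)
  rw [← hf.hasSum_iff, hasSum_zero_iff_of_nonneg fun _ => norm_nonneg _] at h0
  funext i
  simpa using congrFun h0 i

end kernel

/-! ### Discs of convergence of Laurent series. -/

section laurent

/-- The Laurent series `f` converges absolutely for `0 < |z| ≤ r`. -/
def NConv (r : ℝ) (f : LaurentSeries ℂ) : Prop := Summable fun n : ℤ => ‖f.coeff n‖ * r ^ n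

/-- Only finitely many terms are nonzero. Summing over all of `ℤ` allows multiplication by a series
to be read as a kernel. -/
theorem coeff_mul_tsum (f g : LaurentSeries ℂ) (n : ℤ) :
    (f * g).coeff n = ∑' m : ℤ, f.coeff (n - m) * g.coeff m := by
  rw [HahnSeries.coeff_mul, tsum_eq_sum (s := (Finset.antidiagonal f.isPWO_support
    g.isPWO_support n).image Prod.snd)]
  · rw [Finset.sum_image]
    · refine Finset.sum_congr rfl fun x hx => ?_
      rw [← (Finset.mem_antidiagonal.mp hx).2.2, add_sub_cancel_right]
    · intro x hx y hy e
      have h1 := (Finset.mem_antidiagonal.mp hx).2.2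
      have h2 := (Finset.mem_antidiagonal.mp hy).2.2
      exact Prod.ext (by rw [e] at h1; linarith) e
  · intro m hm
    by_contra h
    exact hm (Finset.mem_image.mpr ⟨(n - m, m), Finset.mem_antidiagonal.mpr
      ⟨left_ne_zero_of_mul h, right_ne_zero_of_mul h, by simp⟩, rfl⟩)

theorem NConv.add {r : ℝ} (hr : 0 < r) {f g : LaurentSeries ℂ} (hf : NConv r f)
    (hg : NConv r g) : NConv r (f + g) :=
  Summable.of_nonneg_of_le (fun n => by positivity) (fun n => by
    rw [← add_mul, HahnSeries.coeff_add]; gcongr; exact norm_add_le _ _) (Summable.add hf hg)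

theorem NConv.sum {r : ℝ} (hr : 0 < r) {S : Type*} (s : Finset S) {f : S → LaurentSeries ℂ}
    (hf : ∀ i ∈ s, NConv r (f i)) : NConv r (∑ i ∈ s, f i) := by
  classical
  induction s using Finset.induction_on with
  | empty => simp [NConv, summable_zero]
  | insert a s ha ih =>
    rw [Finset.sum_insert ha]
    exact (hf a (by simp)).add hr (ih fun i hi => hf i (by simp [hi]))

theorem NConv.mul {r : ℝ} (hr : 0 < r) {f g : LaurentSeries ℂ} (hf : NConv r f)
    (hg : NConv r g) : NConv r (f * g) := by
  have h := summable_mul_of_summable_norm (f := fun n : ℤ => f.coeff n * (r : ℂ) ^ n)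
    (g := fun n : ℤ => g.coeff n * (r : ℂ) ^ n)
    (by simpa [NConv, abs_of_pos hr, norm_zpow] using hf)
    (by simpa [NConv, abs_of_pos hr, norm_zpow] using hg)
  -- Reindexing by total degree and second degree groups the double family along the coefficients of
  -- the product.
  let e : ℤ × ℤ ≃ ℤ × ℤ :=
    ⟨fun p => (p.1 - p.2, p.2), fun p => (p.1 + p.2, p.2), fun p => by simp, fun p => by simp⟩
  have h' := (e.summable_iff.mpr h).norm
  have hrow := h'.prod_factor
  refine h'.prod.of_nonneg_of_le (fun n => by positivity) fun n => ?_
  have hc : (r : ℂ) ≠ 0 := by exact_mod_cast hr.ne'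
  have hnn : ‖(f * g).coeff n‖ * r ^ n = ‖(f * g).coeff n * (r : ℂ) ^ n‖ := by
    simp [abs_of_pos hr, norm_zpow]
  rw [hnn, coeff_mul_tsum, ← tsum_mul_right]
  refine le_trans (le_of_eq ?_) (norm_tsum_le_tsum_norm (hrow n))
  congr 2
  funext m
  simp only [e, Function.comp, Equiv.coe_fn_mk]
  rw [zpow_sub₀ hc]
  field_simp

theorem NConv.mono {r s : ℝ} (hr : 0 < r) (hrs : r ≤ s) {f : LaurentSeries ℂ}
    (h : NConv s f) : NConv r f := LConv.mono hr hrs h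

/-- The coefficient of degree `n` is divided by `qⁿ`, which enlarges the disc by the factor `|q| >
1`; this gain is what propagates convergence in `NConv.of_sub_twist`. -/
theorem NConv.dil_inv {q : ℂ} (hq : 1 < ‖q‖) {r : ℝ} {f : LaurentSeries ℂ} (h : NConv r f) :
    NConv (‖q‖ * r) (dil q⁻¹ f) := by
  refine h.congr fun n => ?_
  have : ‖q‖ ^ n ≠ 0 := zpow_ne_zero _ (by linarith)
  simp only [dil, norm_mul, norm_zpow, norm_inv, mul_zpow, inv_zpow]
  field_simp

theorem exists_NConv {S : Type*} [Finite S] (f : S → LaurentSeries ℂ) (hf : ∀ s, LConv (f s)) :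
    ∃ r : ℝ, 0 < r ∧ ∀ s, NConv r (f s) := by
  classical
  have := Fintype.ofFinite S
  choose r hr h using hf
  rcases isEmpty_or_nonempty S with hS | hS
  · exact ⟨1, one_pos, fun s => hS.elim s⟩
  · have hpos : 0 < Finset.univ.inf' Finset.univ_nonempty r := by simpa using hr
    exact ⟨_, hpos, fun s => NConv.mono hpos (Finset.inf'_le r (Finset.mem_univ s)) (h s)⟩

end laurent

/-! ### The equation `f - B · f(z/q) = g` for convergent series of high valuation. -/

section operator
variable {S : Type*} [Fintype S]

/-- The semilinear operator `f ↦ B · f(z/q)` on vectors of Laurent series. -/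
noncomputable def twist (q : ℂ) (B : S → S → LaurentSeries ℂ) (f : S → LaurentSeries ℂ) (s : S) :
    LaurentSeries ℂ :=
  ∑ s', B s s' * dil q⁻¹ (f s')

/-- The matrix of `f ↦ B · f(z/q)` in the basis of normalized monomials `r⁻ⁿ zⁿ e_s` with `n ≥ m s`,
truncated to the same range. -/
noncomputable def twistKernel (q : ℂ) (B : S → S → LaurentSeries ℂ) (m : S → ℤ) (r : ℝ)
    (i j : S × ℤ) : ℂ :=
  if m i.1 ≤ i.2 ∧ m j.1 ≤ j.2 then
    (B i.1 j.1).coeff (i.2 - j.2) * (r : ℂ) ^ (i.2 - j.2) * q⁻¹ ^ j.2 else 0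

theorem summable_fintype_prod {T : Type*} {w : S × T → ℝ} (h0 : ∀ p, 0 ≤ w p)
    (h : ∀ s, Summable fun n => w (s, n)) : Summable w :=
  (summable_prod_of_nonneg h0).mpr ⟨h, Summable.of_finite⟩

variable {q : ℂ} {B : S → S → LaurentSeries ℂ} {m : S → ℤ} {r : ℝ}

/-- Columns of degree below `m` are zero, and in the others the factor `q⁻¹ ^ n` has modulus at most
`‖q‖ ^ (-m s')`. So `hsmall`, which compares this with the norm of the columns of `B`, suffices for
all degrees at once. -/
theorem twistKernel_column (hq : 1 < ‖q‖) (hr : 0 < r) (hB : ∀ s s', NConv r (B s s'))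
    (hsmall : ∀ s', (∑ s, ∑' n : ℤ, ‖(B s s').coeff n‖ * r ^ n) * ‖q‖ ^ (-m s') ≤ 1 / 2)
    (j : S × ℤ) : (Summable fun i => ‖twistKernel q B m r i j‖) ∧
      ∑' i, ‖twistKernel q B m r i j‖ ≤ 1 / 2 := by
  have hq0 : 0 < ‖q‖ := one_pos.trans hq
  have hsh : ∀ s, Summable fun n : ℤ => ‖(B s j.1).coeff (n - j.2)‖ * r ^ (n - j.2) := fun s => by
    have h : Summable fun n : ℤ => ‖(B s j.1).coeff n‖ * r ^ n := hB s j.1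
    exact h.comp_injective (Equiv.subRight j.2).injective
  by_cases hj : m j.1 ≤ j.2
  · let w : S × ℤ → ℝ := fun i =>
      ‖(B i.1 j.1).coeff (i.2 - j.2)‖ * r ^ (i.2 - j.2) * ‖q‖ ^ (-m j.1)
    have hw0 : ∀ i, 0 ≤ w i := fun i => by positivity
    have hw : Summable w := summable_fintype_prod hw0 fun s => (hsh s).mul_right (‖q‖ ^ (-m j.1))
    have hle : ∀ i, ‖twistKernel q B m r i j‖ ≤ w i := fun i => by
      unfold twistKernel
      split_ifs
      · rw [norm_mul, norm_mul, norm_zpow, norm_zpow, Complex.norm_real, Real.norm_of_nonneg hr.le,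
          norm_inv, inv_zpow']
        refine mul_le_mul_of_nonneg_left ?_ (by positivity)
        exact zpow_le_zpow_right₀ hq.le (by omega)
      · simpa using hw0 i
    have hs := hw.of_nonneg_of_le (fun _ => norm_nonneg _) hle
    refine ⟨hs, (hs.tsum_le_tsum hle hw).trans (le_trans (le_of_eq ?_) (hsmall j.1))⟩
    rw [hw.tsum_prod, tsum_fintype, Finset.sum_mul]
    refine Finset.sum_congr rfl fun s _ => ?_
    have e := (Equiv.subRight j.2).tsum_eq fun n : ℤ => ‖(B s j.1).coeff n‖ * r ^ n
    rw [← e, ← tsum_mul_right]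
    rfl
  · have : ∀ i, twistKernel q B m r i j = 0 := fun i => if_neg fun h => hj h.2
    simp only [this, norm_zero, tsum_zero]
    exact ⟨summable_zero, by norm_num⟩

/-- Truncating the columns loses nothing because `f` vanishes below `m`. Truncating the rows does,
since `B` may lower valuations; hence the restriction `m s ≤ n`. -/
theorem coeff_twist (hq : 1 < ‖q‖) (hr : 0 < r) (hB : ∀ s s', NConv r (B s s'))
    (hsmall : ∀ s', (∑ s, ∑' n : ℤ, ‖(B s s').coeff n‖ * r ^ n) * ‖q‖ ^ (-m s') ≤ 1 / 2)
    {f : S → LaurentSeries ℂ} (hf : ∀ s, NConv r (f s)) (hm : ∀ s n, n < m s → (f s).coeff n = 0)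
    (s : S) (n : ℤ) (hn : m s ≤ n) :
    ∑' j : S × ℤ, twistKernel q B m r (s, n) j * ((f j.1).coeff j.2 * (r : ℂ) ^ j.2) =
      (twist q B f s).coeff n * (r : ℂ) ^ n := by
  have hcol := twistKernel_column hq hr hB hsmall
  have hc : (r : ℂ) ≠ 0 := by exact_mod_cast hr.ne'
  have hsum : Summable fun j : S × ℤ => ‖(f j.1).coeff j.2 * (r : ℂ) ^ j.2‖ :=
    summable_fintype_prod (fun _ => norm_nonneg _) fun s => by
      simpa [NConv, abs_of_pos hr, norm_zpow] using hf s
  rw [((kernel_bound (fun j => (hcol j).1) (fun j => (hcol j).2) hsum).1 (s, n)).tsum_prod,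
    tsum_fintype, twist, HahnSeries.coeff_sum, Finset.sum_mul]
  refine Finset.sum_congr rfl fun s' _ => ?_
  rw [coeff_mul_tsum, ← tsum_mul_right]
  congr 1
  funext n'
  rw [twistKernel]
  simp only [hn, true_and, dil]
  split_ifs with h
  · rw [zpow_sub₀ hc]; field_simp
  · rw [hm s' n' (not_le.mp h)]; simp

/-- On convergent series of high enough valuation the equation `f - B · f(z/q) = g` has a unique
solution up to terms of low valuation: existence. -/
theorem exists_sub_twist (hq : 1 < ‖q‖) (hr : 0 < r) (hB : ∀ s s', NConv r (B s s'))
    (hsmall : ∀ s', (∑ s, ∑' n : ℤ, ‖(B s s').coeff n‖ * r ^ n) * ‖q‖ ^ (-m s') ≤ 1 / 2)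
    {g : S → LaurentSeries ℂ} (hg : ∀ s, NConv r (g s)) :
    ∃ f : S → LaurentSeries ℂ, (∀ s, NConv r (f s)) ∧ (∀ s n, n < m s → (f s).coeff n = 0) ∧
      ∀ s n, m s ≤ n → (f s - twist q B f s).coeff n = (g s).coeff n := by
  have hcol := twistKernel_column hq hr hB hsmall
  have hc : (r : ℂ) ≠ 0 := by exact_mod_cast hr.ne'
  obtain ⟨y, hy, hy'⟩ := exists_eq_add_kernel (fun j => (hcol j).1) (fun j => (hcol j).2)
    (g := fun j => if m j.1 ≤ j.2 then (g j.1).coeff j.2 * (r : ℂ) ^ j.2 else 0) (by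
      refine summable_fintype_prod (fun _ => norm_nonneg _) fun s =>
        (hg s).of_nonneg_of_le (fun _ => norm_nonneg _) fun n => ?_
      dsimp only
      split_ifs
      · simp [abs_of_pos hr, norm_zpow]
      · simp only [norm_zero]; positivity)
  -- The truncated rows and right-hand side vanish below `m`, so the fixed point is bounded below
  -- and defines a Laurent series.
  have hy0 : ∀ s n, n < m s → y (s, n) = 0 := fun s n h => by
    rw [hy']
    simp [twistKernel, not_le.mpr h]
  let f : S → LaurentSeries ℂ := fun s => HahnSeries.ofSuppBddBelow
    (fun n => y (s, n) / (r : ℂ) ^ n) ⟨m s, fun n h => by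
      by_contra h'
      exact h (by simp [hy0 s n (not_le.mp h')])⟩
  have hfc : ∀ s n, (f s).coeff n = y (s, n) / (r : ℂ) ^ n := fun s n => rfl
  have hfy : ∀ j : S × ℤ, (f j.1).coeff j.2 * (r : ℂ) ^ j.2 = y j := fun j => by
    rw [hfc]; field_simp
  have hf : ∀ s, NConv r (f s) := fun s => by
    refine (hy.prod_factor s).congr fun n => ?_
    rw [← hfy (s, n)]; simp [abs_of_pos hr, norm_zpow]
  have hf0 : ∀ s n, n < m s → (f s).coeff n = 0 := fun s n h => by simp [hfc, hy0 s n h]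
  refine ⟨f, hf, hf0, fun s n hn => ?_⟩
  have h1 := coeff_twist hq hr hB hsmall hf hf0 s n hn
  have h2 := hy' (s, n)
  simp only [hfy] at h1
  rw [h1] at h2
  simp only [hn, if_true] at h2
  rw [← hfy (s, n), ← add_mul] at h2
  rw [HahnSeries.coeff_sub, sub_eq_iff_eq_add]
  exact mul_right_cancel₀ (zpow_ne_zero n hc) h2

/-- The coefficients of `f`, scaled by powers of `r`, form an `ℓ¹` vector fixed by the truncated
kernel. -/
theorem eq_zero_of_sub_twist (hq : 1 < ‖q‖) (hr : 0 < r) (hB : ∀ s s', NConv r (B s s'))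
    (hsmall : ∀ s', (∑ s, ∑' n : ℤ, ‖(B s s').coeff n‖ * r ^ n) * ‖q‖ ^ (-m s') ≤ 1 / 2)
    {f : S → LaurentSeries ℂ} (hf : ∀ s, NConv r (f s)) (hm : ∀ s n, n < m s → (f s).coeff n = 0)
    (h : ∀ s n, m s ≤ n → (f s - twist q B f s).coeff n = 0) : f = 0 := by
  have hcol := twistKernel_column hq hr hB hsmall
  have hc : (r : ℂ) ≠ 0 := by exact_mod_cast hr.ne'
  have := eq_zero_of_eq_kernel (fun j => (hcol j).1) (fun j => (hcol j).2)
    (f := fun j => (f j.1).coeff j.2 * (r : ℂ) ^ j.2)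
    (summable_fintype_prod (fun _ => norm_nonneg _) fun s => by
      simpa [NConv, abs_of_pos hr, norm_zpow] using hf s) (by
    rintro ⟨s, n⟩
    by_cases hn : m s ≤ n
    · rw [coeff_twist hq hr hB hsmall hf hm s n hn]
      have := h s n hn
      rw [HahnSeries.coeff_sub, sub_eq_zero] at this
      simp only [this]
    · rw [hm s n (not_le.mp hn)]
      simp [twistKernel, hn])
  funext s
  ext n
  have := congrFun this (s, n)
  simpa [hc, zpow_ne_zero] using this

/-- As `|q| > 1`, a high enough truncation level turns the operator into a contraction, however
large the matrix is. -/
theorem exists_small (hq : 1 < ‖q‖) (C : S → ℝ) :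
    ∃ M : ℤ, ∀ m : S → ℤ, (∀ s, M ≤ m s) → ∀ s, C s * ‖q‖ ^ (-m s) ≤ 1 / 2 := by
  obtain ⟨k, hk⟩ := pow_unbounded_of_one_lt (2 * ∑ s, |C s|) hq
  refine ⟨k, fun m hm s => ?_⟩
  have hq0 : 0 < ‖q‖ := one_pos.trans hq
  have h1 : C s ≤ ∑ s, |C s| :=
    (le_abs_self _).trans (Finset.single_le_sum (fun s _ => abs_nonneg (C s)) (Finset.mem_univ s))
  have h2 : ‖q‖ ^ (k : ℤ) ≤ ‖q‖ ^ m s := zpow_le_zpow_right₀ hq.le (hm s)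
  rw [zpow_natCast] at h2
  rw [zpow_neg, ← div_eq_mul_inv, div_le_iff₀ (by positivity)]
  linarith

theorem NConv.twist (hq : 1 < ‖q‖) {ρ : ℝ} (hr : 0 < r) (hρ : 0 < ρ)
    (hB : ∀ s s', NConv r (B s s')) {f : S → LaurentSeries ℂ} (hf : ∀ s, NConv ρ (f s)) (s : S) :
    NConv (min (‖q‖ * ρ) r) (twist q B f s) := by
  have hmin : 0 < min (‖q‖ * ρ) r := lt_min (by positivity) hr
  exact NConv.sum hmin _ fun s' _ => ((hB s s').mono hmin (min_le_right _ _)).mul hmin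
    (((hf s').dil_inv hq).mono hmin (min_le_left _ _))

/-- A convergent solution `f` of `f - B · f(z/q) = g` converges wherever `B` and `g` do. -/
theorem NConv.of_sub_twist (hq : 1 < ‖q‖) (hr : 0 < r) (hB : ∀ s s', NConv r (B s s'))
    {f : S → LaurentSeries ℂ} (hf : ∀ s, LConv (f s))
    (hg : ∀ s, NConv r (f s - QDiff.twist q B f s)) (s : S) : NConv r (f s) := by
  obtain ⟨ρ, hρ, hfρ⟩ := exists_NConv f hf
  have hq0 : 0 < ‖q‖ := one_pos.trans hq
  -- Each use of `f = g + B · f(z/q)` multiplies the known radius of `f` by `|q|`, up to the radius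
  -- `r` of `B` and `g`.
  have key : ∀ k : ℕ, ∀ s, NConv (min (‖q‖ ^ k * ρ) r) (f s) := by
    intro k
    induction k with
    | zero => exact fun s => (hfρ s).mono (lt_min (by positivity) hr) (by simp)
    | succ k ih =>
      intro s
      have hmin : 0 < min (‖q‖ ^ k * ρ) r := lt_min (by positivity) hr
      have h1 := NConv.twist hq hr hmin hB ih s
      have h0 : 0 < min (‖q‖ ^ (k + 1) * ρ) r := lt_min (by positivity) hr
      have h2 : min (‖q‖ ^ (k + 1) * ρ) r ≤ min (‖q‖ * min (‖q‖ ^ k * ρ) r) r := by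
        refine le_min ?_ (min_le_right _ _)
        rw [mul_min_of_nonneg _ _ hq0.le]
        refine min_le_min (le_of_eq (by ring)) ?_
        nlinarith
      have := ((hg s).mono h0 (min_le_right _ _)).add h0 (h1.mono h0 h2)
      simpa using this
  obtain ⟨k, hk⟩ := pow_unbounded_of_one_lt (r / ρ) hq
  have := key k s
  rwa [min_eq_right ((div_lt_iff₀ hρ).mp hk).le] at this

end operator

/-! ### The cokernel of `Φ - 1` when `Φ` raises valuations. -/

section cokernel
variable {S : Type*}

/-- Vectors `x` such that `v_0(x_s) + β_s ≥ c` for all `s`. -/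
def vge (β : S → ℚ) (c : ℚ) : AddSubgroup (S → Ka) where
  carrier := {x | ∀ s (n : ℤ), (n : ℚ) + β s < c → (x s : LaurentSeries ℂ).coeff n = 0}
  zero_mem' _ _ _ := rfl
  add_mem' {x y} hx hy s n h := by
    change ((x s : LaurentSeries ℂ) + (y s : LaurentSeries ℂ)).coeff n = 0
    rw [HahnSeries.coeff_add, hx s n h, hy s n h, add_zero]
  neg_mem' {x} hx s n h := by
    change (-(x s : LaurentSeries ℂ)).coeff n = 0
    rw [HahnSeries.coeff_neg, hx s n h, neg_zero]

theorem vge_anti (β : S → ℚ) {c c' : ℚ} (h : c ≤ c') : vge β c' ≤ vge β c :=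
  fun _ hx s n hn => hx s n (hn.trans_le h)

theorem exists_mem_vge [Finite S] (β : S → ℚ) (x : S → Ka) : ∃ c, x ∈ vge β c := by
  have := Fintype.ofFinite S
  rcases isEmpty_or_nonempty S with hS | hS
  · exact ⟨0, fun s => hS.elim s⟩
  · refine ⟨Finset.univ.inf' Finset.univ_nonempty
      fun s => ((x s : LaurentSeries ℂ).order : ℚ) + β s, fun s n h => ?_⟩
    refine HahnSeries.coeff_eq_zero_of_lt_order ?_
    have h1 := h.trans_le (Finset.inf'_le (fun s => ((x s : LaurentSeries ℂ).order : ℚ) + β s)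
      (Finset.mem_univ s))
    have : (n : ℚ) < (x s : LaurentSeries ℂ).order := by linarith
    exact_mod_cast this

theorem coeff_eq_zero_of_lt_ceil {β : S → ℚ} {c : ℚ} {x : S → Ka} (hx : x ∈ vge β c) (s : S)
    (n : ℤ) (h : n < ⌈c - β s⌉) : (x s : LaurentSeries ℂ).coeff n = 0 :=
  hx s n (by rw [Int.lt_ceil] at h; linarith)

theorem exists_le_ceil [Finite S] (β : S → ℚ) (M : ℤ) :
    ∃ c : ℚ, ∀ c' ≥ c, ∀ s, M ≤ ⌈c' - β s⌉ := by
  have := Fintype.ofFinite S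
  refine ⟨M + ∑ s, |β s|, fun c' hc s => ?_⟩
  have h1 : β s ≤ ∑ s, |β s| :=
    (le_abs_self _).trans (Finset.single_le_sum (fun s _ => abs_nonneg (β s)) (Finset.mem_univ s))
  have : (M : ℚ) ≤ c' - β s := by linarith
  exact_mod_cast this.trans (Int.le_ceil _)

variable [Fintype S] {q : ℂ} {hq : 1 < ‖q‖}

section matrix
variable [DecidableEq S]

/-- The matrix of `Φ⁻¹`. -/
noncomputable def invMatrix (Φ : (S → Ka) ≃+ (S → Ka)) (s s' : S) : LaurentSeries ℂ :=
  (Φ.symm (Pi.single s' 1) s : Ka)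

/-- `Φ⁻¹` is linear with respect to `f(z) ↦ f(z/q)`, hence determined by the images of the standard
vectors. Working with `Φ⁻¹` rather than `Φ` makes the dilatation contracting. -/
theorem symm_eq_twist {Φ : (S → Ka) ≃+ (S → Ka)}
    (hΦ : ∀ (a : Ka) x, Φ (a • x) = sigmaQ q hq a • Φ x) (x : S → Ka) (s : S) :
    ((Φ.symm x s : Ka) : LaurentSeries ℂ) = twist q (invMatrix Φ) (fun s => x s) s := by
  have hs : ∀ (a : Ka) x, Φ.symm (a • x) = (sigmaQ q hq).symm a • Φ.symm x := fun a x => by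
    apply Φ.injective; rw [hΦ]; simp
  have hx : x = ∑ s', x s' • (Pi.single s' 1 : S → Ka) := pi_eq_sum_univ' x
  conv_lhs => rw [hx, map_sum]
  simp only [hs, Finset.sum_apply, Pi.smul_apply, smul_eq_mul]
  rw [AddSubmonoidClass.coe_finsetSum, twist]
  refine Finset.sum_congr rfl fun s' _ => ?_
  rw [mul_comm]
  rfl

variable {Φ : (S → Ka) ≃+ (S → Ka)} (hΦ : ∀ (a : Ka) x, Φ (a • x) = sigmaQ q hq a • Φ x)
  {β : S → ℚ}
include hΦ

/-- In terms of `f = Φ x` the equation `Φ x - x = g` becomes `f - B · f(z/q) = g`, and the bound `c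
≤ n + β s` means `⌈c - β s⌉ ≤ n`. The error is confined to shifted valuations below `c`. -/
theorem exists_approx {r : ℝ} (hr : 0 < r) (hB : ∀ s s', NConv r (invMatrix Φ s s')) {c : ℚ}
    (hsmall : ∀ s', (∑ s, ∑' n : ℤ, ‖(invMatrix Φ s s').coeff n‖ * r ^ n) *
      ‖q‖ ^ (-⌈c - β s'⌉) ≤ 1 / 2) {g : S → Ka} (hg : ∀ s, NConv r (g s)) :
    ∃ x : S → Ka, Φ x ∈ vge β c ∧
      ∀ s (n : ℤ), c ≤ n + β s → ((g - (Φ x - x)) s : LaurentSeries ℂ).coeff n = 0 := by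
  obtain ⟨f, hf, hm, h⟩ := exists_sub_twist (m := fun s => ⌈c - β s⌉) hq hr hB hsmall hg
  let f' : S → Ka := fun s => ⟨f s, r, hr, hf s⟩
  refine ⟨Φ.symm f', fun s n hn => ?_, fun s n hn => ?_⟩
  · rw [Φ.apply_symm_apply]
    exact hm s n (by rw [Int.lt_ceil]; linarith)
  · rw [Φ.apply_symm_apply]
    change ((g s : LaurentSeries ℂ) - (f s - (Φ.symm f' s : Ka))).coeff n = 0
    rw [symm_eq_twist hΦ, HahnSeries.coeff_sub, sub_eq_zero]
    exact (h s n (by rw [Int.ceil_le]; linarith)).symm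

/-- A priori `Φ x` converges only on some small disc. `NConv.of_sub_twist` extends it to radius `r`,
where the contraction forces it to vanish. -/
theorem eq_zero_of_approx {r : ℝ} (hr : 0 < r) (hB : ∀ s s', NConv r (invMatrix Φ s s')) {c : ℚ}
    (hsmall : ∀ s', (∑ s, ∑' n : ℤ, ‖(invMatrix Φ s s').coeff n‖ * r ^ n) *
      ‖q‖ ^ (-⌈c - β s'⌉) ≤ 1 / 2) {x : S → Ka} (hx : Φ x ∈ vge β c)
    (hconv : ∀ s, NConv r ((Φ x - x) s : Ka))
    (h : ∀ s (n : ℤ), c ≤ n + β s → ((Φ x - x) s : LaurentSeries ℂ).coeff n = 0) : x = 0 := by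
  have e : ∀ s, (((Φ x - x) s : Ka) : LaurentSeries ℂ) =
      (Φ x s : LaurentSeries ℂ) - twist q (invMatrix Φ) (fun s => Φ x s) s := fun s => by
    rw [← symm_eq_twist hΦ, Φ.symm_apply_apply]; rfl
  have hc := NConv.of_sub_twist hq hr hB (f := fun s => (Φ x s : Ka)) (fun s => (Φ x s).2)
    (fun s => by rw [← e]; exact hconv s)
  have h0 := eq_zero_of_sub_twist (m := fun s => ⌈c - β s⌉) hq hr hB hsmall hc
    (fun s n hn => coeff_eq_zero_of_lt_ceil hx s n hn)
    (fun s n hn => by rw [← e]; exact h s n (by rw [Int.ceil_le] at hn; linarith))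
  apply Φ.injective
  rw [map_zero]
  funext s
  exact Subtype.ext (congrFun h0 s)

end matrix

/-- The monomial `zⁿ e_s`. -/
noncomputable def monomialVec [DecidableEq S] (p : Σ _ : S, ℤ) : S → Ka :=
  Pi.single p.1 ⟨HahnSeries.single p.2 1, 1, one_pos,
    summable_of_hasFiniteSupport (Set.Finite.subset (Set.finite_singleton p.2) fun n hn => by
      by_contra h
      exact hn (by simp [HahnSeries.coeff_single_of_ne h]))⟩

theorem coeff_smul (c : ℂ) (f : Ka) (n : ℤ) :
    ((c • f : Ka) : LaurentSeries ℂ).coeff n = c * (f : LaurentSeries ℂ).coeff n := by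
  change (HahnSeries.C c * (f : LaurentSeries ℂ)).coeff n = _
  simp

omit [Fintype S] in
theorem coeff_monomialVec [DecidableEq S] (p : Σ _ : S, ℤ) (s : S) (n : ℤ) :
    (monomialVec p s : LaurentSeries ℂ).coeff n = if p = ⟨s, n⟩ then 1 else 0 := by
  obtain ⟨s', n'⟩ := p
  unfold monomialVec
  by_cases hs : s' = s
  · subst hs
    rw [Pi.single_eq_same]
    by_cases hn : n' = n
    · subst hn; simp
    · rw [if_neg (by simpa using hn)]
      exact HahnSeries.coeff_single_of_ne (Ne.symm hn)
  · rw [Pi.single_eq_of_ne (Ne.symm hs), if_neg (by simp [hs])]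
    rfl

omit [Fintype S] in
theorem coeff_sum_monomialVec [DecidableEq S] (T : Finset (Σ _ : S, ℤ)) (a : T → ℂ) (s : S)
    (n : ℤ) : ((∑ p, a p • monomialVec p.1) s : LaurentSeries ℂ).coeff n =
      if h : (⟨s, n⟩ : Σ _ : S, ℤ) ∈ T then a ⟨_, h⟩ else 0 := by
  rw [Finset.sum_apply, AddSubmonoidClass.coe_finsetSum, HahnSeries.coeff_sum]
  simp only [Pi.smul_apply, coeff_smul, coeff_monomialVec, mul_ite, mul_one, mul_zero]
  split_ifs with h
  · rw [Finset.sum_eq_single ⟨_, h⟩]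
    · simp
    · intro p _ hp
      rw [if_neg]
      intro e
      exact hp (Subtype.ext e)
    · simp
  · refine Finset.sum_eq_zero fun p _ => ?_
    rw [if_neg]
    intro e
    exact h (e ▸ p.2)

/-- A Laurent polynomial converges at every radius. This is how an error term regains a radius that
the original right-hand side lacked. -/
theorem NConv.of_bounded {r : ℝ} {f : LaurentSeries ℂ} (a : ℤ) (h : ∀ n, a ≤ n → f.coeff n = 0) :
    NConv r f := by
  obtain ⟨b, hb⟩ : ∃ b : ℤ, ∀ n < b, f.coeff n = 0 :=
    ⟨f.order, fun n hn => HahnSeries.coeff_eq_zero_of_lt_order hn⟩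
  refine summable_of_hasFiniteSupport ((Set.finite_Ico b a).subset fun n hn => ?_)
  by_contra h'
  rw [Set.mem_Ico, not_and_or, not_le, not_lt] at h'
  refine hn ?_
  rcases h' with h' | h'
  · simp [hb n h']
  · simp [h n h']

/-- Let `Φ` be a `σ_q`-linear automorphism of `K^S` that raises by `δ > 0` the valuation shifted by
`β`. Then `Φ - 1` is injective and its cokernel has a finite `ℂ`-basis, of cardinality the number of
jumps of the valuation in an interval of length `δ`. -/
theorem exists_complement {Φ : (S → Ka) ≃+ (S → Ka)}
    (hΦ : ∀ (a : Ka) x, Φ (a • x) = sigmaQ q hq a • Φ x) (β : S → ℚ) {δ : ℚ} (hδ : 0 < δ)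
    (hv : ∀ c x, Φ x ∈ vge β (c + δ) ↔ x ∈ vge β c) {D : ℤ}
    (hD : ∀ c : ℚ, ∑ s, (⌈c - β s⌉ - ⌈c - δ - β s⌉) = D) :
    ∃ d : ℕ, (d : ℤ) = D ∧ ∃ v : Fin d → S → Ka,
      Function.Bijective fun p : (Fin d → ℂ) × (S → Ka) =>
        ∑ l, p.1 l • v l + (Φ p.2 - p.2) := by
  classical
  have hv' : ∀ c x, x ∈ vge β c → Φ x ∈ vge β (c + δ) := fun c x => (hv c x).2
  obtain ⟨r₀, hr₀, hB₀⟩ := exists_NConv (fun p : S × S => invMatrix Φ p.1 p.2)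
    fun p => (Φ.symm (Pi.single p.2 1) p.1).2
  replace hB₀ : ∀ s s', NConv r₀ (invMatrix Φ s s') := fun s s' => hB₀ (s, s')
  have hlarge : ∀ r : ℝ, ∃ c₁ : ℚ, ∀ c ≥ c₁, ∀ s',
      (∑ s, ∑' n : ℤ, ‖(invMatrix Φ s s').coeff n‖ * r ^ n) * ‖q‖ ^ (-⌈c - β s'⌉) ≤ 1 / 2 := by
    intro r
    obtain ⟨M, hM⟩ := exists_small hq
      fun s' => ∑ s, ∑' n : ℤ, ‖(invMatrix Φ s s').coeff n‖ * r ^ n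
    obtain ⟨c₁, hc₁⟩ := exists_le_ceil β M
    exact ⟨c₁, fun c hc => hM _ (hc₁ c hc)⟩
  -- The radius `r₀` and the level `c₀` depend on `Φ` only, so the window `T` of shifted valuations
  -- in `[c₀ - δ, c₀)` is fixed before any right-hand side is considered.
  obtain ⟨c₀, hc₀⟩ := hlarge r₀
  let T : Finset (Σ _ : S, ℤ) :=
    Finset.univ.sigma fun s => Finset.Ico ⌈c₀ - δ - β s⌉ ⌈c₀ - β s⌉
  have hT : ∀ s n, (⟨s, n⟩ : Σ _ : S, ℤ) ∈ T ↔ c₀ - δ ≤ n + β s ∧ (n : ℚ) + β s < c₀ := by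
    intro s n
    simp only [T, Finset.mem_sigma, Finset.mem_univ, true_and, Finset.mem_Ico, Int.ceil_le,
      Int.lt_ceil]
    constructor <;> rintro ⟨h1, h2⟩ <;> constructor <;> linarith
  let F : (T → ℂ) × (S → Ka) → (S → Ka) := fun p => ∑ l, p.1 l • monomialVec l.1 + (Φ p.2 - p.2)
  have hFadd : ∀ p p', F (p + p') = F p + F p' := fun p p' => by
    simp only [F, Prod.fst_add, Prod.snd_add, Pi.add_apply, add_smul, Finset.sum_add_distrib,
      map_add]
    abel
  have hlow : ∀ a : T → ℂ, ∑ l, a l • monomialVec l.1 ∈ vge β (c₀ - δ) := fun a s n hn => by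
    rw [coeff_sum_monomialVec, dif_neg]
    rw [hT]; intro h; linarith [h.1]
  have hhigh : ∀ (a : T → ℂ) s (n : ℤ), c₀ ≤ n + β s →
      ((∑ l, a l • monomialVec l.1) s : LaurentSeries ℂ).coeff n = 0 := fun a s n hn => by
    rw [coeff_sum_monomialVec, dif_neg]
    rw [hT]; intro h; linarith [h.2]
  have hinj : ∀ p, F p = 0 → p = 0 := by
    rintro ⟨a, x⟩ h
    have e : Φ x - x = -∑ l, a l • monomialVec l.1 := eq_neg_of_add_eq_zero_right h
    have hx : x = 0 := by
      obtain ⟨b, hb⟩ := exists_mem_vge β x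
      -- Since `x` is `Φ x` plus a combination of window monomials, its valuation improves by `δ` at
      -- each pass until it reaches the bottom of the window.
      have hk : ∀ k : ℕ, x ∈ vge β (min (b + k * δ) (c₀ - δ)) := by
        intro k
        induction k with
        | zero => exact vge_anti β (by simp) hb
        | succ k ih =>
          have h1 := hv' _ _ ih
          have h2 : x = Φ x + ∑ l, a l • monomialVec l.1 := by
            rw [eq_neg_iff_add_eq_zero] at e
            rw [← sub_eq_zero, ← neg_eq_zero, ← e]; abel
          rw [h2]
          refine add_mem (vge_anti β ?_ h1) (vge_anti β (min_le_right _ _) (hlow a))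
          rw [min_add]
          refine min_le_min (by push_cast; linarith) (by linarith)
      have hx0 : x ∈ vge β (c₀ - δ) := by
        obtain ⟨k, hk'⟩ := exists_nat_gt ((c₀ - δ - b) / δ)
        rw [div_lt_iff₀ hδ] at hk'
        have := hk k
        rwa [min_eq_right (by linarith)] at this
      have hx1 : Φ x ∈ vge β c₀ := by simpa using hv' _ _ hx0
      refine eq_zero_of_approx hΦ hr₀ hB₀ (hc₀ c₀ le_rfl) hx1 (fun s => ?_) (fun s n hn => ?_)
      · refine NConv.of_bounded ⌈c₀ - β s⌉ fun n hn => ?_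
        rw [e, Pi.neg_apply]
        change (-((∑ l, a l • monomialVec l.1) s : LaurentSeries ℂ)).coeff n = 0
        rw [HahnSeries.coeff_neg, hhigh a s n (by rw [Int.ceil_le] at hn; linarith), neg_zero]
      · rw [e, Pi.neg_apply]
        change (-((∑ l, a l • monomialVec l.1) s : LaurentSeries ℂ)).coeff n = 0
        rw [HahnSeries.coeff_neg, hhigh a s n hn, neg_zero]
    subst hx
    have ha : a = 0 := by
      funext p
      have h1 := coeff_sum_monomialVec T a p.1.1 p.1.2
      rw [map_zero, sub_zero, zero_eq_neg] at e
      rw [e, dif_pos p.2] at h1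
      exact h1.symm
    rw [ha]; rfl
  -- As `g = Φ g - (Φ g - g)`, passing from `g` to `Φ g` changes nothing modulo the image and gains
  -- `δ` in valuation.
  have hstep : ∀ g, (∃ p, F p = Φ g) → ∃ p, F p = g := by
    rintro g ⟨p, hp⟩
    refine ⟨p + (0, -g), ?_⟩
    rw [hFadd, hp]
    simp only [F, map_neg, Pi.zero_apply, zero_smul, Finset.sum_const_zero]
    abel
  have hmain : ∀ g ∈ vge β (c₀ - δ), ∃ p, F p = g := by
    intro g hg
    obtain ⟨r, hr, hgr⟩ := exists_NConv (fun s => (g s : LaurentSeries ℂ)) fun s => (g s).2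
    have hm : 0 < min r r₀ := lt_min hr hr₀
    -- The series `g` may converge only on a disc smaller than `r₀`, where the contraction needs a
    -- higher level `c₁`. A first correction `x` at that level leaves a Laurent polynomial `g₁`;
    -- being convergent at radius `r₀`, it admits a second correction `y` at level `c₀`.
    obtain ⟨c₁, hc₁⟩ := hlarge (min r r₀)
    obtain ⟨x, hx, h⟩ := exists_approx hΦ hm (fun s s' => (hB₀ s s').mono hm (min_le_right _ _))
      (hc₁ (max c₀ c₁) (le_max_right _ _)) (fun s => (hgr s).mono hm (min_le_left _ _))
    have hsub : ∀ x, Φ x ∈ vge β c₀ → Φ x - x ∈ vge β (c₀ - δ) := fun x hx =>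
      sub_mem (vge_anti β (by linarith) hx) ((hv (c₀ - δ) x).1 (by simpa using hx))
    set g₁ := g - (Φ x - x) with hg₁
    have hg₁low : g₁ ∈ vge β (c₀ - δ) := sub_mem hg (hsub x (vge_anti β (le_max_left _ _) hx))
    obtain ⟨y, hy, h'⟩ := exists_approx hΦ hr₀ hB₀ (hc₀ c₀ le_rfl) (g := g₁) fun s =>
      NConv.of_bounded ⌈max c₀ c₁ - β s⌉ fun n hn =>
        h s n (by rw [Int.ceil_le] at hn; linarith)
    have hg₂low : g₁ - (Φ y - y) ∈ vge β (c₀ - δ) := sub_mem hg₁low (hsub y hy)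
    refine ⟨(fun p => ((g₁ - (Φ y - y)) p.1.1 : LaurentSeries ℂ).coeff p.1.2, x + y), ?_⟩
    -- What remains is bounded below by `c₀ - δ` and has no term from `c₀` on, so it is a
    -- combination of window monomials.
    have key : ∑ p : T, ((g₁ - (Φ y - y)) p.1.1 : LaurentSeries ℂ).coeff p.1.2 • monomialVec p.1 =
        g₁ - (Φ y - y) := by
      funext s
      refine Subtype.ext (HahnSeries.ext (funext fun n => ?_))
      rw [coeff_sum_monomialVec T fun p => ((g₁ - (Φ y - y)) p.1.1 : LaurentSeries ℂ).coeff p.1.2]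
      split_ifs with hp
      · rfl
      · rw [hT, not_and_or, not_le, not_lt] at hp
        rcases hp with hp | hp
        · exact (hg₂low s n hp).symm
        · exact (h' s n hp).symm
    change _ + (Φ (x + y) - (x + y)) = g
    rw [key, hg₁, map_add]
    abel
  have hsurj : Function.Surjective F := by
    intro g
    obtain ⟨b, hb⟩ := exists_mem_vge β g
    obtain ⟨k, hk⟩ := exists_nat_gt ((c₀ - δ - b) / δ)
    rw [div_lt_iff₀ hδ] at hk
    have hall : ∀ (k : ℕ) (b : ℚ) g, g ∈ vge β b → c₀ - δ ≤ b + k * δ → ∃ p, F p = g := by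
      intro k
      induction k with
      | zero => exact fun b g hg hb => hmain g (vge_anti β (by simpa using hb) hg)
      | succ k ih =>
        exact fun b g hg hb => hstep g (ih (b + δ) _ (hv' _ _ hg) (by push_cast at hb; linarith))
    exact hall k b g hb (by linarith)
  have hbij : Function.Bijective F := by
    refine ⟨fun p p' h => ?_, hsurj⟩
    have h0 := hFadd (p - p') p'
    rw [sub_add_cancel, h, right_eq_add] at h0
    exact sub_eq_zero.mp (hinj _ h0)
  have hcard : (T.card : ℤ) = D := by
    rw [← hD c₀, Finset.card_sigma, Nat.cast_sum]
    refine Finset.sum_congr rfl fun s _ => ?_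
    rw [Int.card_Ico, Int.toNat_of_nonneg]
    exact sub_nonneg.mpr (Int.ceil_mono (by linarith))
  refine ⟨T.card, hcard, fun l => monomialVec (T.equivFin.symm l).1, ?_⟩
  let E : (Fin T.card → ℂ) × (S → Ka) ≃ (T → ℂ) × (S → Ka) :=
    (T.equivFin.arrowCongr (Equiv.refl ℂ)).symm.prodCongr (Equiv.refl _)
  convert hbij.comp E.bijective using 1
  funext p
  simp only [F, E, Function.comp]
  congr 1
  refine Fintype.sum_equiv T.equivFin.symm _ _ fun l => ?_
  simp

end cokernel

/-! ### The internal `Hom` of difference modules. -/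

section hom
variable {K : Type u} [CommRing K] {σ : K ≃+* K}

/-- The difference module structure `f ↦ Φ ∘ f ∘ Φ⁻¹` of `Hom(M, N)`. -/
def homΦ (M N : DiffMod.{u, w} K σ) : (M →ₗ[K] N) ≃+ (M →ₗ[K] N) where
  toFun f :=
    { toFun := fun x => N.Φ (f (M.Φ.symm x))
      map_add' := fun x y => by simp
      map_smul' := fun a x => by simp [M.Φ_symm_smul, N.Φ_smul] }
  invFun f :=
    { toFun := fun x => N.Φ.symm (f (M.Φ x))
      map_add' := fun x y => by simp
      map_smul' := fun a x => by simp [M.Φ_smul, N.Φ_symm_smul] }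
  left_inv f := by ext x; simp
  right_inv f := by ext x; simp
  map_add' f g := by ext x; simp

variable {M N : DiffMod.{u, w} K σ}

@[simp] theorem homΦ_apply (f : M →ₗ[K] N) (x : M) : homΦ M N f x = N.Φ (f (M.Φ.symm x)) := rfl

theorem homΦ_smul (a : K) (f : M →ₗ[K] N) : homΦ M N (a • f) = σ a • homΦ M N f := by
  ext x; simp [N.Φ_smul]

end hom

/-! ### Valuations and lattices attached to a weighted basis. -/

section valuation

/-- `v_0(f) ≥ c`. -/
def valGE (c : ℚ) (f : Ka) : Prop := ∀ n : ℤ, (n : ℚ) < c → (f : LaurentSeries ℂ).coeff n = 0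

theorem valGE_iff {c : ℚ} {f : Ka} (hf : f ≠ 0) : valGE c f ↔ c ≤ v0 f := by
  have hf' : (f : LaurentSeries ℂ) ≠ 0 := fun h => hf (Subtype.ext h)
  constructor
  · intro h
    by_contra! hlt
    exact HahnSeries.coeff_order_eq_zero.not.mpr hf' (h _ hlt)
  · intro h n hn
    refine HahnSeries.coeff_eq_zero_of_lt_order ?_
    exact_mod_cast hn.trans_le h

theorem valGE_zero (c : ℚ) : valGE c 0 := fun _ _ => rfl

theorem v0_mul {f g : Ka} (hf : f ≠ 0) (hg : g ≠ 0) : v0 (f * g) = v0 f + v0 g :=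
  HahnSeries.order_mul (fun h => hf (Subtype.ext h)) fun h => hg (Subtype.ext h)

theorem v0_one : v0 1 = 0 := HahnSeries.order_one

theorem valGE_one : valGE 0 1 := by rw [valGE_iff one_ne_zero, v0_one]; simp

theorem valGE.mul {a b : ℚ} {f g : Ka} (hf : valGE a f) (hg : valGE b g) :
    valGE (a + b) (f * g) := by
  by_cases h : f = 0
  · rw [h, zero_mul]; exact valGE_zero _
  by_cases h' : g = 0
  · rw [h', mul_zero]; exact valGE_zero _
  rw [valGE_iff h] at hf
  rw [valGE_iff h'] at hg
  rw [valGE_iff (mul_ne_zero h h'), v0_mul h h']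
  push_cast
  exact add_le_add hf hg

theorem valGE.div {f g : Ka} {c : ℚ} (hg : g ≠ 0) (h : f ≠ 0 → c + v0 g ≤ v0 f) :
    valGE c (f / g) := by
  by_cases hf : f = 0
  · rw [hf, zero_div]; exact valGE_zero _
  rw [valGE_iff (div_ne_zero hf hg)]
  have h1 := v0_mul (div_ne_zero hf hg) hg
  rw [div_mul_cancel₀ _ hg] at h1
  have h2 := h hf
  rw [h1] at h2
  push_cast at h2
  linarith

theorem valGE.sigma {q : ℂ} {hq : 1 < ‖q‖} {c : ℚ} {f : Ka} (hf : valGE c f) :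
    valGE c ((sigmaQ q hq).toRingEquiv f) := fun n hn => by
  change q ^ n * (f : LaurentSeries ℂ).coeff n = 0
  rw [hf n hn, mul_zero]

theorem valGE.sigma_symm {q : ℂ} {hq : 1 < ‖q‖} {c : ℚ} {f : Ka} (hf : valGE c f) :
    valGE c ((sigmaQ q hq).toRingEquiv.symm f) := fun n hn => by
  change q⁻¹ ^ n * (f : LaurentSeries ℂ).coeff n = 0
  rw [hf n hn, mul_zero]

theorem mem_vge_iff {S : Type*} {β : S → ℚ} {c : ℚ} {x : S → Ka} :
    x ∈ vge β c ↔ ∀ s, valGE (c - β s) (x s) :=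
  forall_congr' fun s => forall_congr' fun n => by rw [lt_sub_iff_add_lt]

variable {S : Type*} [Fintype S] {M : Type*} [AddCommGroup M] [Module Ka M]

/-- The lattice of vectors whose coordinates in the basis `b` satisfy `v_0(x_s) + β_s ≥ c`. -/
noncomputable def lattice (b : Module.Basis S Ka M) (β : S → ℚ) (c : ℚ) : AddSubgroup M :=
  (vge β c).comap b.equivFun.toLinearMap.toAddMonoidHom

variable {b : Module.Basis S Ka M} {β : S → ℚ} {c : ℚ}

theorem mem_lattice {x : M} : x ∈ lattice b β c ↔ ∀ s, valGE (c - β s) (b.equivFun x s) :=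
  mem_vge_iff

theorem smul_mem_lattice {a : ℚ} {f : Ka} (hf : valGE a f) {x : M} (hx : x ∈ lattice b β c) :
    f • x ∈ lattice b β (a + c) := by
  rw [mem_lattice] at hx ⊢
  intro s
  rw [map_smul, Pi.smul_apply, smul_eq_mul, add_sub_assoc]
  exact hf.mul (hx s)

theorem basis_mem_lattice (s : S) : b s ∈ lattice b β (β s) := by
  classical
  rw [mem_lattice]
  intro s'
  rw [Module.Basis.equivFun_self]
  split_ifs with h
  · subst h; rw [sub_self]; exact valGE_one
  · exact valGE_zero _

theorem mem_of_forall_basis {N : Type*} [AddCommGroup N] {L : AddSubgroup N} (f : M →+ N) {x : M}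
    (h : ∀ s, f (b.equivFun x s • b s) ∈ L) : f x ∈ L := by
  rw [← b.sum_equivFun x, map_sum]
  exact sum_mem fun s _ => h s

end valuation

/-! ### The valuation of a pure isoclinic module and the dimension count. -/

section isoclinic
variable {q : ℂ} {hq : 1 < ‖q‖} {M : DiffMod.{0, v} Ka (sigmaQ q hq).toRingEquiv}

/-- On a pure isoclinic module of slope `μ` there is a valuation (with rational values) that `Φ`
shifts by `-μ`. -/
theorem IsPureIsoclinic.exists_basis {μ : ℚ} (h : IsPureIsoclinic M μ) :
    ∃ (n : ℕ) (b : Module.Basis (Fin n) Ka M), (∃ A : ℤ, (A : ℚ) = μ * n) ∧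
      ∀ c x, M.Φ x ∈ lattice b (fun a => -(μ * a)) (c - μ) ↔
        x ∈ lattice b (fun a => -(μ * a)) c := by
  obtain ⟨n, a, ⟨h0, hn, e, hli, hsp, hrel⟩, hpos, hend, hle⟩ := h
  -- The vector `Φ^i e` is given valuation `-μ i`, so `Φ` shifts consecutive basis vectors by `-μ`.
  -- The Newton polygon is needed only at the two ends, for `Φ^n e` and `Φ⁻¹ e`.
  let b : Module.Basis (Fin n) Ka M := Module.Basis.mk hli hsp.ge
  have hb : ∀ i : Fin n, b i = (⇑M.Φ)^[i] e := fun i => Module.Basis.mk_apply hli hsp.ge i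
  set L := lattice b (fun a => -(μ * a)) with hL
  have hbL : ∀ i : ℕ, i < n → (⇑M.Φ)^[i] e ∈ L (-(μ * i)) := fun i hi => by
    have := basis_mem_lattice (b := b) (β := fun a => -(μ * a)) ⟨i, hi⟩
    rwa [hb] at this
  -- The relation is solved for its last term; the slope condition gives `v₀(a_i) - v₀(a_n) ≥ μ i -
  -- μ n`.
  have hlast : (⇑M.Φ)^[n] e ∈ L (-(μ * n)) := by
    rw [Finset.sum_range_succ] at hrel
    have : (⇑M.Φ)^[n] e = -∑ i ∈ Finset.range n, (a i / a n) • (⇑M.Φ)^[i] e := by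
      apply smul_right_injective M hn
      dsimp only
      rw [smul_neg, Finset.smul_sum, ← add_eq_zero_iff_eq_neg', ← hrel]
      congr 1
      refine Finset.sum_congr rfl fun i _ => ?_
      rw [smul_smul, mul_div_cancel₀ _ hn]
    rw [this]
    refine neg_mem (sum_mem fun i hi => ?_)
    have hi' := Finset.mem_range.mp hi
    have := smul_mem_lattice (valGE.div (c := μ * i - μ * n) hn fun hai => by
      have := hle i hi'.le hai
      linarith) (hbL i hi')
    rwa [show μ * i - μ * n + -(μ * i) = -(μ * n) by ring] at this
  -- The relation is solved for `e` and `Φ⁻¹` is applied. The coefficients `a_(i+1) / a_0` have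
  -- valuation at least `μ (i + 1)`, which `σ⁻¹` preserves.
  have hfirst : M.Φ.symm e ∈ L μ := by
    rw [Finset.sum_range_succ'] at hrel
    have : M.Φ.symm e = -∑ i ∈ Finset.range n,
        (sigmaQ q hq).toRingEquiv.symm (a (i + 1) / a 0) • (⇑M.Φ)^[i] e := by
      apply M.Φ.injective
      apply smul_right_injective M h0
      dsimp only
      rw [M.Φ.apply_symm_apply, map_neg, map_sum, smul_neg, Finset.smul_sum,
        ← add_eq_zero_iff_eq_neg', ← hrel]
      congr 1
      refine Finset.sum_congr rfl fun i _ => ?_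
      rw [M.Φ_smul, RingEquiv.apply_symm_apply, smul_smul, mul_div_cancel₀ _ h0,
        Function.iterate_succ_apply']
    rw [this]
    refine neg_mem (sum_mem fun i hi => ?_)
    have hi' := Finset.mem_range.mp hi
    have := smul_mem_lattice (valGE.sigma_symm (q := q) (hq := hq)
      (valGE.div (c := μ * (i + 1 : ℕ)) h0 fun hai => by
        have := hle (i + 1) hi' hai
        linarith)) (hbL i hi')
    rwa [show μ * (i + 1 : ℕ) + -(μ * i) = μ by push_cast; ring] at this
  have hΦ : ∀ c x, x ∈ L c → M.Φ x ∈ L (c - μ) := fun c x hx => by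
    refine mem_of_forall_basis (b := b) M.Φ.toAddMonoidHom fun s => ?_
    change M.Φ (_ • b s) ∈ _
    rw [M.Φ_smul, hb, ← Function.iterate_succ_apply' (⇑M.Φ)]
    have hs : (⇑M.Φ)^[(s : ℕ) + 1] e ∈ L (-(μ * ((s : ℕ) + 1 : ℕ))) := by
      rcases Nat.lt_or_ge ((s : ℕ) + 1) n with h | h
      · exact hbL _ h
      · have : (s : ℕ) + 1 = n := le_antisymm s.2 h
        rw [this]; exact hlast
    have := smul_mem_lattice (valGE.sigma (q := q) (hq := hq) (mem_lattice.mp hx s)) hs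
    rwa [show c - -(μ * (s : ℕ)) + -(μ * ((s : ℕ) + 1 : ℕ)) = c - μ by push_cast; ring] at this
  have hΦ' : ∀ c x, x ∈ L c → M.Φ.symm x ∈ L (c + μ) := fun c x hx => by
    refine mem_of_forall_basis (b := b) M.Φ.symm.toAddMonoidHom fun s => ?_
    change M.Φ.symm (_ • b s) ∈ _
    rw [M.Φ_symm_smul, hb]
    have hs : M.Φ.symm ((⇑M.Φ)^[(s : ℕ)] e) ∈ L (μ - μ * (s : ℕ)) := by
      rcases s with ⟨_ | s, hs⟩
      · simpa using hfirst
      · dsimp only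
        rw [Function.iterate_succ_apply', M.Φ.symm_apply_apply]
        have := hbL s (by omega)
        rwa [show μ - μ * (s + 1 : ℕ) = -(μ * s) by push_cast; ring]
    have := smul_mem_lattice (valGE.sigma_symm (q := q) (hq := hq) (mem_lattice.mp hx s)) hs
    rwa [show c - -(μ * (s : ℕ)) + (μ - μ * (s : ℕ)) = c + μ by ring] at this
  -- The height `μ n` of the Newton polygon is a difference of two integral valuations; this
  -- integrality makes the dimension a natural number.
  refine ⟨n, b, ⟨v0 (a n) - v0 (a 0), by push_cast; rw [hend]; ring⟩, fun c x => ⟨fun hx => ?_,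
    hΦ c x⟩⟩
  simpa using hΦ' _ _ hx

/-- With `F a b = ⌈c + μ a - ν b⌉` the summand is `F a b - F (a + 1) (b + 1)`. Split into a step in
`b` and a step in `a`, it telescopes in each direction; as `ν m` and `μ n` are integers, they come
out of the ceilings and the dependence on `c` disappears. -/
theorem sum_ceil_sub {μ ν : ℚ} {n m : ℕ} {A B : ℤ} (hA : (A : ℚ) = μ * n) (hB : (B : ℚ) = ν * m)
    (c : ℚ) : ∑ s : Fin n × Fin m, (⌈c - (-(μ * s.1) + ν * s.2)⌉ -
      ⌈c - (ν - μ) - (-(μ * s.1) + ν * s.2)⌉) = n * B - m * A := by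
  let F : ℕ → ℕ → ℤ := fun a b => ⌈c + μ * a - ν * b⌉
  have h1 : ∀ a, ∑ b : Fin m, (F a b - F a (b + 1)) = B := fun a => by
    rw [← Finset.sum_range fun b => F a b - F a (b + 1), Finset.sum_range_sub']
    simp only [F]
    rw [← hB, Int.ceil_sub_intCast]
    simp
  have h2 : ∀ b, ∑ a : Fin n, (F a b - F (a + 1) b) = -A := fun b => by
    rw [← Finset.sum_range fun a => F a b - F (a + 1) b, Finset.sum_range_sub']
    simp only [F]
    rw [← hA, show c + (A : ℚ) - ν * b = c + μ * (0 : ℕ) - ν * b + (A : ℤ) by push_cast; ring,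
      Int.ceil_add_intCast]
    simp
  have h3 : ∀ s : Fin n × Fin m, ⌈c - (-(μ * s.1) + ν * s.2)⌉ -
      ⌈c - (ν - μ) - (-(μ * s.1) + ν * s.2)⌉ = (F s.1 s.2 - F s.1 (s.2 + 1)) +
        (F s.1 (s.2 + 1) - F (s.1 + 1) (s.2 + 1)) := fun s => by
    rw [sub_add_sub_cancel]
    simp only [F]
    congr 2
    · ring
    · push_cast; ring
  simp only [h3]
  rw [Finset.sum_add_distrib, Fintype.sum_prod_type, Fintype.sum_prod_type_right]
  simp only
  simp only [h1, h2]
  simp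
  ring

/-- For slopes `μ < ν`, the operator `Φ - 1` on `Hom(M, N)` is injective with a finite dimensional
cokernel. -/
theorem IsPureIsoclinic.exists_hom_complement {N : DiffMod.{0, v} Ka (sigmaQ q hq).toRingEquiv}
    {μ ν : ℚ} (hM : IsPureIsoclinic M ν) (hN : IsPureIsoclinic N μ) (hlt : μ < ν) :
    ∃ d : ℕ, (d : ℚ) = Module.finrank Ka N * Module.finrank Ka M * (ν - μ) ∧
      ∃ v : Fin d → (M →ₗ[Ka] N),
        Function.Bijective fun p : (Fin d → ℂ) × (M →ₗ[Ka] N) =>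
          ∑ l, algebraMap ℂ Ka (p.1 l) • v l + (homΦ M N p.2 - p.2) := by
  obtain ⟨m, b', ⟨B, hB⟩, hΦM⟩ := hM.exists_basis
  obtain ⟨n, b, ⟨A, hA⟩, hΦN⟩ := hN.exists_basis
  have hΦM' : ∀ c x, M.Φ.symm x ∈ lattice b' (fun a => -(ν * a)) (c + ν) ↔
      x ∈ lattice b' (fun a => -(ν * a)) c := fun c x => by
    rw [← hΦM, M.Φ.apply_symm_apply, add_sub_cancel_right]
  let e : (M →ₗ[Ka] N) ≃ₗ[Ka] (Fin n × Fin m → Ka) :=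
    (LinearMap.toMatrix b' b).trans (LinearEquiv.curry Ka Ka (Fin n) (Fin m)).symm
  have he : ∀ f s, e f s = b.equivFun (f (b' s.2)) s.1 := fun f s =>
    LinearMap.toMatrix_apply b' b f s.1 s.2
  -- The elementary map at position `(s, t)` sends a vector of valuation `-ν t` to one of valuation
  -- `-μ s`.
  let β : Fin n × Fin m → ℚ := fun s => -(μ * s.1) + ν * s.2
  -- The coordinate valuation is the operator valuation: it measures by how much `f` raises
  -- valuations.
  have hval : ∀ c f, e f ∈ vge β c ↔ ∀ c', ∀ x ∈ lattice b' (fun a => -(ν * a)) c',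
      f x ∈ lattice b (fun a => -(μ * a)) (c' + c) := by
    intro c f
    rw [mem_vge_iff]
    constructor
    · intro h c' x hx
      refine mem_of_forall_basis (b := b') f.toAddMonoidHom fun t => ?_
      change f (_ • b' t) ∈ _
      rw [map_smul]
      have h1 : f (b' t) ∈ lattice b (fun a => -(μ * a)) (c - ν * t) := by
        rw [mem_lattice]
        intro s
        have := h (s, t)
        rw [he] at this
        simp only [β] at this
        rwa [show c - ν * t - -(μ * s) = c - (-(μ * s) + ν * t) by ring]
      have := smul_mem_lattice (mem_lattice.mp hx t) h1
      rwa [show c' - -(ν * t) + (c - ν * t) = c' + c by ring] at this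
    · intro h s
      have := mem_lattice.mp (h _ _ (basis_mem_lattice (b := b') (β := fun a => -(ν * a)) s.2)) s.1
      rw [he]
      simp only [β]
      rwa [show -(ν * s.2) + c - -(μ * s.1) = c - (-(μ * s.1) + ν * s.2) by ring] at this
  let Φ : (Fin n × Fin m → Ka) ≃+ (Fin n × Fin m → Ka) :=
    (e.symm.toAddEquiv.trans (homΦ M N)).trans e.toAddEquiv
  have hΦe : ∀ f, Φ (e f) = e (homΦ M N f) := fun f => by
    change e (homΦ M N (e.symm (e f))) = _
    rw [e.symm_apply_apply]
  have hΦ : ∀ (a : Ka) x, Φ (a • x) = sigmaQ q hq a • Φ x := fun a x => by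
    obtain ⟨f, rfl⟩ := e.surjective x
    rw [← map_smul, hΦe, hΦe, homΦ_smul, map_smul]
    rfl
  -- In `f ↦ Φ f Φ⁻¹` the inverse on `M` contributes `ν` and the automorphism of `N` contributes
  -- `-μ`.
  have hv : ∀ c x, Φ x ∈ vge β (c + (ν - μ)) ↔ x ∈ vge β c := fun c x => by
    obtain ⟨f, rfl⟩ := e.surjective x
    rw [hΦe, hval, hval]
    constructor
    · intro h c' x hx
      have := h (c' - ν) (M.Φ x) ((hΦM _ _).2 hx)
      rw [homΦ_apply, M.Φ.symm_apply_apply, show c' - ν + (c + (ν - μ)) = c' + c - μ by ring,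
        hΦN] at this
      exact this
    · intro h c' x hx
      rw [homΦ_apply, show c' + (c + (ν - μ)) = c' + ν + c - μ by ring, hΦN]
      exact h _ _ ((hΦM' _ _).2 hx)
  obtain ⟨d, hd, v, hbij⟩ := exists_complement hΦ β (sub_pos.mpr hlt) hv (D := n * B - m * A)
    fun c => sum_ceil_sub hA hB c
  refine ⟨d, ?_, fun l => e.symm (v l), ?_⟩
  · rw [Module.finrank_eq_card_basis b, Module.finrank_eq_card_basis b', Fintype.card_fin,
      Fintype.card_fin, ← Int.cast_natCast d, hd]
    push_cast
    rw [hA, hB]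
    ring
  · have h1 := e.symm.bijective.comp (hbij.comp
      ((Equiv.refl (Fin d → ℂ)).prodCongr e.toEquiv).bijective)
    convert h1 using 1
    funext p
    simp only [Function.comp, map_add, map_sub, map_sum, Equiv.prodCongr_apply, Prod.map,
      Equiv.refl_apply, LinearEquiv.coe_toEquiv, hΦe, e.symm_apply_apply]
    congr 1
    refine Finset.sum_congr rfl fun l _ => ?_
    rw [← map_smul, algebraMap_smul]

end isoclinic

/-! ### Complements after extension of scalars to `A`. -/

section baseChange
attribute [local instance] Algebra.TensorProduct.rightAlgebra

section abstract
variable {K : Type*} [CommRing K] [Algebra ℂ K] {A : Type*} [CommRing A] [Algebra ℂ A]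
  {H : Type*} [AddCommMonoid H] [Module K H] [Module ℂ H] [IsScalarTower ℂ K H]
  {R : Type*} [CommRing R] [Algebra K R] (ρ : K ⊗[ℂ] A ≃ₗ[K] R)
  {H' : Type*} [AddCommMonoid H'] [Module K H'] [Module R H'] [IsScalarTower K R H']

/-- The identification of `H ⊗_ℂ A` with the base change of `H` from `K` to `R ≃ K ⊗ A`. -/
noncomputable def tensorEquivBaseChange {j : H →ₗ[K] H'} (hj : IsBaseChange R j) :
    H ⊗[ℂ] A ≃+ H' :=
  ((((TensorProduct.AlgebraTensorModule.cancelBaseChange ℂ K K H A).symm.trans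
    (LinearEquiv.lTensor H ρ)).trans
      (TensorProduct.comm K H R)).toAddEquiv).trans hj.equiv.toAddEquiv

theorem tensorEquivBaseChange_tmul {j : H →ₗ[K] H'} (hj : IsBaseChange R j) (x : H)
    (a : A) : tensorEquivBaseChange ρ hj (x ⊗ₜ a) = ρ (1 ⊗ₜ a) • j x := by
  change hj.equiv (TensorProduct.comm K H R (LinearEquiv.lTensor H ρ
      ((TensorProduct.AlgebraTensorModule.cancelBaseChange ℂ K K H A).symm (x ⊗ₜ a)))) = _
  rw [TensorProduct.AlgebraTensorModule.cancelBaseChange_symm_tmul, LinearEquiv.lTensor_tmul,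
    TensorProduct.comm_tmul, IsBaseChange.equiv_tmul]

/-- If `(c, x) ↦ ∑ c_l v_l + δ x` is bijective, then so is its base change to `A`. -/
theorem bijective_baseChange {j : H →ₗ[K] H'} (hj : IsBaseChange R j) (δ : H →ₗ[ℂ] H)
    (δ' : H' →+ H')
    (hδ : ∀ (a : A) x, δ' (ρ (1 ⊗ₜ a) • j x) = ρ (1 ⊗ₜ a) • j (δ x)) {d : ℕ}
    (v : Fin d → H) (h : Function.Bijective fun p : (Fin d → ℂ) × H =>
      ∑ l, p.1 l • v l + δ p.2) :
    Function.Bijective fun p : (Fin d → A) × H' =>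
      ∑ l, ρ (1 ⊗ₜ p.1 l) • j (v l) + δ' p.2 := by
  let L₀ : (Fin d → ℂ) × H →ₗ[ℂ] H :=
    (Fintype.linearCombination ℂ v).coprod δ
  have hL₀ : ∀ p, L₀ p = ∑ l, p.1 l • v l + δ p.2 := fun p => rfl
  let L : ((Fin d → ℂ) × H) ≃ₗ[ℂ] H := LinearEquiv.ofBijective L₀ h
  let E₁ : (Fin d → ℂ) ⊗[ℂ] A ≃+ (Fin d → A) :=
    ((TensorProduct.comm ℂ (Fin d → ℂ) A).trans
      (TensorProduct.piScalarRight ℂ ℂ A (Fin d))).toAddEquiv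
  have hE₁ : ∀ c a, E₁ (c ⊗ₜ a) = fun l => c l • a := fun c a => by
    change TensorProduct.piScalarRight ℂ ℂ A (Fin d) (TensorProduct.comm ℂ (Fin d → ℂ) A (c ⊗ₜ a))
      = _
    rw [TensorProduct.comm_tmul, TensorProduct.piScalarRight_apply,
      TensorProduct.piScalarRightHom_tmul]
  let E : ((Fin d → ℂ) × H) ⊗[ℂ] A ≃+ (Fin d → A) × H' :=
    (TensorProduct.prodLeft ℂ ℂ (Fin d → ℂ) H A).toAddEquiv.trans
      (E₁.prodCongr (tensorEquivBaseChange ρ hj))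
  have hE : ∀ c x a, E ((c, x) ⊗ₜ a) = (fun l => c l • a, ρ (1 ⊗ₜ a) • j x) :=
      fun c x a => by
    change (E₁.prodCongr (tensorEquivBaseChange ρ hj))
      (TensorProduct.prodLeft ℂ ℂ (Fin d → ℂ) H A ((c, x) ⊗ₜ a)) = _
    rw [TensorProduct.prodLeft_tmul]
    exact Prod.ext (hE₁ c a) (tensorEquivBaseChange_tmul ρ hj x a)
  let F : (Fin d → A) × H' →+ H' :=
    { toFun := fun p => ∑ l, ρ (1 ⊗ₜ p.1 l) • j (v l) + δ' p.2
      map_zero' := by simp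
      map_add' := fun p p' => by
        simp only [Prod.fst_add, Prod.snd_add, Pi.add_apply, TensorProduct.tmul_add, add_smul,
          Finset.sum_add_distrib, map_add]
        abel }
  have hscal : ∀ (c : ℂ) (a : A) (x : H), ρ (1 ⊗ₜ (c • a)) • j x =
      ρ (1 ⊗ₜ a) • j (c • x) := fun c a x => by
    have e : (1 : K) ⊗ₜ[ℂ] (c • a) = algebraMap ℂ K c • ((1 : K) ⊗ₜ[ℂ] a) := by
      rw [algebraMap_smul, TensorProduct.tmul_smul]
    rw [e, ← algebraMap_smul K c x, map_smul, map_smul, smul_assoc, smul_comm]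
  -- The map `δ` is only `ℂ`-linear, so the tensor product is taken over `ℂ`. Up to the
  -- identifications of source and target, the map in question is `L ⊗ A`.
  have key : ∀ t, F (E t) = tensorEquivBaseChange ρ hj (LinearEquiv.rTensor A L t) := by
    intro t
    induction t with
    | zero => simp
    | add x y hx hy => simp only [map_add, hx, hy]
    | tmul p a =>
      obtain ⟨c, x⟩ := p
      rw [hE, LinearEquiv.rTensor_tmul, tensorEquivBaseChange_tmul]
      change ∑ l, ρ (1 ⊗ₜ (c l • a)) • j (v l) +
        δ' (ρ (1 ⊗ₜ a) • j x) =
        ρ (1 ⊗ₜ a) • j (∑ l, c l • v l + δ x)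
      simp only [hscal, hδ, map_add, map_sum, smul_add, Finset.smul_sum]
  have hF : Function.Bijective (F ∘ E) := by
    rw [show F ∘ E = tensorEquivBaseChange ρ hj ∘ LinearEquiv.rTensor A L from funext key]
    exact (tensorEquivBaseChange ρ hj).bijective.comp (LinearEquiv.rTensor A L).bijective
  exact (Function.Bijective.of_comp_iff F E.bijective).mp hF

omit [Module ℂ H] [IsScalarTower ℂ K H] in
-- Restricting scalars along `ℂ → K` provides the `ℂ`-structure, so that the result applies to
-- spaces `Hom(M, N)` given with a `K`-structure only.
theorem bijective_baseChange_of_algebraMap {j : H →ₗ[K] H'} (hj : IsBaseChange R j)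
    (δ : H →+ H) (hδc : ∀ (c : ℂ) x, δ (algebraMap ℂ K c • x) = algebraMap ℂ K c • δ x)
    (δ' : H' →+ H')
    (hδ : ∀ (a : A) x, δ' (ρ (1 ⊗ₜ a) • j x) = ρ (1 ⊗ₜ a) • j (δ x)) {d : ℕ}
    (v : Fin d → H) (h : Function.Bijective fun p : (Fin d → ℂ) × H =>
      ∑ l, algebraMap ℂ K (p.1 l) • v l + δ p.2) :
    Function.Bijective fun p : (Fin d → A) × H' =>
      ∑ l, ρ (1 ⊗ₜ p.1 l) • j (v l) + δ' p.2 := by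
  let _ : Module ℂ H := Module.compHom _ (algebraMap ℂ K)
  have : IsScalarTower ℂ K H := ⟨fun a b x => by rw [Algebra.smul_def, mul_smul]; rfl⟩
  exact bijective_baseChange ρ hj { δ with map_smul' := hδc } δ' hδ v h

variable {M N : Type*} [AddCommGroup M] [Module K M] [AddCommGroup N] [Module K N]

/-- For finitely presented `M` and flat `R`, forming `Hom` commutes with base change, so the
abstract statement applies with `δ = θ - 1`. -/
theorem bijective_baseChangeHom [Module.Flat K R] [Module.FinitePresentation K M]
    (θ : (M →ₗ[K] N) →+ (M →ₗ[K] N))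
    (hθc : ∀ (c : ℂ) x, θ (algebraMap ℂ K c • x) = algebraMap ℂ K c • θ x)
    (θ' : (R ⊗[K] M →ₗ[R] R ⊗[K] N) →+ (R ⊗[K] M →ₗ[R] R ⊗[K] N))
    (hθ : ∀ (a : A) (f : M →ₗ[K] N), θ' (ρ (1 ⊗ₜ a) • f.baseChange R) =
      ρ (1 ⊗ₜ a) • (θ f).baseChange R) {d : ℕ}
    (v : Fin d → (M →ₗ[K] N)) (h : Function.Bijective fun p : (Fin d → ℂ) × (M →ₗ[K] N) =>
      ∑ l, algebraMap ℂ K (p.1 l) • v l + (θ p.2 - p.2)) :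
    Function.Bijective fun p : (Fin d → A) × (R ⊗[K] M →ₗ[R] R ⊗[K] N) =>
      ∑ l, ρ (1 ⊗ₜ p.1 l) • (v l).baseChange R + (θ' p.2 - p.2) := by
  let δ : (M →ₗ[K] N) →+ (M →ₗ[K] N) :=
    ⟨⟨fun f => θ f - f, by rw [map_zero, sub_zero]⟩,
      fun f g => by simp only [map_add, add_sub_add_comm]⟩
  let δ' : (R ⊗[K] M →ₗ[R] R ⊗[K] N) →+ (R ⊗[K] M →ₗ[R] R ⊗[K] N) :=
    ⟨⟨fun f => θ' f - f, by rw [map_zero]; exact LinearMap.ext fun x => sub_zero (0 : R ⊗[K] N)⟩,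
      fun f g => by 
        dsimp only
        rw [map_add]
        exact LinearMap.ext fun x => add_sub_add_comm (θ' f x) (θ' g x) (f x) (g x)⟩
  refine bijective_baseChange_of_algebraMap ρ
    (Module.FinitePresentation.isBaseChange_map K M N R) δ (fun c x => ?_) δ' (fun a f => ?_) v h
  · change θ _ - _ = _ • (θ x - x)
    rw [hθc, smul_sub]
  · change θ' (ρ (1 ⊗ₜ a) • f.baseChange R) - ρ (1 ⊗ₜ a) • f.baseChange R =
      ρ (1 ⊗ₜ a) • (θ f - f).baseChange R
    rw [hθ, LinearMap.baseChange_sub]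
    exact LinearMap.ext fun x => (smul_sub (ρ (1 ⊗ₜ a)) ((θ f).baseChange R x)
      (f.baseChange R x)).symm

end abstract

variable {K : Type} [Field K] [Algebra ℂ K] {σ : K ≃ₐ[ℂ] K}

/-- The extension of scalars of a linear map, from `K` to `A ⊗ K`. -/
noncomputable def extHom (A : Type u) [CommRing A] [Algebra ℂ A] {M N : DiffMod.{0, v} K σ.toRingEquiv}
    (f : M →ₗ[K] N) : M.ext σ A →ₗ[A ⊗[ℂ] K] N.ext σ A :=
  f.baseChange (A ⊗[ℂ] K)

theorem extHom_tmul (A : Type u) [CommRing A] [Algebra ℂ A] {M N : DiffMod.{0, v} K σ.toRingEquiv}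
    (f : M →ₗ[K] N) (a : A ⊗[ℂ] K) (x : M) :
    extHom A f (a ⊗ₜ[K] x : (A ⊗[ℂ] K) ⊗[K] M) = (a ⊗ₜ[K] f x : (A ⊗[ℂ] K) ⊗[K] N) := rfl

/-- Writing the argument as `Φ t` removes the inverse in the conjugation and leaves an identity to
test on pure tensors. -/
theorem homΦ_extHom (A : Type u) [CommRing A] [Algebra ℂ A] {M N : DiffMod.{0, v} K σ.toRingEquiv}
    (f : M →ₗ[K] N) : homΦ (M.ext σ A) (N.ext σ A) (extHom A f) = extHom A (homΦ M N f) := by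
  refine LinearMap.ext fun t => ?_
  obtain ⟨t, rfl⟩ := (M.ext σ A).Φ.surjective t
  rw [homΦ_apply, AddEquiv.symm_apply_apply]
  refine TensorProduct.induction_on (motive := fun t : (A ⊗[ℂ] K) ⊗[K] M =>
    (N.ext σ A).Φ (extHom A f t) = extHom A (homΦ M N f) ((M.ext σ A).Φ t)) t ?_ (fun a x => ?_)
    (fun x y hx hy => ?_)
  · exact (congrArg _ (map_zero (extHom A f))).trans ((map_zero _).trans
      ((congrArg _ (map_zero (M.ext σ A).Φ)).trans (map_zero (extHom A (homΦ M N f)))).symm)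
  · rw [extHom_tmul]
    refine (DiffMod.tensor_Φ_tmul (extAut_algebraMap σ A) N a (f x)).trans ?_
    refine Eq.trans ?_ (congrArg (extHom A (homΦ M N f))
      (DiffMod.tensor_Φ_tmul (extAut_algebraMap σ A) M a x)).symm
    rw [extHom_tmul, homΦ_apply, AddEquiv.symm_apply_apply]
  · refine (congrArg _ (map_add (extHom A f) x y)).trans ((map_add _ _ _).trans
      ((congrArg₂ _ hx hy).trans ?_))
    exact (map_add (extHom A (homΦ M N f)) _ _).symm.trans
      (congrArg _ (map_add (M.ext σ A).Φ x y).symm)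

/-- Since `1 ⊗ σ` fixes `a ⊗ 1`, conjugation by `Φ` is `A`-linear and is the base change from `ℂ` to
`A` of the conjugation on `Hom(M, N)`. -/
theorem bijective_extHom (A : Type u) [CommRing A] [Algebra ℂ A]
    {M N : DiffMod.{0, v} K σ.toRingEquiv} {d : ℕ} (v : Fin d → (M →ₗ[K] N))
    (h : Function.Bijective fun p : (Fin d → ℂ) × (M →ₗ[K] N) =>
      ∑ l, algebraMap ℂ K (p.1 l) • v l + (homΦ M N p.2 - p.2)) :
    Function.Bijective fun p : (Fin d → A) × (M.ext σ A →ₗ[A ⊗[ℂ] K] N.ext σ A) =>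
      ∑ l, (p.1 l ⊗ₜ[ℂ] (1 : K)) • extHom A (v l) +
        (homΦ (M.ext σ A) (N.ext σ A) p.2 - p.2) := by
  have : Module.FinitePresentation K M := Module.finitePresentation_of_finite K M
  have hθc : ∀ (c : ℂ) (f : M →ₗ[K] N), (homΦ M N).toAddMonoidHom (algebraMap ℂ K c • f) =
      algebraMap ℂ K c • (homΦ M N).toAddMonoidHom f := fun c f =>
    (homΦ_smul _ f).trans (congrArg (· • homΦ M N f) (σ.commutes c))
  let θ' : ((A ⊗[ℂ] K) ⊗[K] M →ₗ[A ⊗[ℂ] K] (A ⊗[ℂ] K) ⊗[K] N) →+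
      ((A ⊗[ℂ] K) ⊗[K] M →ₗ[A ⊗[ℂ] K] (A ⊗[ℂ] K) ⊗[K] N) :=
    (homΦ (M.ext σ A) (N.ext σ A)).toAddMonoidHom
  have hθ : ∀ (a : A) (f : M →ₗ[K] N), θ' ((a ⊗ₜ[ℂ] (1 : K)) • f.baseChange (A ⊗[ℂ] K)) =
      (a ⊗ₜ[ℂ] (1 : K)) • ((homΦ M N).toAddMonoidHom f).baseChange (A ⊗[ℂ] K) := fun a f => by
    refine (homΦ_smul (M := M.ext σ A) (N := N.ext σ A) (a ⊗ₜ[ℂ] (1 : K)) (extHom A f)).trans ?_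
    rw [homΦ_extHom, extAut_tmul, map_one]
    rfl
  exact bijective_baseChangeHom (Algebra.TensorProduct.commRight ℂ K A).toLinearEquiv _ hθc θ' hθ v h

end baseChange

/-! ### Triangular systems, and filtered modules as unipotent block matrices. -/

/-- A triangular system of equations has a unique solution. -/
theorem existsUnique_triangular {I : Type*} {X : I → Type*} [Nonempty (∀ i, X i)] (m : I → ℕ)
    {n : ℕ} (hm : ∀ i, m i < n) (F : (∀ i, X i) → ∀ i, X i)
    (hF : ∀ x y i, (∀ j, m j < m i → x j = y j) → F x i = F y i) : ∃! x, F x = x := by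
  obtain ⟨x₀⟩ := ‹Nonempty (∀ i, X i)›
  -- After `l` iterations from any starting point, the entries of rank less than `l` are stationary.
  have key : ∀ l : ℕ, ∀ i, m i < l → F (F^[l] x₀) i = F^[l] x₀ i := by
    intro l
    induction l with
    | zero => exact fun i h => absurd h (Nat.not_lt_zero _)
    | succ l ih =>
      intro i hi
      rw [Function.iterate_succ_apply']
      exact hF _ _ i fun j hj => ih j (by omega)
  refine ⟨F^[n] x₀, funext fun i => key n i (hm i), fun y hy => ?_⟩
  have hfix : F (F^[n] x₀) = F^[n] x₀ := funext fun i => key n i (hm i)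
  have : ∀ l : ℕ, ∀ i, m i < l → y i = F^[n] x₀ i := by
    intro l
    induction l with
    | zero => exact fun i h => absurd h (Nat.not_lt_zero _)
    | succ l ih =>
      intro i hi
      rw [← hy, ← hfix]
      exact hF _ _ i fun j hj => ih j (by omega)
  exact funext fun i => this n i (hm i)

section triangular
variable {R : Type u} [CommRing R] {σ : R ≃+* R} {k : ℕ} (Q : Fin k → DiffMod.{u, w} R σ)

/-- Matrices of linear maps between the `Q i`. -/
abbrev BlockMatrix := ∀ i j : Fin k, Q j →ₗ[R] Q i

variable {Q}

/-- The endomorphism of `∏ Q i` with a given matrix. -/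
def act (U : BlockMatrix Q) : (∀ i, Q i) →ₗ[R] (∀ i, Q i) :=
  LinearMap.pi fun i => ∑ j, U i j ∘ₗ LinearMap.proj j

theorem act_apply (U : BlockMatrix Q) (x : ∀ i, Q i) (i : Fin k) :
    act U x i = ∑ j, U i j (x j) := by
  simp [act]

theorem act_single (U : BlockMatrix Q) (j : Fin k) (x : Q j) (i : Fin k) :
    act U (Pi.single j x) i = U i j x := by
  rw [act_apply, Finset.sum_eq_single j]
  · rw [Pi.single_eq_same]
  · intro l _ hl
    rw [Pi.single_eq_of_ne hl, map_zero]
  · simp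

/-- A block matrix is strictly upper triangular. -/
def IsStrict (U : BlockMatrix Q) : Prop := ∀ i j, ¬ i < j → U i j = 0

variable (Q) in
/-- The filtration of `∏ Q i` by its partial products. -/
def stdFil (i : Fin (k + 1)) : Submodule R (∀ i, Q i) where
  carrier := {x | ∀ j : Fin k, i ≤ j.castSucc → x j = 0}
  add_mem' hx hy j h := by rw [Pi.add_apply, hx j h, hy j h, add_zero]
  zero_mem' _ _ := rfl
  smul_mem' a x hx j h := by rw [Pi.smul_apply, hx j h, smul_zero]

theorem mem_stdFil {i : Fin (k + 1)} {x : ∀ i, Q i} :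
    x ∈ stdFil Q i ↔ ∀ j : Fin k, i ≤ j.castSucc → x j = 0 := Iff.rfl

theorem single_mem_stdFil (i : Fin k) (y : Q i) : Pi.single i y ∈ stdFil Q i.succ := by
  intro l hl
  rw [Pi.single_eq_of_ne (Fin.succ_le_castSucc_iff.mp hl).ne']

theorem act_mem_stdFil {U : BlockMatrix Q} (hU : IsStrict U) {i : Fin (k + 1)} {x : ∀ i, Q i}
    (hx : x ∈ stdFil Q i) : act U x ∈ stdFil Q i := by
  intro j hj
  rw [act_apply]
  refine Finset.sum_eq_zero fun l _ => ?_
  by_cases hl : j < l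
  · rw [hx l (hj.trans (Fin.castSucc_lt_castSucc_iff.mpr hl).le), map_zero]
  · rw [hU j l hl, LinearMap.zero_apply]

theorem act_eq_zero {U : BlockMatrix Q} (hU : IsStrict U) {i : Fin k} {x : ∀ i, Q i}
    (hx : x ∈ stdFil Q i.succ) : act U x i = 0 := by
  rw [act_apply]
  refine Finset.sum_eq_zero fun l _ => ?_
  by_cases hl : i < l
  · rw [hx l (Fin.succ_le_castSucc_iff.mpr hl), map_zero]
  · rw [hU i l hl, LinearMap.zero_apply]

/-- Descending induction on the coordinate: besides `x j`, coordinate `j` of `x + U x` involves only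
later entries. The converse direction is what stability under the inverse automorphism needs. -/
theorem add_act_mem_stdFil_iff {U : BlockMatrix Q} (hU : IsStrict U) {i : Fin (k + 1)}
    {x : ∀ i, Q i} : x + act U x ∈ stdFil Q i ↔ x ∈ stdFil Q i := by
  refine ⟨fun h => ?_, fun h => add_mem h (act_mem_stdFil hU h)⟩
  have key : ∀ n : ℕ, ∀ j : Fin k, k - j ≤ n → i ≤ j.castSucc → x j = 0 := by
    intro n
    induction n with
    | zero => intro j hj; omega
    | succ n ih =>
      intro j hj hij
      have h1 := h j hij
      rw [Pi.add_apply, act_apply, Finset.sum_eq_zero, add_zero] at h1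
      · exact h1
      · intro l _
        by_cases hl : j < l
        · rw [ih l (by omega) (hij.trans (Fin.castSucc_lt_castSucc_iff.mpr hl).le), map_zero]
        · rw [hU j l hl, LinearMap.zero_apply]
  exact fun j hj => key k j (by omega) hj

/-- The equation `x + U x = y` is solved by back substitution from the last coordinate; the rank `k
- 1 - i` counts from there. -/
theorem bijective_add_act {U : BlockMatrix Q} (hU : IsStrict U) :
    Function.Bijective fun x : ∀ i, Q i => x + act U x := by
  rw [Function.bijective_iff_existsUnique]
  intro y
  have := existsUnique_triangular (X := fun i => Q i) (fun i : Fin k => k - 1 - (i : ℕ)) (n := k)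
    (fun i => by omega) (fun x i => y i - ∑ j ∈ Finset.Ioi i, U i j (x j)) (fun x x' i h => by
      congr 1
      refine Finset.sum_congr rfl fun j hj => ?_
      rw [h j (by have := Finset.mem_Ioi.mp hj; omega)])
  refine (existsUnique_congr fun x => ?_).mp this
  have h : ∀ i, ∑ j ∈ Finset.Ioi i, U i j (x j) = act U x i := fun i => by
    rw [act_apply]
    refine Finset.sum_subset (Finset.subset_univ _) fun j _ hj => ?_
    rw [hU i j (by simpa using hj), LinearMap.zero_apply]
  simp only [h]
  rw [funext_iff, funext_iff]
  exact forall_congr' fun i => by rw [sub_eq_iff_eq_add, Pi.add_apply, eq_comm]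

/-- The unipotent automorphism `1 + U` of `∏ Q i`. -/
noncomputable def unipotent (U : BlockMatrix Q) (hU : IsStrict U) :
    (∀ i, Q i) ≃ₗ[R] (∀ i, Q i) :=
  LinearEquiv.ofBijective (LinearMap.id + act U) (bijective_add_act hU)

variable (Q) in
/-- The diagonal automorphism of `∏ Q i`. -/
def diagΦ : (∀ i, Q i) ≃+ (∀ i, Q i) := AddEquiv.piCongrRight fun i => (Q i).Φ

@[simp] theorem diagΦ_apply (x : ∀ i, Q i) (i : Fin k) : diagΦ Q x i = (Q i).Φ (x i) := rfl

theorem diagΦ_smul (a : R) (x : ∀ i, Q i) : diagΦ Q (a • x) = σ a • diagΦ Q x :=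
  funext fun i => (Q i).Φ_smul a (x i)

theorem diagΦ_mem_stdFil_iff (i : Fin (k + 1)) (x : ∀ i, Q i) :
    diagΦ Q x ∈ stdFil Q i ↔ x ∈ stdFil Q i := by
  simp only [mem_stdFil, diagΦ_apply, EmbeddingLike.map_eq_zero_iff]

/-- The difference module `∏ Q i` with the automorphism `(1 + U) ∘ diag(Φ_i)`. -/
noncomputable def stdMod (U : BlockMatrix Q) (hU : IsStrict U) : DiffMod.{u, w} R σ :=
  haveI : Module.Projective R (∀ i, Q i) :=
    Module.Projective.of_equiv (DirectSum.linearEquivFunOnFintype R (Fin k) fun i => Q i)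
  { carrier := ∀ i, Q i
    Φ := (diagΦ Q).trans (unipotent U hU).toAddEquiv
    Φ_smul := fun a x => by
      change unipotent U hU (diagΦ Q (a • x)) = σ a • unipotent U hU (diagΦ Q x)
      rw [diagΦ_smul, map_smul] }

variable (Q) in
/-- The projection of the `i`-th step of the filtration to `Q i`. -/
def stdGr (i : Fin k) : stdFil Q i.succ →ₗ[R] Q i :=
  LinearMap.proj i ∘ₗ (stdFil Q i.succ).subtype

theorem stdGr_apply (i : Fin k) (x : stdFil Q i.succ) : stdGr Q i x = (x : ∀ i, Q i) i := rfl

theorem stdGr_eq_zero_iff (i : Fin k) (x : stdFil Q i.succ) :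
    stdGr Q i x = 0 ↔ (x : ∀ i, Q i) ∈ stdFil Q i.castSucc := by
  rw [stdGr_apply, mem_stdFil]
  constructor
  · intro h j hj
    rcases (Fin.castSucc_le_castSucc_iff.mp hj).eq_or_lt with rfl | hlt
    · exact h
    · exact x.2 j (Fin.succ_le_castSucc_iff.mpr hlt)
  · exact fun h => h i le_rfl

/-- The module `∏ Q i` with the automorphism `(1 + U) ∘ diag(Φ_i)`, filtered by the partial
products. -/
noncomputable def stdPair (U : BlockMatrix Q) (hU : IsStrict U) : FilteredPair Q :=
  FilteredPair.ofGr (stdMod U hU) (stdFil Q)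
    ((Submodule.eq_bot_iff _).mpr fun _ hx => funext fun j => hx j (Fin.zero_le _))
    ((Submodule.eq_top_iff').mpr fun x j hj => absurd hj (not_le.mpr (Fin.castSucc_lt_last j)))
    (fun i x hx j hj => hx j ((Fin.castSucc_lt_succ).le.trans hj))
    (fun i x => (add_act_mem_stdFil_iff hU).trans (diagΦ_mem_stdFil_iff i x))
    (stdGr Q)
    (fun i y => ⟨⟨Pi.single i y, single_mem_stdFil i y⟩, by
      change (Pi.single i y : ∀ i, Q i) i = y
      rw [Pi.single_eq_same]⟩)
    stdGr_eq_zero_iff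
    (fun i x => by
      have h : ∀ x ∈ stdFil Q i.succ, (diagΦ Q x + act U (diagΦ Q x)) i = (Q i).Φ (x i) :=
        fun x hx => by
          rw [Pi.add_apply, act_eq_zero hU ((diagΦ_mem_stdFil_iff _ _).mpr hx), add_zero,
            diagΦ_apply]
      exact h x.1 x.2)

/-- A filtered endomorphism of `∏ Q i` inducing the identity on the graded module is unipotent. -/
theorem exists_eq_add_act (f : (∀ i, Q i) →ₗ[R] (∀ i, Q i))
    (hfil : ∀ i, ∀ x ∈ stdFil Q i, f x ∈ stdFil Q i)
    (hgr : ∀ i, ∀ x ∈ stdFil Q i.succ, f x i = x i) :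
    ∃ g : BlockMatrix Q, IsStrict g ∧ ∀ x, f x = x + act g x := by
  let g : BlockMatrix Q := fun i j =>
    if i < j then LinearMap.proj i ∘ₗ f ∘ₗ LinearMap.single R (fun i => Q i) j else 0
  have hg : IsStrict g := fun i j h => if_neg h
  refine ⟨g, hg, fun x => ?_⟩
  suffices h : f = LinearMap.id + act g from LinearMap.congr_fun h x
  refine LinearMap.pi_ext fun j y => funext fun i => ?_
  rw [LinearMap.add_apply, LinearMap.id_apply, Pi.add_apply, act_single]
  have hy := single_mem_stdFil j y
  rcases lt_trichotomy i j with h | rfl | h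
  · rw [Pi.single_eq_of_ne h.ne, zero_add]
    simp only [g, if_pos h]
    rfl
  · rw [hgr i _ hy, hg i i (lt_irrefl i), LinearMap.zero_apply, add_zero]
  · rw [Pi.single_eq_of_ne h.ne', hg i j h.not_gt, LinearMap.zero_apply, add_zero]
    exact hfil _ _ hy i (Fin.succ_le_castSucc_iff.mpr h)

/-- The matrix identity `(1 + g)(1 + u) = (1 + v)(1 + Φ g Φ⁻¹)`. -/
def GaugeRel (g u v : BlockMatrix Q) : Prop :=
  ∀ i j, g i j + u i j + ∑ l, g i l ∘ₗ u l j =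
    v i j + homΦ (Q j) (Q i) (g i j) + ∑ l, v i l ∘ₗ homΦ (Q j) (Q l) (g l j)

theorem diagΦ_act (g : BlockMatrix Q) (x : ∀ i, Q i) :
    diagΦ Q (act g x) = act (fun i j => homΦ (Q j) (Q i) (g i j)) (diagΦ Q x) := by
  funext i
  rw [diagΦ_apply, act_apply, act_apply, map_sum]
  exact Finset.sum_congr rfl fun j _ => by
    rw [homΦ_apply, diagΦ_apply, AddEquiv.symm_apply_apply]

/-- Both products of unipotent maps are expanded into a single block matrix, whose entries are
recovered on vectors supported in one coordinate. -/
theorem gaugeRel_iff (g u v : BlockMatrix Q) : GaugeRel g u v ↔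
    ∀ x, (x + act u x) + act g (x + act u x) =
      (x + act (fun i j => homΦ (Q j) (Q i) (g i j)) x) +
        act v (x + act (fun i j => homΦ (Q j) (Q i) (g i j)) x) := by
  have hcomp : ∀ (a b : BlockMatrix Q) x, act a (act b x) =
      act (fun i j => ∑ l, a i l ∘ₗ b l j) x := fun a b x => by
    funext i
    simp only [act_apply, map_sum, LinearMap.sum_apply, LinearMap.comp_apply]
    exact Finset.sum_comm
  have hadd : ∀ (a b : BlockMatrix Q) x, act a x + act b x = act (a + b) x := fun a b x => by
    funext i
    simp only [act_apply, Pi.add_apply, LinearMap.add_apply, Finset.sum_add_distrib]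
  set θ : BlockMatrix Q := fun i j => homΦ (Q j) (Q i) (g i j) with hθ
  have h1 : ∀ x, (x + act u x) + act g (x + act u x) =
      x + act (g + u + fun i j => ∑ l, g i l ∘ₗ u l j) x := fun x => by
    rw [map_add, hcomp, ← hadd, ← hadd]; abel
  have h2 : ∀ x, (x + act θ x) + act v (x + act θ x) =
      x + act (v + θ + fun i j => ∑ l, v i l ∘ₗ θ l j) x := fun x => by
    rw [map_add, hcomp, ← hadd, ← hadd]; abel
  simp only [h1, h2, add_right_inj]
  constructor
  · intro h x
    have : (g + u + fun i j => ∑ l, g i l ∘ₗ u l j) = v + θ + fun i j => ∑ l, v i l ∘ₗ θ l j :=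
      funext fun i => funext fun j => h i j
    rw [this]
  · intro h i j
    refine LinearMap.ext fun x => ?_
    have := congrFun (h (Pi.single j x)) i
    rw [act_single, act_single] at this
    exact this

/-- A filtered map inducing the identity on the graded module is `1 + g`. With `D` the diagonal
automorphism, the condition `(1 + g)(1 + u)D = (1 + v)D(1 + g)` becomes the gauge relation once `D`
is moved to the right and cancelled. -/
theorem stdPair_equivalent_iff {u v : BlockMatrix Q} (hu : IsStrict u) (hv : IsStrict v) :
    FilteredPair.Equivalent (stdPair u hu) (stdPair v hv) ↔
      ∃ g : BlockMatrix Q, IsStrict g ∧ GaugeRel g u v := by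
  constructor
  · rintro ⟨f, hf, hfil, hgr⟩
    let f' : (∀ i, Q i) →ₗ[R] (∀ i, Q i) :=
      { toFun := f, map_add' := f.map_add, map_smul' := f.map_smul }
    obtain ⟨g, hg, hfg⟩ := exists_eq_add_act f' hfil fun i x hx => hgr i ⟨x, hx⟩
    refine ⟨g, hg, (gaugeRel_iff g u v).mpr fun x => ?_⟩
    obtain ⟨x, rfl⟩ := (diagΦ Q).surjective x
    have h : f' (diagΦ Q x + act u (diagΦ Q x)) =
      diagΦ Q (f' x) + act v (diagΦ Q (f' x)) := hf x
    rw [hfg, hfg, map_add (diagΦ Q), diagΦ_act] at h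
    exact h
  · rintro ⟨g, hg, h⟩
    rw [gaugeRel_iff] at h
    let f : (stdPair u hu).M →ₗ[R] (stdPair v hv).M :=
      { toFun := fun x : ∀ i, Q i => x + act g x
        map_add' := (LinearMap.id + act g).map_add
        map_smul' := (LinearMap.id + act g).map_smul }
    have hfil : ∀ i, ∀ x ∈ stdFil Q i, x + act g x ∈ stdFil Q i := fun i x hx =>
      add_mem hx (act_mem_stdFil hg hx)
    have hcomm : ∀ x, diagΦ Q x + act u (diagΦ Q x) + act g (diagΦ Q x + act u (diagΦ Q x)) =
        diagΦ Q (x + act g x) + act v (diagΦ Q (x + act g x)) := fun x => by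
      rw [map_add (diagΦ Q), diagΦ_act]
      exact h (diagΦ Q x)
    have hgr : ∀ i, ∀ x ∈ stdFil Q i.succ, (x + act g x) i = x i := fun i x hx => by
      rw [Pi.add_apply, act_eq_zero hg hx, add_zero]
    exact ⟨f, hcomm, hfil, fun i x => hgr i x.1 x.2⟩

/-- Every filtered difference module is isomorphic to `∏ Q i` with an upper triangular
automorphism. -/
theorem exists_stdPair_equivalent (X : FilteredPair Q) :
    ∃ (u : BlockMatrix Q) (hu : IsStrict u), FilteredPair.Equivalent (stdPair u hu) X := by
  have hsec : ∀ i, ∃ s : Q i →ₗ[R] X.fil i.succ, ∀ y, X.gr i (s y) = y := fun i => by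
    obtain ⟨s, hs⟩ := Module.projective_lifting_property (X.gr i) LinearMap.id (X.gr_surjective i)
    exact ⟨s, fun y => LinearMap.congr_fun hs y⟩
  choose s hs using hsec
  have hmono : Monotone X.fil := Fin.monotone_iff_le_succ.mpr X.fil_le
  -- The sum of the sections of the graded projections is a filtered, purely linear isomorphism onto
  -- `M`.
  let S : (∀ i, Q i) →ₗ[R] X.M :=
    ∑ i, (X.fil i.succ).subtype ∘ₗ s i ∘ₗ LinearMap.proj i
  have hS : ∀ x, S x = ∑ i, (s i (x i) : X.M) := fun x => by simp [S]
  have hSfil : ∀ i, ∀ x ∈ stdFil Q i, S x ∈ X.fil i := fun i x hx => by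
    rw [hS]
    refine sum_mem fun j _ => ?_
    by_cases hj : i ≤ j.castSucc
    · rw [hx j hj, map_zero]; exact zero_mem _
    · exact hmono (Fin.castSucc_lt_iff_succ_le.mp (not_le.mp hj)) (s j (x j)).2
  have hSgr : ∀ i, ∀ x (hx : x ∈ stdFil Q i.succ), X.gr i ⟨S x, hSfil _ x hx⟩ = x i := by
    intro i x hx
    have : X.gr i (⟨S x, hSfil _ x hx⟩ - s i (x i)) = 0 := by
      rw [X.gr_eq_zero_iff]
      have e : S x - s i (x i) = S (x - Pi.single i (x i)) := by
        rw [map_sub]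
        congr 1
        rw [hS, Finset.sum_eq_single i]
        · rw [Pi.single_eq_same]
        · intro j _ hj
          rw [Pi.single_eq_of_ne hj, map_zero, Submodule.coe_zero]
        · simp
      change S x - s i (x i) ∈ _
      rw [e]
      refine hSfil _ _ fun j hj => ?_
      rcases (Fin.castSucc_le_castSucc_iff.mp hj).eq_or_lt with rfl | hlt
      · simp
      · rw [Pi.sub_apply, Pi.single_eq_of_ne hlt.ne', sub_zero,
          hx j (Fin.succ_le_castSucc_iff.mpr hlt)]
    rw [map_sub, hs, sub_eq_zero] at this
    exact this
  have hinj : Function.Injective S := by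
    rw [injective_iff_map_eq_zero]
    intro x hx
    have key : ∀ i : Fin (k + 1), x ∈ stdFil Q i → x = 0 := by
      intro i
      induction i using Fin.induction with
      | zero => exact fun h => funext fun j => h j (Fin.zero_le _)
      | succ i ih =>
        intro h
        refine ih ((stdGr_eq_zero_iff i ⟨x, h⟩).mp ?_)
        change x i = 0
        rw [← hSgr i x h, X.gr_eq_zero_iff]
        simp [hx]
    exact key (Fin.last k) fun j hj => absurd hj (not_le.mpr (Fin.castSucc_lt_last j))
  have hsurj' : ∀ i : Fin (k + 1), ∀ y ∈ X.fil i, ∃ x ∈ stdFil Q i, S x = y := by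
    intro i
    induction i using Fin.induction with
    | zero =>
      intro y hy
      rw [X.fil_zero, Submodule.mem_bot] at hy
      exact ⟨0, zero_mem _, by rw [map_zero, hy]⟩
    | succ i ih =>
      intro y hy
      have hsing := single_mem_stdFil i (X.gr i ⟨y, hy⟩)
      have h0 : X.gr i (⟨y, hy⟩ - ⟨S _, hSfil _ _ hsing⟩) = 0 := by
        rw [map_sub, hSgr i _ hsing, Pi.single_eq_same, sub_self]
      rw [X.gr_eq_zero_iff] at h0
      obtain ⟨x, hx, e⟩ := ih _ h0
      refine ⟨x + Pi.single i (X.gr i ⟨y, hy⟩), add_mem (fun j hj =>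
        hx j ((Fin.castSucc_lt_succ).le.trans hj)) hsing, ?_⟩
      rw [map_add, e]
      exact sub_add_cancel _ _
  have hsurj : Function.Surjective S := fun y => by
    obtain ⟨x, -, e⟩ := hsurj' (Fin.last k) y (by simp [X.fil_last])
    exact ⟨x, e⟩
  let e := LinearEquiv.ofBijective S ⟨hinj, hsurj⟩
  have he : ∀ y, S (e.symm y) = y := fun y => e.apply_symm_apply y
  have hsymm : ∀ i, ∀ y ∈ X.fil i, e.symm y ∈ stdFil Q i := fun i y hy => by
    obtain ⟨x, hx, rfl⟩ := hsurj' i y hy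
    rwa [show e.symm (S x) = x from e.symm_apply_apply x]
  have hdsymm : ∀ (a : R) x, (diagΦ Q).symm (a • x) = σ.symm a • (diagΦ Q).symm x := fun a x => by
    apply (diagΦ Q).injective
    rw [diagΦ_smul]
    simp
  -- This is `S⁻¹ Φ S D⁻¹`, with `D` the diagonal automorphism. The two twists cancel, so it is
  -- linear; it is the identity on the graded module, hence of the form `1 + u`.
  let W : (∀ i, Q i) →ₗ[R] (∀ i, Q i) :=
    { toFun := fun x => e.symm (X.M.Φ (S ((diagΦ Q).symm x)))
      map_add' := fun x y => by simp only [map_add]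
      map_smul' := fun a x => by
        rw [hdsymm, map_smul, X.M.Φ_smul, RingEquiv.apply_symm_apply, map_smul, RingHom.id_apply] }
  have hWS : ∀ x, S (W (diagΦ Q x)) = X.M.Φ (S x) := fun x => by
    change S (e.symm _) = _
    rw [he, AddEquiv.symm_apply_apply]
  have hWfil : ∀ i, ∀ x ∈ stdFil Q i, W x ∈ stdFil Q i := fun i x hx =>
    hsymm i _ ((X.Φ_mem_iff i _).mpr (hSfil i _
      ((diagΦ_mem_stdFil_iff i _).mp (by rwa [AddEquiv.apply_symm_apply]))))
  obtain ⟨u, hu, hWu⟩ := exists_eq_add_act W hWfil (fun i x hx => by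
    obtain ⟨x, rfl⟩ := (diagΦ Q).surjective x
    have hx' := (diagΦ_mem_stdFil_iff i.succ x).mp hx
    rw [← hSgr i _ (hWfil _ _ hx), diagΦ_apply, ← hSgr i x hx', ← X.gr_Φ]
    congr 1
    exact Subtype.ext (hWS x))
  let S' : (stdPair u hu).M →ₗ[R] X.M :=
    { toFun := S, map_add' := S.map_add, map_smul' := S.map_smul }
  refine ⟨u, hu, S', fun x => ?_, hSfil, fun i x => ?_⟩
  · refine Eq.trans ?_ (hWS x)
    rw [hWu]
    rfl
  · exact hSgr i x.1 x.2

end triangular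

/-! ### Unique normal forms under gauge equivalence. -/

section normalForm
variable {R : Type u} [CommRing R] {σ : R ≃+* R} {k : ℕ} {Q : Fin k → DiffMod.{u, w} R σ}
  {W : Fin k → Fin k → Type*} (ι : ∀ i j, W i j → (Q j →ₗ[R] Q i))

/-- The part of the gauge equation at position `(i, j)` that only involves unknowns at positions
closer to the diagonal. -/
def gaugeRest (u : BlockMatrix Q) (w : ∀ i j, W i j) (g : BlockMatrix Q) : BlockMatrix Q :=
  fun i j => u i j + ∑ l ∈ Finset.Ioo i j, (g i l ∘ₗ u l j -
      ι i l (w i l) ∘ₗ homΦ (Q j) (Q l) (g l j))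

/-- For `i < l < j`, the positions `(i, l)` and `(l, j)` are both strictly nearer the diagonal than
`(i, j)`: this makes the system triangular. -/
theorem gaugeRest_congr {u : BlockMatrix Q} {w w' : ∀ i j, W i j} {g g' : BlockMatrix Q}
    (i j : Fin k) (h : ∀ i' j' : Fin k, (j' : ℕ) - i' < j - i → w i' j' = w' i' j' ∧ g i' j' = g' i' j') :
    gaugeRest ι u w g i j = gaugeRest ι u w' g' i j := by
  unfold gaugeRest
  congr 1
  refine Finset.sum_congr rfl fun l hl => ?_
  have hl' := Finset.mem_Ioo.mp hl
  obtain ⟨h1, h2⟩ := h i l (by omega)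
  rw [h1, h2, (h l j (by omega)).2]

theorem gaugeRest_sum (hzero : ∀ i j, ¬ i < j → ∀ w, ι i j w = 0) {u g : BlockMatrix Q}
    (hu : IsStrict u) (hg : IsStrict g) (w : ∀ i j, W i j) (i j : Fin k) :
    gaugeRest ι u w g i j = u i j +
      (∑ l, g i l ∘ₗ u l j - ∑ l, ι i l (w i l) ∘ₗ homΦ (Q j) (Q l) (g l j)) := by
  unfold gaugeRest
  congr 1
  rw [← Finset.sum_sub_distrib]
  refine Finset.sum_subset (Finset.subset_univ _) fun l _ hl => ?_
  rw [Finset.mem_Ioo, not_and_or] at hl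
  rcases hl with hl | hl
  · rw [hg i l hl, hzero i l hl, LinearMap.zero_comp, LinearMap.zero_comp, sub_zero]
  · rw [hu l j hl, hg l j hl, map_zero, LinearMap.comp_zero, LinearMap.comp_zero, sub_zero]

/-- Strictness restricts the matrix products to `i < l < j`, so the unknowns at `(i, j)` enter only
through the linear left-hand side. On and below the diagonal the relation is trivial. -/
theorem gaugeRel_iff_gaugeRest (hzero : ∀ i j, ¬ i < j → ∀ w, ι i j w = 0) {u g : BlockMatrix Q}
    (hu : IsStrict u) (hg : IsStrict g) (w : ∀ i j, W i j) :
    GaugeRel g u (fun i j => ι i j (w i j)) ↔ ∀ i j, i < j →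
      ι i j (w i j) + (homΦ (Q j) (Q i) (g i j) - g i j) = gaugeRest ι u w g i j := by
  have key : ∀ {G : Type w} [AddCommGroup G] (a b c d e f : G),
      (a + b + c = d + e + f) ↔ d + (e - a) = b + (c - f) := by
    intro G _ a b c d e f
    rw [← sub_eq_zero, ← sub_eq_zero (a := d + (e - a)), ← neg_eq_zero]
    have : -(a + b + c - (d + e + f)) = d + (e - a) - (b + (c - f)) := by abel
    rw [this]
  refine ⟨fun h i j _ => ?_, fun h i j => ?_⟩
  · rw [gaugeRest_sum ι hzero hu hg]
    exact (key _ _ _ _ _ _).mp (h i j)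
  · by_cases hij : i < j
    · have := h i j hij
      rw [gaugeRest_sum ι hzero hu hg] at this
      exact (key _ _ _ _ _ _).mpr this
    · have h0 := gaugeRest_sum ι hzero hu hg w i j
      unfold gaugeRest at h0
      rw [Finset.Ioo_eq_empty hij, Finset.sum_empty, add_right_inj, eq_comm, sub_eq_zero] at h0
      beta_reduce
      rw [h0, hg i j hij, hu i j hij, hzero i j hij, map_zero]

/-- Every triangular automorphism has a unique normal form. -/
theorem existsUnique_normalForm [∀ i j, Inhabited (W i j)]
    (hbij : ∀ i j, i < j → Function.Bijective fun p : W i j × (Q j →ₗ[R] Q i) =>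
      ι i j p.1 + (homΦ (Q j) (Q i) p.2 - p.2))
    (hsub : ∀ i j, ¬ i < j → Subsingleton (W i j)) (hzero : ∀ i j, ¬ i < j → ∀ w, ι i j w = 0)
    {u : BlockMatrix Q} (hu : IsStrict u) : ∃! p : (∀ i j, W i j) × BlockMatrix Q,
      IsStrict p.2 ∧ GaugeRel p.2 u fun i j => ι i j (p.1 i j) := by
  classical
  -- `S` solves the equation at one position. Off the strict upper triangle it returns `(default,
  -- 0)`, so that one fixed-point equation encodes strictness of `g` together with the gauge
  -- relation.
  have hex : ∀ (p : Fin k × Fin k), ∃ S : (Q p.2 →ₗ[R] Q p.1) → W p.1 p.2 × (Q p.2 →ₗ[R] Q p.1),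
      (p.1 < p.2 → ∀ f x, x = S f ↔
        ι p.1 p.2 x.1 + (homΦ (Q p.2) (Q p.1) x.2 - x.2) = f) ∧
      (¬ p.1 < p.2 → ∀ f x, x = S f ↔ x.2 = 0) := by
    intro p
    by_cases h : p.1 < p.2
    · refine ⟨(Equiv.ofBijective _ (hbij p.1 p.2 h)).symm, fun _ f x => ?_, fun h' => absurd h h'⟩
      exact Equiv.eq_symm_apply _
    · refine ⟨fun _ => (default, 0), fun h' => absurd h' h, fun _ f x => ?_⟩
      have := hsub p.1 p.2 h
      exact ⟨fun hx => congrArg Prod.snd hx, fun hx => Prod.ext (Subsingleton.elim _ _) hx⟩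
  choose S hS hS' using hex
  obtain ⟨x, hx, hx'⟩ := existsUnique_triangular
    (X := fun p : Fin k × Fin k => W p.1 p.2 × (Q p.2 →ₗ[R] Q p.1))
    -- The rank is the distance to the diagonal; the truncated subtraction gives rank `0` to every
    -- position with `i ≥ j`, where the value of `S` is constant.
    (fun p => (p.2 : ℕ) - p.1) (n := k) (fun p => by omega)
    (fun x p => S p (gaugeRest ι u (fun i j => (x (i, j)).1) (fun i j => (x (i, j)).2) p.1 p.2))
    (fun x y p h => congrArg (S p) (gaugeRest_congr ι p.1 p.2 fun i j hij => by
      rw [h (i, j) hij]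
      exact ⟨rfl, rfl⟩))
  have hiff : ∀ (w : ∀ i j, W i j) (g : BlockMatrix Q),
      (∀ p : Fin k × Fin k, (w p.1 p.2, g p.1 p.2) = S p (gaugeRest ι u w g p.1 p.2)) ↔
        IsStrict g ∧ GaugeRel g u fun i j => ι i j (w i j) := by
    intro w g
    constructor
    · intro h
      have hg : IsStrict g := fun i j hij => (hS' (i, j) hij _ _).mp (h (i, j))
      exact ⟨hg, (gaugeRel_iff_gaugeRest ι hzero hu hg w).mpr fun i j hij =>
        (hS (i, j) hij _ _).mp (h (i, j))⟩
    · rintro ⟨hg, h⟩ ⟨i, j⟩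
      by_cases hij : i < j
      · exact (hS (i, j) hij _ _).mpr ((gaugeRel_iff_gaugeRest ι hzero hu hg w).mp h i j hij)
      · exact (hS' (i, j) hij _ _).mpr (hg i j hij)
  refine ⟨(fun i j => (x (i, j)).1, fun i j => (x (i, j)).2),
    (hiff _ _).mp fun p => (congrFun hx p).symm, fun p hp => ?_⟩
  have := hx' (fun q => (p.1 q.1 q.2, p.2 q.1 q.2))
    (funext fun q => ((hiff p.1 p.2).mpr hp q).symm)
  refine Prod.ext (funext fun i => funext fun j => ?_) (funext fun i => funext fun j => ?_)
  · exact congrArg Prod.fst (congrFun this (i, j))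
  · exact congrArg Prod.snd (congrFun this (i, j))

/-- A matrix in normal form is its own normal form, through `g = 0`; an equivalence with another one
would be a second normal form. Surjectivity is existence. -/
theorem bijective_normalForm [∀ i j, Inhabited (W i j)]
    (hbij : ∀ i j, i < j → Function.Bijective fun p : W i j × (Q j →ₗ[R] Q i) =>
      ι i j p.1 + (homΦ (Q j) (Q i) p.2 - p.2))
    (hsub : ∀ i j, ¬ i < j → Subsingleton (W i j)) (hzero : ∀ i j, ¬ i < j → ∀ w, ι i j w = 0) :
    Function.Bijective fun w : ∀ i j, W i j => (Quotient.mk (FilteredPair.setoid Q)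
      (stdPair (fun i j => ι i j (w i j)) fun i j h => hzero i j h _)) := by
  constructor
  · intro w w' h
    obtain ⟨g, hg, hrel⟩ := (stdPair_equivalent_iff _ _).mp (Quotient.exact h)
    have hu : IsStrict fun i j => ι i j (w i j) := fun i j h => hzero i j h _
    have := (existsUnique_normalForm ι hbij hsub hzero hu).unique
      (y₁ := (w, 0)) (y₂ := (w', g)) ⟨fun _ _ _ => rfl, fun i j => by simp⟩ ⟨hg, hrel⟩
    exact congrArg Prod.fst this
  · intro X
    induction X using Quotient.inductionOn with
    | h X =>
      obtain ⟨u, hu, hX⟩ := exists_stdPair_equivalent X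
      obtain ⟨⟨w, g⟩, ⟨hg, hrel⟩, -⟩ := existsUnique_normalForm ι hbij hsub hzero hu
      exact ⟨w, Quotient.sound
        (((stdPair_equivalent_iff hu _).mpr ⟨g, hg, hrel⟩).symm.trans hX)⟩

end normalForm

/-! ### Naturality in `A` and representability. -/

section functor
attribute [local instance] Algebra.TensorProduct.rightAlgebra

variable {K : Type} [Field K] [Algebra ℂ K] {σ : K ≃ₐ[ℂ] K}

theorem extTransition_Φ {A B : Type u} [CommRing A] [Algebra ℂ A] [CommRing B] [Algebra ℂ B]
    (φ : A →ₐ[ℂ] B) (M : DiffMod.{0, v} K σ.toRingEquiv) (t : M.ext σ A) :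
    extTransition φ M ((M.ext σ A).Φ t) = (M.ext σ B).Φ (extTransition φ M t) := by
  let := (extMap K φ).toAlgebra
  have := isScalarTower_ext (K := K) φ
  exact transition_Φ (extAut_algebraMap σ A) (extAut_algebraMap σ B) (extMap_extAut σ φ) M t

theorem extTransition_extHom {A B : Type u} [CommRing A] [Algebra ℂ A] [CommRing B] [Algebra ℂ B]
    (φ : A →ₐ[ℂ] B) {M N : DiffMod.{0, v} K σ.toRingEquiv} (f : M →ₗ[K] N) (t : M.ext σ A) :
    extTransition φ N (extHom A f t) = extHom B f (extTransition φ M t) := by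
  refine TensorProduct.induction_on (motive := fun t : (A ⊗[ℂ] K) ⊗[K] M =>
    extTransition φ N (extHom A f t) = extHom B f (extTransition φ M t)) t ?_ (fun a x => ?_)
    (fun x y hx hy => ?_)
  · exact (congrArg _ (map_zero (extHom A f))).trans ((map_zero (extTransition φ N)).trans
      ((congrArg _ (map_zero (extTransition φ M))).trans (map_zero (extHom B f))).symm)
  · rw [extHom_tmul, extTransition_tmul, extTransition_tmul, extHom_tmul]
  · exact (congrArg _ (map_add (extHom A f) x y)).trans ((map_add (extTransition φ N) _ _).trans
      ((congrArg₂ _ hx hy).trans ((congrArg _ (map_add (extTransition φ M) x y)).trans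
        (map_add (extHom B f) _ _)).symm))

variable {k : ℕ} {P : Fin k → DiffMod.{0, v} K σ.toRingEquiv} {d : Fin k → Fin k → ℕ}
  (b : ∀ i j, Fin (d i j) → (P j →ₗ[K] P i))

/-- The linear combination `∑ c_l ⊗ b_l` as a map `A ⊗ P_j → A ⊗ P_i`. -/
noncomputable def extComb (A : Type u) [CommRing A] [Algebra ℂ A] (i j : Fin k)
    (c : Fin (d i j) → A) : (P j).ext σ A →ₗ[A ⊗[ℂ] K] (P i).ext σ A :=
  ∑ l, (c l ⊗ₜ[ℂ] (1 : K)) • extHom A (b i j l)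

theorem extComb_apply (A : Type u) [CommRing A] [Algebra ℂ A] (i j : Fin k)
    (c : Fin (d i j) → A) (t : (P j).ext σ A) :
    extComb b A i j c t = ∑ l, (c l ⊗ₜ[ℂ] (1 : K)) • extHom A (b i j l) t := by
  simp [extComb, LinearMap.sum_apply]

theorem extTransition_extComb {A B : Type u} [CommRing A] [Algebra ℂ A] [CommRing B] [Algebra ℂ B]
    (φ : A →ₐ[ℂ] B) (i j : Fin k) (c : Fin (d i j) → A) (t : (P j).ext σ A) :
    extTransition φ (P i) (extComb b A i j c t) =
      extComb b B i j (fun l => φ (c l)) (extTransition φ (P j) t) := by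
  rw [extComb_apply, extComb_apply, map_sum]
  refine Finset.sum_congr rfl fun l _ => ?_
  rw [map_smulₛₗ, extMap_tmul, extTransition_extHom]

theorem extComb_eq_zero (hd : ∀ i j, ¬ i < j → d i j = 0) (A : Type u) [CommRing A] [Algebra ℂ A]
    (i j : Fin k) (h : ¬ i < j) (c : Fin (d i j) → A) : extComb b A i j c = 0 := by
  have : IsEmpty (Fin (d i j)) := by rw [hd i j h]; infer_instance
  simp [extComb]

/-- The class of the difference module with matrix `1 + ∑ c_l ⊗ b_l`. -/
noncomputable def normalForm (hd : ∀ i j, ¬ i < j → d i j = 0) (A : Type u) [CommRing A]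
    [Algebra ℂ A] (c : ∀ i j, Fin (d i j) → A) : IsoClasses P A :=
  Quotient.mk (FilteredPair.setoid _)
    (stdPair (fun i j => extComb b A i j (c i j)) fun i j h => extComb_eq_zero b hd A i j h _)

theorem bijective_extNormalForm (hd : ∀ i j, ¬ i < j → d i j = 0)
    (hb : ∀ i j, i < j → Function.Bijective fun p : (Fin (d i j) → ℂ) × (P j →ₗ[K] P i) =>
      ∑ l, algebraMap ℂ K (p.1 l) • b i j l + (homΦ (P j) (P i) p.2 - p.2))
    (A : Type u) [CommRing A] [Algebra ℂ A] :
    Function.Bijective (normalForm b hd A) :=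
  have : ∀ i j, Inhabited (Fin (d i j) → A) := fun _ _ => ⟨0⟩
  bijective_normalForm (extComb b A) (fun i j h => bijective_extHom A (b i j) (hb i j h))
    (fun i j h => by rw [hd i j h]; infer_instance) (extComb_eq_zero b hd A)

/-- The maps `b i j l` are defined over `K`, so `φ` acts on the coefficients alone. The
coordinatewise map `φ ⊗ 1` intertwines the two standard modules, and
`FilteredPair.extend_equivalent` turns it into the required equivalence. -/
theorem map_normalForm (hd : ∀ i j, ¬ i < j → d i j = 0) {A B : Type u} [CommRing A]
    [Algebra ℂ A] [CommRing B] [Algebra ℂ B] (φ : A →ₐ[ℂ] B) (c : ∀ i j, Fin (d i j) → A) :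
    IsoClasses.map P φ (normalForm b hd A c) = normalForm b hd B fun i j l => φ (c i j l) := by
  let T : (∀ i, (P i).ext σ A) → ∀ i, (P i).ext σ B := fun x i => extTransition φ (P i) (x i)
  have hTadd : ∀ x y, T (x + y) = T x + T y := fun x y => funext fun i => map_add _ _ _
  have hTsmul : ∀ (a : A ⊗[ℂ] K) x, T (a • x) = extMap K φ a • T x := fun a x =>
    funext fun i => (extTransition φ (P i)).map_smulₛₗ a (x i)
  have hTfil : ∀ i, ∀ x ∈ stdFil (fun i => (P i).ext σ A) i,
      T x ∈ stdFil (fun i => (P i).ext σ B) i := fun i x hx j hj =>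
    (congrArg _ (hx j hj)).trans (map_zero _)
  have hTΦ : ∀ x, T (diagΦ _ x) = diagΦ _ (T x) := fun x => funext fun i =>
    extTransition_Φ φ (P i) (x i)
  have hTact : ∀ x, T (act (fun i j => extComb b A i j (c i j)) x) =
      act (fun i j => extComb b B i j fun l => φ (c i j l)) (T x) := fun x => funext fun i => by
    change extTransition φ (P i) (act _ x i) = _
    rw [act_apply, act_apply, map_sum]
    exact Finset.sum_congr rfl fun j _ => extTransition_extComb b φ i j (c i j) (x j)
  refine Quotient.sound (FilteredPair.extend_equivalent P φ _ _
    { toFun := T, map_add' := hTadd, map_smul' := hTsmul } (fun x => ?_) hTfil fun i x => ?_)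
  · have h : ∀ x, T (diagΦ _ x + act (fun i j => extComb b A i j (c i j)) (diagΦ _ x)) =
        diagΦ _ (T x) + act (fun i j => extComb b B i j fun l => φ (c i j l)) (diagΦ _ (T x)) :=
      fun x => by rw [hTadd, hTact, hTΦ]
    exact h x
  · rfl

/-- The index set of the coordinates of the normal forms. -/
abbrev CoordIndex (d : Fin k → Fin k → ℕ) : Type := Σ p : Fin k × Fin k, Fin (d p.1 p.2)

/-- The point of `F(A)` with given coordinates. -/
noncomputable def pointOfCoords (hd : ∀ i j, ¬ i < j → d i j = 0) {n : ℕ} (e : CoordIndex d ≃ Fin n)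
    (A : CommAlgCat.{u} ℂ) (ψ : CommAlgCat.of.{u} ℂ (MvPolynomial (ULift.{u} (Fin n)) ℂ) ⟶ A) :
    IsoClasses P A :=
  normalForm b hd A fun i j l => ψ.hom (MvPolynomial.X ⟨e ⟨(i, j), l⟩⟩)

/-- An algebra morphism out of the polynomial ring is an arbitrary tuple of values of the variables,
and tuples parametrize normal forms. -/
theorem bijective_pointOfCoords (hd : ∀ i j, ¬ i < j → d i j = 0)
    (hb : ∀ i j, i < j → Function.Bijective fun p : (Fin (d i j) → ℂ) × (P j →ₗ[K] P i) =>
      ∑ l, algebraMap ℂ K (p.1 l) • b i j l + (homΦ (P j) (P i) p.2 - p.2))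
    {n : ℕ} (e : CoordIndex d ≃ Fin n) (A : CommAlgCat.{u} ℂ) :
    Function.Bijective (pointOfCoords b hd e A) := by
  refine (bijective_extNormalForm b hd hb A).comp (g := normalForm b hd A)
    (f := fun ψ : CommAlgCat.of.{u} ℂ (MvPolynomial (ULift.{u} (Fin n)) ℂ) ⟶ A =>
      fun i j l => ψ.hom (MvPolynomial.X ⟨e ⟨(i, j), l⟩⟩)) ⟨fun ψ ψ' h => ?_, fun c => ?_⟩
  · refine CommAlgCat.hom_ext (MvPolynomial.algHom_ext fun ⟨m⟩ => ?_)
    obtain ⟨⟨⟨i, j⟩, l⟩, rfl⟩ := e.surjective m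
    exact congrFun (congrFun (congrFun h i) j) l
  · refine ⟨CommAlgCat.ofHom (MvPolynomial.aeval fun m =>
      c (e.symm m.down).1.1 (e.symm m.down).1.2 (e.symm m.down).2), ?_⟩
    funext i j l
    refine (MvPolynomial.aeval_X _ _).trans ?_
    exact congrArg (fun s : CoordIndex d => c s.1.1 s.1.2 s.2) (e.symm_apply_apply ⟨(i, j), l⟩)

/-- Once bases of complements of the images of `Φ - 1` are given, the functor `F` is an affine
space. -/
theorem nonempty_isoClassesFunctor_iso (hd : ∀ i j, ¬ i < j → d i j = 0)
    (hb : ∀ i j, i < j → Function.Bijective fun p : (Fin (d i j) → ℂ) × (P j →ₗ[K] P i) =>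
      ∑ l, algebraMap ℂ K (p.1 l) • b i j l + (homΦ (P j) (P i) p.2 - p.2))
    {n : ℕ} (e : CoordIndex d ≃ Fin n) :
    Nonempty (isoClassesFunctor.{u, v} P ≅
        coyoneda.obj (Opposite.op
          (CommAlgCat.of.{u} ℂ (MvPolynomial (ULift.{u} (Fin n)) ℂ))) ⋙
          uliftFunctor.{max (u + 1) (v + 1), u}) := by
  refine ⟨(NatIso.ofComponents (fun A => Equiv.toIso (Equiv.ulift.trans
    (Equiv.ofBijective _ (bijective_pointOfCoords b hd hb e A)))) fun {A B} φ => ?_).symm⟩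
  ext ⟨ψ⟩
  exact (map_normalForm b hd φ.hom _).symm

end functor

end QDiff

/-! ### The representability theorem. -/

theorem mainTheorem1 (q : ℂ) (hq : 1 < ‖q‖) (k : ℕ)
    (P : Fin k → QDiff.DiffMod.{0, v} QDiff.Ka (QDiff.sigmaQ q hq).toRingEquiv)
    (r : Fin k → ℕ) (μ : Fin k → ℚ)
    (hr : ∀ i, Module.finrank QDiff.Ka (P i) = r i)
    (hP : ∀ i, QDiff.IsPureIsoclinic (P i) (μ i))
    (hμ : StrictMono μ) :
    ∃ d : ℕ,
      (d : ℚ) = ∑ p : Fin k × Fin k with p.1 < p.2, (r p.1 : ℚ) * r p.2 * (μ p.2 - μ p.1) ∧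
      Nonempty (QDiff.isoClassesFunctor.{u, v} P ≅
        coyoneda.obj (Opposite.op
          (CommAlgCat.of.{u} ℂ (MvPolynomial (ULift.{u} (Fin d)) ℂ))) ⋙
          uliftFunctor.{max (u + 1) (v + 1), u}) := by
  have hex : ∀ i j : Fin k, ∃ (d : ℕ) (b : Fin d → (P j →ₗ[QDiff.Ka] P i)),
      (i < j → (d : ℚ) = r i * r j * (μ j - μ i) ∧
        Function.Bijective fun p : (Fin d → ℂ) × (P j →ₗ[QDiff.Ka] P i) =>
          ∑ l, algebraMap ℂ QDiff.Ka (p.1 l) • b l + (QDiff.homΦ (P j) (P i) p.2 - p.2)) ∧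
      (¬ i < j → d = 0) := by
    intro i j
    by_cases h : i < j
    · obtain ⟨d, hd, b, hb⟩ := (hP j).exists_hom_complement (hP i) (hμ h)
      rw [hr, hr] at hd
      exact ⟨d, b, fun _ => ⟨hd, hb⟩, fun h' => absurd h h'⟩
    -- No coordinates are attached to positions on or below the diagonal, so the cardinality of
    -- `CoordIndex d` is the sum over `i < j`.
    · exact ⟨0, fun _ => 0, fun h' => absurd h' h, fun _ => rfl⟩
  choose d b hdb hd using hex
  refine ⟨Fintype.card (QDiff.CoordIndex d), ?_, QDiff.nonempty_isoClassesFunctor_iso b hd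
    (fun i j h => (hdb i j h).2) (Fintype.equivFin _)⟩
  rw [Fintype.card_sigma, Finset.sum_filter, Nat.cast_sum]
  refine Finset.sum_congr rfl fun p _ => ?_
  rw [Fintype.card_fin]
  split_ifs with h
  · exact (hdb _ _ h).1
  · rw [hd _ _ h, Nat.cast_zero]
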